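/- **Conventions.** All trees are finite. A *tree invariant* $I$ assigns a real number to every tree, with equal values on isomorphic trees; similarly, an invariant $\rho$ of rooted trees assigns a real number to every rooted tree. The one-vertex rooted tree is denoted by $\bullet$, and $[T_1,\dots,T_k]$ is the rooted tree whose root is joined to the roots of (disjoint copies of) $T_1,\dots,T_k$. For $d\ge 1$, $[d]$ is the star with $d$ vertices rooted at its centre. If $v\ne w$ are leaves of a tree $H$, then $[L_1,\dots,L_k]vHw[R_1,\dots,R_\ell]$ is the tree obtained by merging the root of $[L_1,\dots,L_k]$ with $v$ and the root of $[R_1,\dots,R_\ell]$ with $w$ ($k,\ell\ge 0$). Suppose that $\rho$ satisfies $\rho([T_1,\dots,T_k])=f_\rho(\rho(T_1),\dots,\rho(T_k))$ for all rooted trees $T_1,\dots,T_k$ ($k\ge0$), where $f_\rho$ is symmetric (a function of the multiset of its arguments). We say that $\rho$ satisfies I.1–I.3 if moreover $f_\rho$, with variables ranging over the values of $\rho$, is strictly increasing in each single variable and strictly increasing under addition of further variables, and $\rho(\bullet)<\rho(B)$ for every rooted tree $B$ with more than one vertex; $\rho$ satisfies II.1–II.3 if $f_\rho$ is instead strictly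 decreasing in each single variable and under addition of further variables, and $\rho(\bullet)>\rho(B)$ for every rooted tree $B$ with more than one vertex. The invariant $I$ is *maximum-$\rho$-compatible* if for every tree $H$, any two distinct leaves $v,w$ of $H$, all rooted trees $T_1,\dots,T_r$ with $\rho(T_1)\ge\dots\ge\rho(T_r)$ and every integer $s$ with $r/2\le s\le r$, the maximum of $I$ over $$\mathbb K_s=\{[T_{\sigma(1)},\dots,T_{\sigma(k)}]vHw[T_{\sigma(k+1)},\dots,T_{\sigma(r)}] : \sigma\in\mathbb S_r,\ r-s\le k\le s\}$$ is attained by at least one of $[T_1,\dots,T_s]vHw[T_{s+1},\dots,T_r]$ and $[T_{s+1},\dots,T_r]vHw[T_1,\dots,T_s]$. *Minimum-$\rho$-compatible* is defined in the same way with the minimum. Degree sequences are written in non-increasing order. A sequence $B=(b_1,\dots,b_n)$ majorises $D=(d_1,\dots,d_n)$ if $\sum_{i\le n} b_i=\sum_{i\le n} d_i$ and $\sum_{i\le k}b_i\ge\sum_{i\le k}d_i$ for $1\le k<n$. For the degree sequence $B=(b_1,\dots,b_n)$ of a tree, $\mathbb T_{\triangleleft B}$ is the set of all $n$-vertex trees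 whose degree sequence is majorised by $B$. *Greedy tree $\mathcal G(B)$.* Start with a root $v_1$ and give it $b_1$ neighbours, labelled $v_2,\dots,v_{b_1+1}$. Then, for $i=2,3,\dots,n$ in this order, give $v_i$ exactly $b_i-1$ new neighbours, which receive the next available labels. *$\mathcal M$-tree $\mathcal M(B)$.* Let $(d_1,\dots,d_t)$, $d_1\ge\dots\ge d_t\ge2$, be the part of $B$ formed by the entries that are at least $2$. If $1\le t\le d_t+1$, then $\mathcal M(d_1,\dots,d_t)=[[d_1],\dots,[d_{t-1}],\bullet,\dots,\bullet]$, where the root has degree $d_t$; the root is labelled $v_1$ and the roots of $[d_{t-1}],\dots,[d_1]$ are labelled $v_2,\dots,v_t$. If $t\ge d_t+2$, construct $\mathcal M(d_{d_t},\dots,d_{t-1})$ with its labels, let $v_s$ be the vertex of smallest label that is adjacent to a leaf, merge the root of $[[d_1],\dots,[d_{d_t-1}]]$ with a leaf adjacent to $v_s$, and give the next available labels to the roots of $[d_{d_t-1}],\dots,[d_1]$, in this order. Set $\mathcal M(B)=\mathcal M(d_1,\dots,d_t)$. For $B=(1,1)$ and $B=(0)$, $\mathcal M(B)$ is the only tree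 with degree sequence $B$. **Theorem.** Let $\rho$ be an invariant of rooted trees that satisfies $\rho([T_1,\dots,T_k])=f_\rho(\rho(T_1),\dots,\rho(T_k))$ with a symmetric $f_\rho$, let $I$ be a tree invariant, and let $B$ be the degree sequence of a tree. If $I$ is maximum-$\rho$-compatible, then - (i) if $\rho$ satisfies I.1–I.3, then $\mathcal G(B)\in\mathbb T_{\triangleleft B}$ and $\max\{I(T):T\in\mathbb T_{\triangleleft B}\}=I(\mathcal G(B))$; - (ii) if $\rho$ satisfies II.1–II.3, then $\mathcal M(B)\in\mathbb T_{\triangleleft B}$ and $\max\{I(T):T\in\mathbb T_{\triangleleft B}\}=I(\mathcal M(B))$. If $I$ is minimum-$\rho$-compatible, then (i) and (ii) hold with $\min$ in place of $\max$. -/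

import Mathlib

/-! Finite trees, rooted trees, and the gluing operations on them. -/

/-- A finite tree: a connected acyclic graph on a finite vertex set. -/
structure FinTree where
  V : Type
  fintypeV : Fintype V
  graph : SimpleGraph V
  isTree : graph.IsTree

attribute [instance] FinTree.fintypeV

/-- A finite tree with a distinguished vertex, its root. (Mathlib's `RootedTree` is a kind of
partial order, not a graph.) -/
structure RootedFinTree extends FinTree where
  root : V

namespace FinTree

open scoped Classical in
/-- The degree of a vertex. -/
noncomputable def degree (T : FinTree) (x : T.V) : ℕ := T.graph.degree x

/-- A leaf is a vertex of degree one. -/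
def IsLeaf (T : FinTree) (x : T.V) : Prop := T.degree x = 1

/-- The degree sequence, written in non-increasing order. -/
noncomputable def degreeSeq (T : FinTree) : List ℕ :=
  (Finset.univ.val.map T.degree).sort (· ≥ ·)

/-- The adjacency relation of the graph obtained from the disjoint union of `H` and the trees in
the list `L` by joining the vertex `v` of `H` to the root of every tree in `L`. -/
inductive AttachAdj (H : FinTree) (v : H.V) (L : List RootedFinTree) :
    (H.V ⊕ (Σ i : Fin L.length, (L.get i).V)) →
    (H.V ⊕ (Σ i : Fin L.length, (L.get i).V)) → Prop
  | base {x y : H.V} (h : H.graph.Adj x y) : AttachAdj H v L (.inl x) (.inl y)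
  | branch (i : Fin L.length) {x y : (L.get i).V} (h : (L.get i).graph.Adj x y) :
      AttachAdj H v L (.inr ⟨i, x⟩) (.inr ⟨i, y⟩)
  | down (i : Fin L.length) : AttachAdj H v L (.inl v) (.inr ⟨i, (L.get i).root⟩)
  | up (i : Fin L.length) : AttachAdj H v L (.inr ⟨i, (L.get i).root⟩) (.inl v)

/-- The graph with adjacency relation `AttachAdj`. -/
def attachGraph (H : FinTree) (v : H.V) (L : List RootedFinTree) :
    SimpleGraph (H.V ⊕ (Σ i : Fin L.length, (L.get i).V)) where
  Adj := AttachAdj H v L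
  symm := ⟨by
    intro x y h
    cases h with
    | base h => exact .base h.symm
    | branch i h => exact .branch i h.symm
    | down i => exact .up i
    | up i => exact .down i⟩
  loopless := ⟨by
    intro x h
    cases h with
    | base h => exact H.graph.irrefl h
    | branch i h => exact (L.get i).graph.irrefl h⟩

theorem attachGraph_isTree (H : FinTree) (v : H.V) (L : List RootedFinTree) :
    (attachGraph H v L).IsTree := by
  classical
  have hc : (attachGraph H v L).Connected := by
    have hbase : ∀ x, (attachGraph H v L).Reachable (.inl v) (.inl x) := fun x =>
      (H.isTree.connected v x).map
        (⟨Sum.inl, fun h => AttachAdj.base h⟩ : H.graph →g attachGraph H v L)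
    have hbranch : ∀ i x, (attachGraph H v L).Reachable (.inl v) (.inr ⟨i, x⟩) := fun i x =>
      (SimpleGraph.Adj.reachable (G := attachGraph H v L) (AttachAdj.down i)).trans
        (((L.get i).isTree.connected (L.get i).root x).map
          (⟨fun y => Sum.inr ⟨i, y⟩, fun h => AttachAdj.branch i h⟩ :
            (L.get i).graph →g attachGraph H v L))
    rw [SimpleGraph.connected_iff_exists_forall_reachable]
    refine ⟨.inl v, ?_⟩
    rintro (x | ⟨i, x⟩)
    · exact hbase x
    · exact hbranch i x
  rw [SimpleGraph.isTree_iff_connected_and_card]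
  refine ⟨hc, le_antisymm ?_ hc.card_vert_le_card_edgeSet_add_one⟩
  let F : H.graph.edgeSet ⊕ (Σ i : Fin L.length, Option (L.get i).graph.edgeSet) →
      Sym2 (H.V ⊕ (Σ i : Fin L.length, (L.get i).V)) := fun z =>
    match z with
    | .inl e => e.1.map Sum.inl
    | .inr ⟨i, some e⟩ => e.1.map (fun y => Sum.inr ⟨i, y⟩)
    | .inr ⟨i, none⟩ => s(.inl v, .inr ⟨i, (L.get i).root⟩)
  have hF : (attachGraph H v L).edgeSet ⊆ Set.range F := by
    intro e he
    induction e using Sym2.ind with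
    | _ x y =>
      rw [SimpleGraph.mem_edgeSet] at he
      cases he with
      | @base x y h => exact ⟨.inl ⟨s(x, y), h⟩, rfl⟩
      | @branch i x y h => exact ⟨.inr ⟨i, some ⟨s(x, y), h⟩⟩, rfl⟩
      | down i => exact ⟨.inr ⟨i, none⟩, rfl⟩
      | up i => exact ⟨.inr ⟨i, none⟩, Sym2.eq_swap⟩
  have h1 : Nat.card (attachGraph H v L).edgeSet ≤ Nat.card (H.graph.edgeSet ⊕
      (Σ i : Fin L.length, Option (L.get i).graph.edgeSet)) :=
    (Nat.card_mono (Set.toFinite _) hF).trans (Finite.card_range_le F)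
  have hH := (SimpleGraph.isTree_iff_connected_and_card.mp H.isTree).2
  have hT : ∀ i : Fin L.length, Nat.card (Option (L.get i).graph.edgeSet) =
      Nat.card (L.get i).V := fun i => by
    rw [Finite.card_option]
    exact (SimpleGraph.isTree_iff_connected_and_card.mp (L.get i).isTree).2
  rw [Nat.card_sum, Nat.card_sigma] at h1 ⊢
  simp only [hT] at h1
  omega

/-- The tree obtained from `H` by merging its vertex `v` with the root of `[L₁, …, L_k]`, that is,
by joining `v` to the roots of (disjoint copies of) `L₁, …, L_k`. -/
def attach (H : FinTree) (v : H.V) (L : List RootedFinTree) : FinTree where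
  V := H.V ⊕ (Σ i : Fin L.length, (L.get i).V)
  fintypeV := inferInstance
  graph := attachGraph H v L
  isTree := attachGraph_isTree H v L

/-- The tree `[L₁, …, L_k] v H w [R₁, …, R_l]`. -/
def glue (H : FinTree) (v w : H.V) (L R : List RootedFinTree) : FinTree :=
  (H.attach v L).attach (.inl w) R

/-- The tree with one vertex. -/
def single : FinTree where
  V := Unit
  fintypeV := inferInstance
  graph := ⊥
  isTree := .of_subsingleton

end FinTree

namespace RootedFinTree

/-- The one-vertex rooted tree `•`. -/
def single : RootedFinTree where
  toFinTree := FinTree.single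
  root := ()

/-- The rooted tree `[L₁, …, L_k]`: a root joined to the roots of `L₁, …, L_k`. -/
def bracket (L : List RootedFinTree) : RootedFinTree where
  toFinTree := FinTree.single.attach () L
  root := .inl ()

/-- The star `[d]` with `d` vertices, rooted at its centre: a root and `d - 1` leaves. -/
def star (d : ℕ) : RootedFinTree := bracket (List.replicate (d - 1) single)

end RootedFinTree

/-! Invariants. -/

/-- `I` is an invariant of trees: it takes equal values on isomorphic trees. -/
def IsTreeInvariant (I : FinTree → ℝ) : Prop :=
  ∀ S T : FinTree, Nonempty (S.graph ≃g T.graph) → I S = I T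

/-- `ρ` is an invariant of rooted trees: it takes equal values on rooted trees that are
isomorphic by an isomorphism that preserves the root. -/
def IsRootedTreeInvariant (ρ : RootedFinTree → ℝ) : Prop :=
  ∀ S T : RootedFinTree, (∃ e : S.graph ≃g T.graph, e S.root = T.root) → ρ S = ρ T

/-- `ρ([T₁, …, T_k]) = f(ρ(T₁), …, ρ(T_k))` with a symmetric `f`, that is, a function of the
multiset of its arguments. -/
def HasRecurrenceRule (ρ : RootedFinTree → ℝ) (f : Multiset ℝ → ℝ) : Prop :=
  ∀ L : List RootedFinTree, ρ (RootedFinTree.bracket L) = f ((L.map ρ : List ℝ) : Multiset ℝ)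

/-- `f` is strictly increasing in each single variable and under addition of further variables;
the variables range over the values of `ρ`. -/
def StrictlyIncreasingRule (ρ : RootedFinTree → ℝ) (f : Multiset ℝ → ℝ) : Prop :=
  ∀ s : Multiset ℝ, (∀ z ∈ s, z ∈ Set.range ρ) →
    (∀ x ∈ Set.range ρ, ∀ y ∈ Set.range ρ, x < y → f (x ::ₘ s) < f (y ::ₘ s)) ∧
    (∀ x ∈ Set.range ρ, f s < f (x ::ₘ s))

/-- `f` is strictly decreasing in each single variable and under addition of further variables;
the variables range over the values of `ρ`. -/
def StrictlyDecreasingRule (ρ : RootedFinTree → ℝ) (f : Multiset ℝ → ℝ) : Prop :=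
  ∀ s : Multiset ℝ, (∀ z ∈ s, z ∈ Set.range ρ) →
    (∀ x ∈ Set.range ρ, ∀ y ∈ Set.range ρ, x < y → f (y ::ₘ s) < f (x ::ₘ s)) ∧
    (∀ x ∈ Set.range ρ, f (x ::ₘ s) < f s)

/-- The one-vertex tree is the only rooted tree with the smallest value of `ρ`. -/
def SingleIsStrictMin (ρ : RootedFinTree → ℝ) : Prop :=
  ∀ B : RootedFinTree, 1 < Fintype.card B.V → ρ RootedFinTree.single < ρ B

/-- The one-vertex tree is the only rooted tree with the largest value of `ρ`. -/
def SingleIsStrictMax (ρ : RootedFinTree → ℝ) : Prop :=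
  ∀ B : RootedFinTree, 1 < Fintype.card B.V → ρ B < ρ RootedFinTree.single

/-- The set `𝕂_s` of all trees that arise when the rooted trees in the list `T` are distributed
to the leaves `v` and `w` of `H`, with at most `s` of them at each of the two. -/
def distributions (H : FinTree) (v w : H.V) (T : List RootedFinTree) (s : ℕ) : Set FinTree :=
  {X | ∃ L R : List RootedFinTree, (L ++ R).Perm T ∧
    T.length - s ≤ L.length ∧ L.length ≤ s ∧ X = H.glue v w L R}

/-- Maximum-`ρ`-compatibility of a tree invariant. -/
def MaxCompatible (ρ : RootedFinTree → ℝ) (I : FinTree → ℝ) : Prop :=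
  ∀ (H : FinTree) (v w : H.V), v ≠ w → H.IsLeaf v → H.IsLeaf w →
    ∀ T : List RootedFinTree, T.Pairwise (fun A B => ρ B ≤ ρ A) →
      ∀ s : ℕ, T.length ≤ 2 * s → s ≤ T.length →
        (∀ X ∈ distributions H v w T s, I X ≤ I (H.glue v w (T.take s) (T.drop s))) ∨
        (∀ X ∈ distributions H v w T s, I X ≤ I (H.glue v w (T.drop s) (T.take s)))

/-- Minimum-`ρ`-compatibility of a tree invariant. -/
def MinCompatible (ρ : RootedFinTree → ℝ) (I : FinTree → ℝ) : Prop :=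
  ∀ (H : FinTree) (v w : H.V), v ≠ w → H.IsLeaf v → H.IsLeaf w →
    ∀ T : List RootedFinTree, T.Pairwise (fun A B => ρ B ≤ ρ A) →
      ∀ s : ℕ, T.length ≤ 2 * s → s ≤ T.length →
        (∀ X ∈ distributions H v w T s, I (H.glue v w (T.take s) (T.drop s)) ≤ I X) ∨
        (∀ X ∈ distributions H v w T s, I (H.glue v w (T.drop s) (T.take s)) ≤ I X)

/-! Degree sequences. -/

/-- `B` is the (non-increasing) degree sequence of some tree. -/
def IsTreeDegreeSeq (B : List ℕ) : Prop := ∃ T : FinTree, T.degreeSeq = B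

/-- `B` majorises `D`: equal lengths, equal sums, and every partial sum of `B` is at least the
corresponding partial sum of `D`. -/
def Majorises (B D : List ℕ) : Prop :=
  B.length = D.length ∧ B.sum = D.sum ∧
    ∀ k, 1 ≤ k → k < B.length → (D.take k).sum ≤ (B.take k).sum

/-- The set of trees whose degree sequence is majorised by `B`. -/
def treesMajorisedBy (B : List ℕ) : Set FinTree := {T | Majorises B T.degreeSeq}

/-! The greedy tree and the `M`-tree. -/

/-- A tree together with a list of labelled vertices, in the order of their labels. -/
structure LabelledTree where
  tree : FinTree
  labels : List tree.V

namespace LabelledTree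

/-- A single labelled vertex. -/
def start : LabelledTree := ⟨FinTree.single, [()]⟩

/-- Join the vertex `x` to the roots of the trees in `L`, and label these roots, in the order of
the list, by the next available labels. -/
def graft (S : LabelledTree) (x : S.tree.V) (L : List RootedFinTree) : LabelledTree where
  tree := S.tree.attach x L
  labels := S.labels.map Sum.inl ++
    (List.finRange L.length).map (fun i => Sum.inr ⟨i, (L.get i).root⟩)

/-- Join the vertex `x` to the roots of the trees in `L`, without any new labels. -/
def graftUnlabelled (S : LabelledTree) (x : S.tree.V) (L : List RootedFinTree) : LabelledTree where
  tree := S.tree.attach x L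
  labels := S.labels.map Sum.inl

/-- Give `k` new neighbours to the `i`-th labelled vertex (counted from `0`) and label them. -/
def addNeighbours (S : LabelledTree) (i k : ℕ) : LabelledTree :=
  match S.labels[i]? with
  | some v => S.graft v (List.replicate k RootedFinTree.single)
  | none => S

/-- The greedy algorithm from step `i` on: the `i`-th labelled vertex receives the degree `d` that
is the first of the degrees not used so far. The vertex with label `0` is the root; every other
one already has one neighbour, its parent, when its turn comes. -/
def greedySteps : LabelledTree → ℕ → List ℕ → LabelledTree
  | S, _, [] => S
  | S, i, d :: ds => greedySteps (S.addNeighbours i (if i = 0 then d else d - 1)) (i + 1) ds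

open scoped Classical in
/-- Merge the root of `[L₁, …, L_k]` with a leaf that is adjacent to the labelled vertex `v_s`,
where `s` is the smallest possible label, and label the roots of `L₁, …, L_k` by the next available
labels. (It does not matter which leaf adjacent to `v_s` is taken. If there is no labelled vertex
that is adjacent to a leaf, nothing is changed.) -/
noncomputable def graftAtFirstLeaf (S : LabelledTree) (L : List RootedFinTree) : LabelledTree :=
  match S.labels.find? (fun v => ∃ x, S.tree.graph.Adj v x ∧ S.tree.IsLeaf x) with
  | some v =>
    if h : ∃ x, S.tree.graph.Adj v x ∧ S.tree.IsLeaf x then S.graft h.choose L else S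
  | none => S

/-- The labelled `M`-tree with reduced degree sequence `(d₁, …, d_t)`, where
`d₁ ≥ … ≥ d_t ≥ 2`. The labels increase with the degrees.

* If `1 ≤ t ≤ d_t + 1`, it is `[[d₁], …, [d_{t-1}], [1], …, [1]]` with a root of degree `d_t`; its
  root and the roots of `[d_{t-1}], …, [d₁]` are labelled in this order.
* If `t ≥ d_t + 2`, it arises from the labelled `M`-tree of `(d_{d_t}, …, d_{t-1})` by merging the
  root of `[[d₁], …, [d_{d_t - 1}]]` with a leaf adjacent to the first labelled vertex that is
  adjacent to a leaf; the roots of `[d_{d_t - 1}], …, [d₁]` are labelled in this order.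
* The empty reduced degree sequence belongs to the tree with two vertices. -/
noncomputable def mTree (ds : List ℕ) : LabelledTree :=
  if h : ds = [] then ⟨FinTree.single.attach () [RootedFinTree.single], []⟩
  else
    let t := ds.length
    let dt := ds.getLast h
    if t ≤ dt + 1 then
      (start.graft () ((ds.take (t - 1)).reverse.map RootedFinTree.star)).graftUnlabelled
        (.inl ()) (List.replicate (dt - (t - 1)) RootedFinTree.single)
    else
      (mTree ((ds.take (t - 1)).drop (dt - 1))).graftAtFirstLeaf
        ((ds.take (dt - 1)).reverse.map RootedFinTree.star)
termination_by ds.length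
decreasing_by
  have : 0 < ds.length := List.length_pos_iff.mpr h
  simp only [List.length_drop, List.length_take]
  omega

end LabelledTree

/-- The greedy tree `G(B)`. -/
def greedyTree (B : List ℕ) : FinTree := (LabelledTree.greedySteps LabelledTree.start 0 B).tree

/-- The `M`-tree `M(B)`: the entries of `B` that are at least `2` form the reduced degree sequence.
(For the degree sequence `(0)` it is the tree with one vertex.) -/
noncomputable def mTree (B : List ℕ) : FinTree :=
  if B.length ≤ 1 then FinTree.single
  else (LabelledTree.mTree (B.filter (2 ≤ ·))).tree

-- One operation does all the work: an exchange between two nodes of a tree. The path joining the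
-- two nodes plays the role of `H`, and the remaining branches at both nodes are redistributed.
-- Compatibility says that among all admissible distributions a best one separates the branches by
-- `ρ`: the `s` largest at one node, the others at the other (`exchange`). If `s` is the larger of
-- the two numbers of branches, the degrees do not change; if `s` is one more, a unit of degree
-- moves from the smaller to the larger degree.
--
-- The second choice of `s` reduces the theorem to trees with degree sequence exactly `B`. A
-- sequence majorised by `B` is carried to `B` by unit transfers from a smaller entry to one that is
-- at least as large (`Dominates.exists_transfer`), and each transfer is realised by an exchange
-- that does not lower `I` (`exists_le_of_transfer`).
--
-- For a fixed degree sequence, finished branches of a tree are collapsed to ends of a diagram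
-- (`ConfigTree`), of which essentially only the value of `ρ` matters. Let `K` be a list of ends
-- that `ρ` ranks at one extreme among all branches that can occur, and let a node of degree `|K| +
-- 1` have extremal degree on the matching side: largest degree for the largest ends, smallest
-- degree for the smallest ends. Repeated exchanges between this node and the parents of stray
-- members of `K` collect all of `K` at the node. It then has a single further neighbour, so `[K]`
-- can be collapsed to a new end (`merge`). Each merge removes one node. As the choices are dictated
-- by the degrees alone, every tree with the given degrees is driven, without loss, to the same
-- final tree, which is therefore optimal.
--
-- If the rule is increasing, more and larger branches give larger ones. The node of smallest degree
-- takes the smallest ends, and the new branch exceeds all present ends. The ends thus form a queue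
-- (`queue`), and this is the breadth-first labelling of the greedy tree read backwards
-- (`exists_config_queue`, `greedySteps_iso`).
--
-- If the rule is decreasing, single vertices rank highest and a new branch falls below the whole
-- pool of ends. With `m` the smallest degree, the `m - 1` nodes of largest degree take the largest
-- ends one after the other; the resulting `m - 1` branches are the smallest of all, and the node of
-- degree `m` takes them. The branch so obtained ranks just below the pool and joins it as its last
-- member. This is the recursion of the `M`-tree (`mFill`, `le_mFill`, `exists_isMTree`).
--
-- Minimum-compatibility is the same statement for `-I`.

attribute [reducible] FinTree.attach FinTree.single RootedFinTree.single RootedFinTree.bracket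
  FinTree.glue LabelledTree.graft LabelledTree.graftUnlabelled LabelledTree.start

/-! ### Joining two graphs by an edge. -/

namespace SimpleGraph

variable {V W V' W' U : Type}

/-- The disjoint union of two graphs together with one edge that joins `v` to `w`. -/
def edgeJoin (G : SimpleGraph V) (v : V) (H : SimpleGraph W) (w : W) : SimpleGraph (V ⊕ W) where
  Adj
    | .inl a, .inl b => G.Adj a b
    | .inr a, .inr b => H.Adj a b
    | .inl a, .inr b => a = v ∧ b = w
    | .inr b, .inl a => a = v ∧ b = w
  symm := ⟨by
    rintro (a | a) (b | b) h
    · exact G.adj_symm h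
    · exact h
    · exact h
    · exact H.adj_symm h⟩
  loopless := ⟨by
    rintro (a | a) h
    · exact G.irrefl h
    · exact H.irrefl h⟩

section

variable (G : SimpleGraph V) (v : V) (H : SimpleGraph W) (w : W)

@[simp] theorem edgeJoin_inl_inl (a b : V) :
    (G.edgeJoin v H w).Adj (.inl a) (.inl b) ↔ G.Adj a b := Iff.rfl

@[simp] theorem edgeJoin_inr_inr (a b : W) :
    (G.edgeJoin v H w).Adj (.inr a) (.inr b) ↔ H.Adj a b := Iff.rfl

@[simp] theorem edgeJoin_inl_inr (a : V) (b : W) :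
    (G.edgeJoin v H w).Adj (.inl a) (.inr b) ↔ a = v ∧ b = w := Iff.rfl

@[simp] theorem edgeJoin_inr_inl (a : V) (b : W) :
    (G.edgeJoin v H w).Adj (.inr b) (.inl a) ↔ a = v ∧ b = w := Iff.rfl

/-- Swapping the two sides of an edge join. -/
def edgeJoinComm : G.edgeJoin v H w ≃g H.edgeJoin w G v where
  toEquiv := Equiv.sumComm V W
  map_rel_iff' := by
    rintro (a | a) (b | b) <;> simp [and_comm]

/-- Two edge joins at vertices of the same graph commute. -/
def edgeJoinRightComm (v' : V) (K : SimpleGraph U) (u : U) :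
    (G.edgeJoin v H w).edgeJoin (.inl v') K u ≃g (G.edgeJoin v' K u).edgeJoin (.inl v) H w where
  toEquiv :=
    { toFun := Sum.elim (Sum.elim (Sum.inl ∘ Sum.inl) Sum.inr) (Sum.inl ∘ Sum.inr)
      invFun := Sum.elim (Sum.elim (Sum.inl ∘ Sum.inl) Sum.inr) (Sum.inl ∘ Sum.inr)
      left_inv := by rintro ((a | a) | a) <;> rfl
      right_inv := by rintro ((a | a) | a) <;> rfl }
  map_rel_iff' := by
    rintro ((a | a) | a) ((b | b) | b) <;> simp

/-- Edge joins are associative. -/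
def edgeJoinAssoc (x : W) (K : SimpleGraph U) (u : U) :
    (G.edgeJoin v H w).edgeJoin (.inr x) K u ≃g G.edgeJoin v (H.edgeJoin x K u) (.inl w) where
  toEquiv := Equiv.sumAssoc V W U
  map_rel_iff' := by
    rintro ((a | a) | a) ((b | b) | b) <;> simp

variable {G v H w}

/-- An edge join of isomorphic graphs. -/
def edgeJoinCongr {G' : SimpleGraph V'} {v' : V'} {H' : SimpleGraph W'} {w' : W'}
    (e : G ≃g G') (he : e v = v') (f : H ≃g H') (hf : f w = w') :
    G.edgeJoin v H w ≃g G'.edgeJoin v' H' w' where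
  toEquiv := Equiv.sumCongr e.toEquiv f.toEquiv
  map_rel_iff' := by
    subst he hf
    rintro (a | a) (b | b)
    · exact e.map_rel_iff
    · simp
    · simp
    · exact f.map_rel_iff

end

/-- A tree is the edge join of the two parts into which one of its edges divides it. -/
theorem IsTree.exists_iso_edgeJoin {G : SimpleGraph V} (hG : G.IsTree) {v x : V}
    (h : G.Adj v x) :
    ∃ (A B : Set V) (hv : v ∈ A) (hx : x ∈ B) (_ : (G.induce A).IsTree)
      (_ : (G.induce B).IsTree) (e : G ≃g (G.induce A).edgeJoin ⟨v, hv⟩ (G.induce B) ⟨x, hx⟩),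
      (∀ y (hy : y ∈ A), e y = .inl ⟨y, hy⟩) ∧ A = Bᶜ := by
  classical
  set G' := G.deleteEdges {s(v, x)} with hG'
  have hle : G' ≤ G := deleteEdges_le _
  have hbr : ¬ G'.Reachable v x := by
    have := (isAcyclic_iff_forall_isBridge.mp hG.isAcyclic) ((mem_edgeSet G).2 h)
    exact isBridge_iff.mp this
  have hac : G'.IsAcyclic := hG.isAcyclic.anti hle
  have hcover : ∀ y, G'.Reachable v y ∨ G'.Reachable x y := by
    -- A walk can leave a component of `G'` only along the deleted edge, and both ends of that edge
    -- lie in one of the two components, so these cover all vertices.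
    have key : ∀ a y (p : G.Walk a y), (G'.Reachable v a ∨ G'.Reachable x a) →
        (G'.Reachable v y ∨ G'.Reachable x y) := by
      intro a y p
      induction p with
      | nil => exact id
      | @cons a b c hab p ih =>
        intro hva
        apply ih
        by_cases hs : s(a, b) = s(v, x)
        · rcases Sym2.eq_iff.mp hs with ⟨rfl, rfl⟩ | ⟨rfl, rfl⟩
          · exact Or.inr (Reachable.refl _)
          · exact Or.inl (Reachable.refl _)
        · have hab' : G'.Adj a b := by
            rw [hG', deleteEdges_adj]
            exact ⟨hab, by simpa using hs⟩
          exact hva.imp (fun r => r.trans hab'.reachable) (fun r => r.trans hab'.reachable)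
    intro y
    exact key v y (hG.connected v y).some (Or.inl (Reachable.refl _))
  set A : Set V := (G'.connectedComponentMk v).supp with hA
  set B : Set V := (G'.connectedComponentMk x).supp with hB
  have memA : ∀ y, y ∈ A ↔ G'.Reachable v y := fun y => by
    rw [hA, ConnectedComponent.mem_supp_iff, ConnectedComponent.eq, reachable_comm]
  have memB : ∀ y, y ∈ B ↔ G'.Reachable x y := fun y => by
    rw [hB, ConnectedComponent.mem_supp_iff, ConnectedComponent.eq, reachable_comm]
  have hdis : ∀ y, y ∈ A → y ∈ B → False := fun y ha hb =>
    hbr (((memA y).1 ha).trans ((memB y).1 hb).symm)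
  have hAB : A = Bᶜ := by
    ext y
    constructor
    · exact fun ha hb => hdis y ha hb
    · intro hb
      rcases hcover y with h1 | h1
      · exact (memA y).2 h1
      · exact absurd ((memB y).2 h1) hb
  have hvA : v ∈ A := (memA v).2 (Reachable.refl _)
  have hxB : x ∈ B := (memB x).2 (Reachable.refl _)
  have hxA : x ∉ A := fun h => hdis x h hxB
  have hvB : v ∉ B := fun h => hdis v hvA h
  have indA : G.induce A = G'.induce A := by
    ext ⟨a, ha⟩ ⟨b, hb⟩
    simp only [comap_adj, Function.Embedding.subtype_apply, hG', deleteEdges_adj,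
      Set.mem_singleton_iff]
    refine ⟨fun h => ⟨h, fun hs => ?_⟩, fun h => h.1⟩
    rcases Sym2.eq_iff.mp hs with ⟨rfl, rfl⟩ | ⟨rfl, rfl⟩
    · exact hxA hb
    · exact hxA ha
  have indB : G.induce B = G'.induce B := by
    ext ⟨a, ha⟩ ⟨b, hb⟩
    simp only [comap_adj, Function.Embedding.subtype_apply, hG', deleteEdges_adj,
      Set.mem_singleton_iff]
    refine ⟨fun h => ⟨h, fun hs => ?_⟩, fun h => h.1⟩
    rcases Sym2.eq_iff.mp hs with ⟨rfl, rfl⟩ | ⟨rfl, rfl⟩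
    · exact hvB ha
    · exact hvB hb
  have cross : ∀ a b, a ∈ A → b ∈ B → (G.Adj a b ↔ a = v ∧ b = x) := by
    intro a b ha hb
    refine ⟨fun hab => ?_, fun h' => h'.1 ▸ h'.2 ▸ h⟩
    by_contra hne
    have hab' : G'.Adj a b := by
      rw [hG', deleteEdges_adj]
      refine ⟨hab, fun hs => ?_⟩
      rcases Sym2.eq_iff.mp hs with ⟨rfl, rfl⟩ | ⟨rfl, rfl⟩
      · exact hne ⟨rfl, rfl⟩
      · exact hxA ha
    exact hdis b ((memA b).2 (((memA a).1 ha).trans hab'.reachable)) hb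
  have hB' : ∀ y, y ∉ A → y ∈ B := fun y hy => by
    rw [hAB] at hy
    simpa using hy
  let F : V ≃ (A ⊕ B) :=
    { toFun := fun y => if hy : y ∈ A then .inl ⟨y, hy⟩ else .inr ⟨y, hB' y hy⟩
      invFun := Sum.elim (fun y => y.1) (fun y => y.1)
      left_inv := fun y => by
        by_cases hy : y ∈ A <;> simp [hy]
      right_inv := by
        rintro (⟨y, hy⟩ | ⟨y, hy⟩)
        · simp [hy]
        · have : y ∉ A := fun h => hdis y h hy
          simp [this] }
  refine ⟨A, B, hvA, hxB, ?_, ?_, ⟨F, ?_⟩, ?_, hAB⟩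
  · rw [indA]
    exact hac.isTree_connectedComponent _
  · rw [indB]
    exact hac.isTree_connectedComponent _
  · intro a b
    have e1 : ∀ y (hy : y ∈ A), F y = .inl ⟨y, hy⟩ := fun y hy => dif_pos hy
    have e2 : ∀ y (hy : y ∉ A), F y = .inr ⟨y, hB' y hy⟩ := fun y hy => dif_neg hy
    by_cases ha : a ∈ A <;> by_cases hb : b ∈ A
    · rw [e1 a ha, e1 b hb]; simp
    · rw [e1 a ha, e2 b hb]; simp [cross a b ha (hB' b hb)]
    · rw [e2 a ha, e1 b hb]; simp [G.adj_comm a b, cross b a hb (hB' a ha)]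
    · rw [e2 a ha, e2 b hb]; simp
  · intro y hy
    exact dif_pos hy

/-- The degree of a vertex, as a cardinality of a set. -/
noncomputable def ndeg (G : SimpleGraph V) (v : V) : ℕ := (G.neighborSet v).ncard

theorem Iso.ndeg_eq {G : SimpleGraph V} {H : SimpleGraph W} (e : G ≃g H) (v : V) :
    H.ndeg (e v) = G.ndeg v := by
  have : H.neighborSet (e v) = e '' G.neighborSet v := by
    ext y
    constructor
    · intro hy
      refine ⟨e.symm y, ?_, by simp⟩
      rw [mem_neighborSet, ← e.map_adj_iff]
      simpa using hy
    · rintro ⟨z, hz, rfl⟩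
      exact e.map_adj_iff.2 hz
  rw [ndeg, this, Set.ncard_image_of_injective _ e.injective, ndeg]

open Classical in
theorem ndeg_edgeJoin_inl [Finite V] (G : SimpleGraph V) (v : V) (H : SimpleGraph W) (w : W)
    (a : V) : (G.edgeJoin v H w).ndeg (.inl a) = G.ndeg a + if a = v then 1 else 0 := by
  unfold ndeg
  split_ifs with h
  · subst h
    have : (G.edgeJoin a H w).neighborSet (.inl a) =
        insert (.inr w) (Sum.inl '' G.neighborSet a) := by
      ext (y | y) <;> simp
    rw [this, Set.ncard_insert_of_notMem (by simp) (Set.toFinite _),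
      Set.ncard_image_of_injective _ Sum.inl_injective]
  · have : (G.edgeJoin v H w).neighborSet (.inl a) = Sum.inl '' G.neighborSet a := by
      ext (y | y) <;> simp [h]
    rw [this, Set.ncard_image_of_injective _ Sum.inl_injective, add_zero]

open Classical in
theorem ndeg_edgeJoin_inr [Finite W] (G : SimpleGraph V) (v : V) (H : SimpleGraph W) (w : W)
    (b : W) : (G.edgeJoin v H w).ndeg (.inr b) = H.ndeg b + if b = w then 1 else 0 := by
  rw [← (G.edgeJoinComm v H w).ndeg_eq (.inr b)]
  exact ndeg_edgeJoin_inl H w G v b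

end SimpleGraph

theorem FinTree.degree_eq_ndeg (T : FinTree) (x : T.V) : T.degree x = T.graph.ndeg x := by
  classical
  unfold FinTree.degree SimpleGraph.ndeg
  rw [← SimpleGraph.card_neighborSet_eq_degree, Set.ncard_eq_toFinset_card', Set.toFinset_card]

/-! ### Attaching branches one at a time. -/

namespace FinTree

section attach

variable (H : FinTree) (v : H.V) (L : List RootedFinTree)

@[simp] theorem attachGraph_inl_inl (a b : H.V) :
    (attachGraph H v L).Adj (.inl a) (.inl b) ↔ H.graph.Adj a b :=
  ⟨fun h => by cases h; assumption, fun h => .base h⟩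

theorem attachGraph_inl_inr (a : H.V) (i : Fin L.length) (b : (L.get i).V) :
    (attachGraph H v L).Adj (.inl a) (.inr ⟨i, b⟩) ↔ a = v ∧ b = (L.get i).root :=
  ⟨fun h => by cases h; exact ⟨rfl, rfl⟩, by rintro ⟨rfl, rfl⟩; exact .down i⟩

theorem attachGraph_inr_inl (a : H.V) (i : Fin L.length) (b : (L.get i).V) :
    (attachGraph H v L).Adj (.inr ⟨i, b⟩) (.inl a) ↔ a = v ∧ b = (L.get i).root := by
  rw [SimpleGraph.adj_comm, attachGraph_inl_inr]

theorem attachGraph_inr_inr (i : Fin L.length) (a b : (L.get i).V) :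
    (attachGraph H v L).Adj (.inr ⟨i, a⟩) (.inr ⟨i, b⟩) ↔ (L.get i).graph.Adj a b :=
  ⟨fun h => by cases h; assumption, fun h => .branch i h⟩

theorem attachGraph_inr_inr_of_ne {i j : Fin L.length} (hij : i ≠ j) (a : (L.get i).V)
    (b : (L.get j).V) : ¬ (attachGraph H v L).Adj (.inr ⟨i, a⟩) (.inr ⟨j, b⟩) := by
  intro h
  cases h
  exact hij rfl

/-- Attaching no branches changes nothing. -/
def attachNilIso : attachGraph H v [] ≃g H.graph where
  toEquiv :=
    { toFun := Sum.elim id (fun x => x.1.elim0)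
      invFun := Sum.inl
      left_inv := by
        rintro (x | x)
        · rfl
        · exact x.1.elim0
      right_inv := fun x => rfl }
  map_rel_iff' := by
    rintro (x | x) (y | y)
    · exact (attachGraph_inl_inl H v [] x y).symm
    · exact y.1.elim0
    · exact x.1.elim0
    · exact x.1.elim0

/-- The vertices of a tree with at least one branch attached. -/
def attachConsEquiv (A : RootedFinTree) :
    (H.V ⊕ (Σ i : Fin (A :: L).length, ((A :: L).get i).V)) ≃
      ((H.V ⊕ (Σ i : Fin L.length, (L.get i).V)) ⊕ A.V) where
  toFun
    | .inl x => .inl (.inl x)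
    | .inr ⟨⟨0, _⟩, y⟩ => .inr y
    | .inr ⟨⟨i + 1, h⟩, y⟩ => .inl (.inr ⟨⟨i, Nat.lt_of_succ_lt_succ h⟩, y⟩)
  invFun
    | .inl (.inl x) => .inl x
    | .inr y => .inr ⟨⟨0, Nat.succ_pos _⟩, y⟩
    | .inl (.inr ⟨i, y⟩) => .inr ⟨⟨i.1 + 1, Nat.succ_lt_succ i.2⟩, y⟩
  left_inv := by
    rintro (x | ⟨⟨_ | i, h⟩, y⟩) <;> rfl
  right_inv := by
    rintro ((x | ⟨i, y⟩) | y) <;> rfl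

/-- Branches can be attached one at a time. -/
def attachConsIso (A : RootedFinTree) :
    attachGraph H v (A :: L) ≃g (attachGraph H v L).edgeJoin (.inl v) A.graph A.root where
  toEquiv := attachConsEquiv H L A
  map_rel_iff' := by
    rintro (x | ⟨⟨_ | i, h⟩, x⟩) (y | ⟨⟨_ | j, h'⟩, y⟩)
    · exact (attachGraph_inl_inl H v L x y).trans (attachGraph_inl_inl H v (A :: L) x y).symm
    · rw [attachGraph_inl_inr]
      change Sum.inl x = Sum.inl v ∧ y = A.root ↔ x = v ∧ y = A.root
      simp
    · rw [attachGraph_inl_inr]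
      exact attachGraph_inl_inr H v L x ⟨j, Nat.lt_of_succ_lt_succ h'⟩ y
    · rw [attachGraph_inr_inl]
      change Sum.inl y = Sum.inl v ∧ x = A.root ↔ y = v ∧ x = A.root
      simp
    · rw [attachGraph_inr_inr]
      rfl
    · refine iff_of_false ?_ (attachGraph_inr_inr_of_ne _ _ _ (by simp) _ _)
      rintro ⟨h1, -⟩
      exact absurd h1 (by simp)
    · rw [attachGraph_inr_inl]
      exact attachGraph_inr_inl H v L y ⟨i, Nat.lt_of_succ_lt_succ h⟩ x
    · refine iff_of_false ?_ (attachGraph_inr_inr_of_ne _ _ _ (by simp) _ _)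
      rintro ⟨h1, -⟩
      exact absurd h1 (by simp)
    · simp only [attachConsEquiv, Equiv.coe_fn_mk, SimpleGraph.edgeJoin_inl_inl]
      by_cases hij : i = j
      · subst hij
        rw [attachGraph_inr_inr, attachGraph_inr_inr]
        rfl
      · refine iff_of_false (attachGraph_inr_inr_of_ne _ _ _ ?_ _ _)
          (attachGraph_inr_inr_of_ne _ _ _ ?_ _ _)
        · simpa using hij
        · simpa using hij

end attach

/-- The tree obtained from `T` and `A` by joining `v` to the root of `A`. -/
@[reducible] def join (T : FinTree) (v : T.V) (A : RootedFinTree) : FinTree where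
  V := T.V ⊕ A.V
  fintypeV := inferInstance
  graph := T.graph.edgeJoin v A.graph A.root
  isTree := (SimpleGraph.Iso.isTree_iff ((attachConsIso T v [] A).trans
    (SimpleGraph.edgeJoinCongr (attachNilIso T v) rfl .refl rfl))).1 (attachGraph_isTree T v [A])

end FinTree

/-! ### Marked trees and filling them with branches. -/

/-- A tree with vertices marked by `α`. -/
structure MarkedTree (α : Type) where
  tree : FinTree
  mark : α → tree.V

namespace MarkedTree

variable {α β γ : Type}

/-- Isomorphism of marked trees. -/
def Equivalent (M N : MarkedTree α) : Prop :=
  ∃ e : M.tree.graph ≃g N.tree.graph, ∀ a, e (M.mark a) = N.mark a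

infix:50 " ≋ " => Equivalent

theorem Equivalent.refl (M : MarkedTree α) : M ≋ M := ⟨.refl, fun _ => rfl⟩

theorem Equivalent.symm {M N : MarkedTree α} : M ≋ N → N ≋ M := by
  rintro ⟨e, he⟩
  exact ⟨SimpleGraph.Iso.symm e, fun a => by rw [← he a]; exact e.symm_apply_apply _⟩

theorem Equivalent.trans {M N K : MarkedTree α} : M ≋ N → N ≋ K → M ≋ K := by
  rintro ⟨e, he⟩ ⟨f, hf⟩
  refine ⟨SimpleGraph.Iso.comp f e, fun a => ?_⟩
  rw [← hf, ← he]
  rfl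

/-- Change of marks. -/
def comap (M : MarkedTree α) (f : β → α) : MarkedTree β := ⟨M.tree, M.mark ∘ f⟩

theorem Equivalent.comap {M N : MarkedTree α} (h : M ≋ N) (f : β → α) :
    M.comap f ≋ N.comap f := by
  obtain ⟨e, he⟩ := h
  exact ⟨e, fun b => he (f b)⟩

theorem Equivalent.nonempty_iso {M N : MarkedTree α} (h : M ≋ N) :
    Nonempty (M.tree.graph ≃g N.tree.graph) := ⟨h.choose⟩

/-- The rooted tree with root marked by `a`. -/
@[reducible] def rooted (M : MarkedTree α) (a : α) : RootedFinTree := ⟨M.tree, M.mark a⟩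

end MarkedTree

namespace FinTree

/-- A tree with every vertex marked by itself. -/
@[reducible] def marked (T : FinTree) : MarkedTree T.V := ⟨T, id⟩

end FinTree

namespace RootedFinTree

/-- Isomorphism of rooted trees. -/
def Equivalent (A B : RootedFinTree) : Prop :=
  ∃ e : A.graph ≃g B.graph, e A.root = B.root

theorem Equivalent.refl (A : RootedFinTree) : A.Equivalent A := ⟨.refl, rfl⟩

theorem Equivalent.symm {A B : RootedFinTree} : A.Equivalent B → B.Equivalent A := by
  rintro ⟨e, he⟩
  exact ⟨SimpleGraph.Iso.symm e, by rw [← he]; exact e.symm_apply_apply _⟩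

theorem Equivalent.trans {A B C : RootedFinTree} :
    A.Equivalent B → B.Equivalent C → A.Equivalent C := by
  rintro ⟨e, he⟩ ⟨f, hf⟩
  refine ⟨SimpleGraph.Iso.comp f e, ?_⟩
  rw [← hf, ← he]
  rfl

end RootedFinTree

namespace MarkedTree

variable {α β γ : Type}

theorem Equivalent.rooted {M N : MarkedTree α} (h : M ≋ N) (a : α) :
    (M.rooted a).Equivalent (N.rooted a) := by
  obtain ⟨e, he⟩ := h
  exact ⟨e, he a⟩

/-- Join the vertex marked by `a` to the root of `A`. -/
@[reducible] def join (M : MarkedTree α) (a : α) (A : RootedFinTree) : MarkedTree α :=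
  ⟨M.tree.join (M.mark a) A, Sum.inl ∘ M.mark⟩

/-- Join the vertex of `M` marked by `a` to the vertex of `N` marked by `b`, keeping all marks. -/
@[reducible] def joinMarked (M : MarkedTree α) (a : α) (N : MarkedTree β) (b : β) : MarkedTree (α ⊕ β) :=
  ⟨M.tree.join (M.mark a) (N.rooted b), Sum.map M.mark N.mark⟩

theorem join_congr {M N : MarkedTree α} (h : M ≋ N) (a : α) {A B : RootedFinTree}
    (hAB : A.Equivalent B) : M.join a A ≋ N.join a B := by
  obtain ⟨e, he⟩ := h
  obtain ⟨f, hf⟩ := hAB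
  refine ⟨SimpleGraph.edgeJoinCongr e (he a) f hf, fun c => ?_⟩
  exact congrArg Sum.inl (he c)

theorem join_right_comm (M : MarkedTree α) (a b : α) (A B : RootedFinTree) :
    (M.join a A).join b B ≋ (M.join b B).join a A :=
  ⟨SimpleGraph.edgeJoinRightComm _ _ _ _ _ _ _, fun _ => rfl⟩

theorem joinMarked_join_inl (M : MarkedTree α) (a : α) (N : MarkedTree β) (b : β) (c : α)
    (A : RootedFinTree) :
    (M.joinMarked a N b).join (.inl c) A ≋ (M.join c A).joinMarked a N b := by
  refine ⟨SimpleGraph.edgeJoinRightComm _ _ _ _ _ _ _, ?_⟩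
  rintro (x | x) <;> rfl

theorem joinMarked_join_inr (M : MarkedTree α) (a : α) (N : MarkedTree β) (b : β) (c : β)
    (A : RootedFinTree) :
    (M.joinMarked a N b).join (.inr c) A ≋ M.joinMarked a (N.join c A) b := by
  refine ⟨SimpleGraph.edgeJoinAssoc _ _ _ _ _ _ _, ?_⟩
  rintro (x | x) <;> rfl

/-- Join, for each pair `(a, A)` in the list, the vertex marked by `a` to the root of `A`. -/
def fill (M : MarkedTree α) (l : List (α × RootedFinTree)) : MarkedTree α :=
  l.foldr (fun p N => N.join p.1 p.2) M

@[simp] theorem fill_nil (M : MarkedTree α) : M.fill [] = M := rfl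

@[simp] theorem fill_cons (M : MarkedTree α) (p : α × RootedFinTree)
    (l : List (α × RootedFinTree)) : M.fill (p :: l) = (M.fill l).join p.1 p.2 := rfl

theorem fill_append (M : MarkedTree α) (l l' : List (α × RootedFinTree)) :
    M.fill (l ++ l') = (M.fill l').fill l := by
  simp [fill, List.foldr_append]

theorem fill_congr {M N : MarkedTree α} (h : M ≋ N) {l l' : List (α × RootedFinTree)}
    (hl : List.Forall₂ (fun p q => p.1 = q.1 ∧ p.2.Equivalent q.2) l l') :
    M.fill l ≋ N.fill l' := by
  induction hl with
  | nil => exact h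
  | @cons p q l l' hpq _ ih =>
    obtain ⟨a, A⟩ := p
    obtain ⟨b, B⟩ := q
    obtain ⟨h1, h2⟩ := hpq
    dsimp only at h1 h2
    subst h1
    exact join_congr ih a h2

theorem fill_congr_left {M N : MarkedTree α} (h : M ≋ N) (l : List (α × RootedFinTree)) :
    M.fill l ≋ N.fill l :=
  fill_congr h (List.forall₂_same.2 fun _ _ => ⟨rfl, .refl _⟩)

/-- Joins at any two marks commute, so only the multiset of pairs matters. This disposes of the
order in which constructions attach their branches. -/
theorem fill_perm (M : MarkedTree α) {l l' : List (α × RootedFinTree)} (h : l.Perm l') :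
    M.fill l ≋ M.fill l' := by
  induction h with
  | nil => exact .refl _
  | cons p _ ih => exact join_congr ih _ (.refl _)
  | swap p q l => exact join_right_comm _ _ _ _ _
  | trans _ _ ih1 ih2 => exact ih1.trans ih2

theorem fill_comap (M : MarkedTree α) (f : β → α) (l : List (β × RootedFinTree)) :
    (M.comap f).fill l = (M.fill (l.map (Prod.map f id))).comap f := by
  induction l with
  | nil => rfl
  | cons p l ih =>
    rw [fill_cons, ih]
    rfl

/-- Pairs with marks in `M` and pairs with marks in `N` do not interact: edge joins are associative
and commute with joins at other vertices. -/
theorem joinMarked_fill (M : MarkedTree α) (a : α) (N : MarkedTree β) (b : β)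
    (l : List (α × RootedFinTree)) (l' : List (β × RootedFinTree)) :
    (M.joinMarked a N b).fill (l.map (Prod.map Sum.inl id) ++ l'.map (Prod.map Sum.inr id)) ≋
      (M.fill l).joinMarked a (N.fill l') b := by
  induction l with
  | nil =>
    simp only [List.map_nil, List.nil_append, fill_nil]
    induction l' with
    | nil => exact .refl _
    | cons p l' ih =>
      exact (join_congr ih _ (.refl _)).trans (joinMarked_join_inr _ _ _ _ _ _)
  | cons p l ih =>
    exact (join_congr ih _ (.refl _)).trans (joinMarked_join_inl _ _ _ _ _ _)

end MarkedTree

namespace MarkedTree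

variable {α β : Type}

/-- Join the vertex marked by `a` to the roots of the trees in `L`. -/
def attach (M : MarkedTree α) (a : α) (L : List RootedFinTree) : MarkedTree α :=
  ⟨M.tree.attach (M.mark a) L, Sum.inl ∘ M.mark⟩

theorem attach_nil (M : MarkedTree α) (a : α) : M.attach a [] ≋ M :=
  ⟨FinTree.attachNilIso _ _, fun _ => rfl⟩

theorem attach_cons (M : MarkedTree α) (a : α) (A : RootedFinTree) (L : List RootedFinTree) :
    M.attach a (A :: L) ≋ (M.attach a L).join a A :=
  ⟨FinTree.attachConsIso _ _ _ _, fun _ => rfl⟩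

theorem attach_equivalent_fill (M : MarkedTree α) (a : α) (L : List RootedFinTree) :
    M.attach a L ≋ M.fill (L.map fun A => (a, A)) := by
  induction L with
  | nil => exact attach_nil M a
  | cons A L ih => exact (attach_cons M a A L).trans (join_congr ih a (.refl A))

end MarkedTree

open MarkedTree

namespace RootedFinTree

theorem bracket_equivalent_fill (L : List RootedFinTree) :
    (bracket L).Equivalent ((FinTree.single.marked.fill (L.map fun A => ((), A))).rooted ()) :=
  (attach_equivalent_fill FinTree.single.marked () L).rooted ()

theorem bracket_congr {L L' : List RootedFinTree} (h : List.Forall₂ Equivalent L L') :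
    (bracket L).Equivalent (bracket L') := by
  refine (bracket_equivalent_fill L).trans (.trans ?_ (bracket_equivalent_fill L').symm)
  apply MarkedTree.Equivalent.rooted
  refine fill_congr (.refl _) ?_
  rw [List.forall₂_map_left_iff, List.forall₂_map_right_iff]
  exact h.imp fun _ _ h => ⟨rfl, h⟩

theorem bracket_perm {L L' : List RootedFinTree} (h : L.Perm L') :
    (bracket L).Equivalent (bracket L') :=
  (bracket_equivalent_fill L).trans
    (((fill_perm _ (h.map _)).rooted ()).trans (bracket_equivalent_fill L').symm)

theorem bracket_cons_congr {A B : RootedFinTree} (h : A.Equivalent B) (L : List RootedFinTree) :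
    (bracket (A :: L)).Equivalent (bracket (B :: L)) :=
  bracket_congr (.cons h (List.forall₂_same.2 fun _ _ => .refl _))

/-- The root of a rooted tree can be moved along an edge. -/
theorem bracket_bracket_iso (L M : List RootedFinTree) :
    Nonempty ((bracket (bracket M :: L)).graph ≃g (bracket (bracket L :: M)).graph) :=
  ⟨((FinTree.attachConsIso FinTree.single () L (bracket M)).trans
    (SimpleGraph.edgeJoinComm _ _ _ _)).trans
      (FinTree.attachConsIso FinTree.single () M (bracket L)).symm⟩

theorem bracket_cons_equivalent_join (A : RootedFinTree) (L : List RootedFinTree) :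
    (bracket (A :: L)).Equivalent (((bracket L).marked.join (bracket L).root A).rooted
      (bracket L).root) :=
  ⟨FinTree.attachConsIso _ _ _ _, rfl⟩

end RootedFinTree

open RootedFinTree

/-! ### Filling attached branches; degrees. -/

namespace FinTree

/-- Filling a tree with attached branches amounts to filling the tree and the branches
separately. -/
theorem fill_attach (T : FinTree) (x : T.V) (L : List RootedFinTree)
    (l : List (T.V × RootedFinTree))
    (l' : ∀ i : Fin L.length, List ((L.get i).V × RootedFinTree)) :
    ((T.attach x L).marked.fill (l.map (Prod.map Sum.inl id) ++
      (List.finRange L.length).flatMap fun i =>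
        (l' i).map (Prod.map (fun y => Sum.inr ⟨i, y⟩) id))).comap Sum.inl ≋
    T.marked.fill (l ++ (List.finRange L.length).map fun i =>
      (x, ((L.get i).marked.fill (l' i)).rooted (L.get i).root)) := by
  induction L with
  | nil =>
    have h0 : List.finRange ([] : List RootedFinTree).length = [] := rfl
    rw [h0]
    simp only [List.flatMap_nil, List.append_nil, List.map_nil]
    rw [← fill_comap]
    exact fill_congr_left (attach_nil T.marked x) l
  | cons A L ih =>
    have h1 : (T.attach x (A :: L)).marked ≋
        (((T.attach x L).marked.joinMarked (.inl x) A.marked A.root)).comap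
          (attachConsEquiv T L A) := by
      refine ⟨attachConsIso T x L A, fun y => ?_⟩
      have : ∀ z : (T.V ⊕ (Σ i : Fin L.length, (L.get i).V)) ⊕ A.V,
        ((T.attach x L).marked.joinMarked (.inl x) A.marked A.root).mark z = z := by
        rintro (z | z) <;> rfl
      exact (this _).symm
    have hfr : List.finRange (A :: L).length =
        (⟨0, Nat.succ_pos _⟩ : Fin (A :: L).length) ::
          (List.finRange L.length).map Fin.succ := List.finRange_succ
    have h2 := (fill_congr_left h1 (l.map (Prod.map Sum.inl id) ++
      (List.finRange (A :: L).length).flatMap fun i : Fin (A :: L).length =>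
        (l' i).map (Prod.map (fun y => Sum.inr ⟨i, y⟩) id))).comap Sum.inl
    rw [fill_comap] at h2
    refine h2.trans ?_
    -- The branch with index `0` is split off: its pairs are moved behind all others, the order that
    -- `joinMarked_fill` requires.
    have h3 := (fill_perm ((T.attach x L).marked.joinMarked (.inl x) A.marked A.root)
      (l := ((l.map (Prod.map Sum.inl id) ++
      (List.finRange (A :: L).length).flatMap fun i : Fin (A :: L).length =>
        (l' i).map (Prod.map (fun y => (Sum.inr ⟨i, y⟩ : T.V ⊕ (Σ i : Fin (A :: L).length, ((A :: L).get i).V))) id)).map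
          (Prod.map (attachConsEquiv T L A) id)))
      (l' := (l.map (Prod.map Sum.inl id) ++
      (List.finRange L.length).flatMap fun i : Fin L.length =>
        (l' i.succ).map (Prod.map (fun y => (Sum.inr ⟨i, y⟩ : T.V ⊕ (Σ i : Fin L.length, (L.get i).V))) id)).map
          (Prod.map Sum.inl id) ++ (l' ⟨0, Nat.succ_pos _⟩).map (Prod.map Sum.inr id)) ?_)
    · refine ((h3.trans (joinMarked_fill _ _ _ _ _ _)).comap
        (Sum.inl ∘ Sum.inl)).trans ?_
      have h4 := join_congr (ih (fun i => l' i.succ)) x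
        (.refl ((A.marked.fill (l' ⟨0, Nat.succ_pos _⟩)).rooted A.root))
      refine Equivalent.trans h4 ?_
      rw [hfr]
      simp only [List.map_cons, List.map_map]
      exact fill_perm T.marked (l := (x, _) :: (l ++ _)) List.perm_middle.symm
    · rw [hfr]
      simp only [List.flatMap_cons, List.map_append, List.flatMap_map, List.map_map,
        List.map_flatMap, List.append_assoc]
      refine List.Perm.append (List.Perm.of_eq ?_) (List.perm_append_comm.trans
        (List.Perm.append (List.Perm.of_eq ?_) (List.Perm.of_eq ?_)))
      · rfl
      · rfl
      · rfl

/-- The degrees of the vertices, where `k` is added to the degree of `v`. -/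
noncomputable def degreesAt (T : FinTree) (v : T.V) (k : ℕ) : Multiset ℕ := by
  classical
  exact Finset.univ.val.map fun x => T.graph.ndeg x + if x = v then k else 0

theorem degreesAt_iso {S T : FinTree} (e : S.graph ≃g T.graph) (v : S.V) (k : ℕ) :
    T.degreesAt (e v) k = S.degreesAt v k := by
  classical
  unfold degreesAt
  have : (Finset.univ : Finset T.V).val = (Finset.univ : Finset S.V).val.map e := by
    rw [← Finset.map_univ_equiv e.toEquiv]
    rfl
  rw [this, Multiset.map_map]
  refine Multiset.map_congr rfl fun x _ => ?_
  simp [e.ndeg_eq]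

/-- The connecting edge adds one at each of its ends, which explains `k + 1` at `v` and the `1` at
the root of `A`. -/
theorem degreesAt_join (T : FinTree) (v : T.V) (A : RootedFinTree) (k : ℕ) :
    (T.join v A).degreesAt (.inl v) k = T.degreesAt v (k + 1) + A.degreesAt A.root 1 := by
  classical
  unfold degreesAt
  have : (Finset.univ : Finset (T.V ⊕ A.V)).val =
      (Finset.univ : Finset T.V).val.map Sum.inl + (Finset.univ : Finset A.V).val.map Sum.inr := by
    rw [← Finset.univ_disjSum_univ]
    rfl
  change Multiset.map _ (Finset.univ : Finset (T.V ⊕ A.V)).val = _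
  rw [this, Multiset.map_add, Multiset.map_map, Multiset.map_map]
  congr 1
  · refine Multiset.map_congr rfl fun x _ => ?_
    have := SimpleGraph.ndeg_edgeJoin_inl T.graph v A.graph A.root x
    simp only [Function.comp_apply, Sum.inl.injEq]
    change (T.graph.edgeJoin v A.graph A.root).ndeg (.inl x) + _ = _
    rw [this]
    split_ifs <;> omega
  · refine Multiset.map_congr rfl fun x _ => ?_
    have := SimpleGraph.ndeg_edgeJoin_inr T.graph v A.graph A.root x
    simp only [Function.comp_apply]
    change (T.graph.edgeJoin v A.graph A.root).ndeg (.inr x) + _ = _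
    rw [this]
    simp

theorem ndeg_attach_inl (T : FinTree) (v : T.V) (L : List RootedFinTree) (x : T.V)
    [Decidable (x = v)] :
    (T.attach v L).graph.ndeg (.inl x) = T.graph.ndeg x + if x = v then L.length else 0 := by
  classical
  induction L with
  | nil =>
    rw [← (attachNilIso T v).ndeg_eq (.inl x)]
    simp only [List.length_nil, ite_self, add_zero]
    rfl
  | cons A L ih =>
    have h1 := (attachConsIso T v L A).ndeg_eq (.inl x)
    have h2 : attachConsIso T v L A (.inl x) = .inl (.inl x) := rfl
    rw [h2, SimpleGraph.ndeg_edgeJoin_inl] at h1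
    change (attachGraph T v (A :: L)).ndeg _ = _
    rw [← h1]
    change (attachGraph T v L).ndeg _ = _ at ih
    rw [ih]
    simp only [Sum.inl.injEq, List.length_cons]
    split_ifs <;> omega

open Classical in
theorem ndeg_attach_inr (T : FinTree) (v : T.V) (L : List RootedFinTree) (i : Fin L.length)
    (y : (L.get i).V) :
    (T.attach v L).graph.ndeg (.inr ⟨i, y⟩) =
      (L.get i).graph.ndeg y + if y = (L.get i).root then 1 else 0 := by
  change (attachGraph T v L).ndeg _ = _
  induction L with
  | nil => exact i.elim0
  | cons A L ih =>
    obtain ⟨_ | i, hi⟩ := i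
    · have h1 := (attachConsIso T v L A).ndeg_eq (.inr ⟨⟨0, hi⟩, y⟩)
      have h2 : attachConsIso T v L A (.inr ⟨⟨0, hi⟩, y⟩) = .inr y := rfl
      rw [← h1, h2, SimpleGraph.ndeg_edgeJoin_inr]
      congr
    · have h1 := (attachConsIso T v L A).ndeg_eq (.inr ⟨⟨i + 1, hi⟩, y⟩)
      have h2 : attachConsIso T v L A (.inr ⟨⟨i + 1, hi⟩, y⟩) =
        .inl (.inr ⟨⟨i, Nat.lt_of_succ_lt_succ hi⟩, y⟩) := rfl
      rw [← h1, h2, SimpleGraph.ndeg_edgeJoin_inl, if_neg (by simp), add_zero]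
      exact ih ⟨i, Nat.lt_of_succ_lt_succ hi⟩ y

/-- The multiset of the degrees of the vertices. -/
noncomputable def degrees (T : FinTree) : Multiset ℕ := Finset.univ.val.map T.degree

theorem degreesAt_zero (T : FinTree) (v : T.V) : T.degreesAt v 0 = T.degrees := by
  unfold degreesAt degrees
  refine Multiset.map_congr rfl fun x _ => ?_
  simp [degree_eq_ndeg]

theorem degrees_eq_of_iso {S T : FinTree} (h : Nonempty (S.graph ≃g T.graph)) :
    S.degrees = T.degrees := by
  obtain ⟨e⟩ := h
  obtain ⟨v⟩ := S.isTree.connected.nonempty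
  rw [← degreesAt_zero S v, ← degreesAt_iso e, degreesAt_zero]

theorem coe_degreeSeq (T : FinTree) : (T.degreeSeq : Multiset ℕ) = T.degrees :=
  Multiset.sort_eq _ _

theorem degreeSeq_eq_of_degrees {S T : FinTree} (h : S.degrees = T.degrees) :
    S.degreeSeq = T.degreeSeq := by
  unfold degreeSeq
  exact congrArg (fun s : Multiset ℕ => s.sort (· ≥ ·)) h

theorem degreeSeq_pairwise (T : FinTree) : T.degreeSeq.Pairwise (· ≥ ·) :=
  Multiset.pairwise_sort _ _

end FinTree

/-! ### Degrees of branches, and gluing at the ends of a path. -/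

namespace RootedFinTree

/-- The degrees of the vertices of a branch whose root is joined to a vertex outside. -/
noncomputable def branchDegrees (A : RootedFinTree) : Multiset ℕ := A.degreesAt A.root 1

/-- The number `k` counts neighbours of the root outside the tree. It varies in the induction
because a branch that is split off becomes such a neighbour. -/
theorem degreesAt_bracket (L : List RootedFinTree) (k : ℕ) :
    (bracket L).degreesAt (bracket L).root k = (k + L.length) ::ₘ (L.map branchDegrees).sum := by
  induction L generalizing k with
  | nil =>
    have h := FinTree.degreesAt_iso (T := FinTree.single) (S := (bracket []).toFinTree)
      (FinTree.attachNilIso FinTree.single ()) (.inl ()) k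
    refine h.symm.trans ?_
    unfold FinTree.degreesAt
    have h1 : (Finset.univ : Finset FinTree.single.V).val = {()} := rfl
    rw [h1]
    have h2 : (⊥ : SimpleGraph Unit).ndeg () = 0 := by
      simp [SimpleGraph.ndeg, SimpleGraph.neighborSet]
    change Multiset.map _ {()} = _
    simp only [Multiset.map_singleton]
    rw [h2]
    simp
  | cons A L ih =>
    have h := FinTree.degreesAt_iso (T := (bracket L).toFinTree.join (bracket L).root A)
      (S := (bracket (A :: L)).toFinTree)
      (FinTree.attachConsIso FinTree.single () L A) (.inl ()) k
    refine h.symm.trans ?_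
    refine (FinTree.degreesAt_join (bracket L).toFinTree (bracket L).root A k).trans ?_
    rw [ih]
    simp only [List.length_cons, List.map_cons, List.sum_cons]
    rw [Multiset.cons_add, add_comm (List.sum _)]
    congr 1
    omega

theorem branchDegrees_bracket (L : List RootedFinTree) :
    (bracket L).branchDegrees = (L.length + 1) ::ₘ (L.map branchDegrees).sum := by
  rw [branchDegrees, degreesAt_bracket, add_comm]

theorem degrees_bracket (L : List RootedFinTree) :
    (bracket L).degrees = L.length ::ₘ (L.map branchDegrees).sum := by
  rw [← FinTree.degreesAt_zero _ (bracket L).root, degreesAt_bracket, zero_add]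

/-- The function `β` of a list of branches, together with further branches at the root, is
realised by gluing to two leaves of a tree. -/
def IsGluing (β : List RootedFinTree → RootedFinTree) : Prop :=
  ∃ (H : FinTree) (v w : H.V), v ≠ w ∧ H.IsLeaf v ∧ H.IsLeaf w ∧
    ∀ L R, (RootedFinTree.mk (H.glue v w L R) (.inl (.inl v))).Equivalent (bracket (β R :: L))

/-- Branches attached at `b` are absorbed into `B`. Hence, seen from a new vertex hung on the root
of `B`, everything except `L` is one single branch. -/
theorem join_single_fill (B : RootedFinTree) (b : B.V) (L R : List RootedFinTree) :
    ((((FinTree.single.join () B).marked.attach (.inl ()) L).attach (.inr b) R).rooted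
      (.inl ())).Equivalent (bracket ((B.marked.attach b R).rooted B.root :: L)) := by
  have h0 : (FinTree.single.join () B).marked ≋
      FinTree.single.marked.joinMarked () B.marked B.root :=
    ⟨.refl, by rintro (x | x) <;> rfl⟩
  have h1 : ((FinTree.single.join () B).marked.attach (.inl ()) L).attach (.inr b) R ≋
      (FinTree.single.join () B).marked.fill
        ((R.map fun A => (.inr b, A)) ++ L.map fun A => (.inl (), A)) := by
    refine (attach_equivalent_fill _ _ _).trans ?_
    rw [fill_append]
    exact fill_congr_left (attach_equivalent_fill _ _ _) _
  have h2 := joinMarked_fill FinTree.single.marked () B.marked B.root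
    (L.map fun A => ((), A)) (R.map fun A => (b, A))
  have h3 := ((h1.trans ((fill_congr_left h0 _).trans (fill_perm _
    List.perm_append_comm))).trans (by
      convert h2 using 2
      simp only [List.map_map]
      rfl)).rooted (.inl ())
  refine h3.trans ?_
  refine .trans ?_ (bracket_equivalent_fill _).symm
  have h4 : (FinTree.single.marked.fill (L.map fun A => ((), A))).join ()
      ((B.marked.fill (R.map fun A => (b, A))).rooted B.root) ≋
      (FinTree.single.marked.fill (L.map fun A => ((), A))).join ()
      ((B.marked.attach b R).rooted B.root) :=
    join_congr (.refl _) () ((attach_equivalent_fill B.marked b R).symm.rooted B.root)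
  exact h4.rooted ()

theorem ndeg_single : FinTree.single.graph.ndeg () = 0 := by
  change (⊥ : SimpleGraph Unit).ndeg () = 0
  simp [SimpleGraph.ndeg, SimpleGraph.neighborSet]

theorem single_join_isLeaf (B : RootedFinTree) : (FinTree.single.join () B).IsLeaf (.inl ()) := by
  classical
  rw [FinTree.IsLeaf, FinTree.degree_eq_ndeg]
  change (SimpleGraph.edgeJoin _ _ _ _).ndeg _ = 1
  rw [SimpleGraph.ndeg_edgeJoin_inl, ndeg_single]
  simp

/-- The tree `H` is a single edge, and its two ends are the two leaves. -/
theorem isGluing_bracket : IsGluing bracket := by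
  classical
  refine ⟨FinTree.single.join () single, .inl (), .inr (), by simp, single_join_isLeaf _, ?_, ?_⟩
  · rw [FinTree.IsLeaf, FinTree.degree_eq_ndeg]
    change (SimpleGraph.edgeJoin _ _ _ _).ndeg _ = 1
    rw [SimpleGraph.ndeg_edgeJoin_inr]
    change FinTree.single.graph.ndeg () + _ = 1
    rw [ndeg_single]
    simp [single]
  · intro L R
    exact join_single_fill single () L R

/-- The path grows at its front: the old leaf `v` receives the side branches `S` and a new pendant
neighbour, which takes over its role, while `w` remains a leaf because `w ≠ v`. -/
theorem IsGluing.step {β : List RootedFinTree → RootedFinTree} (h : IsGluing β)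
    (S : List RootedFinTree) : IsGluing fun R => bracket (β R :: S) := by
  classical
  obtain ⟨H, v, w, hvw, -, hw, hβ⟩ := h
  refine ⟨FinTree.single.join () ⟨H.attach v S, .inl v⟩, .inl (), .inr (.inl w), by simp,
    single_join_isLeaf _, ?_, ?_⟩
  · rw [FinTree.IsLeaf, FinTree.degree_eq_ndeg] at hw ⊢
    change (SimpleGraph.edgeJoin _ _ _ _).ndeg _ = 1
    rw [SimpleGraph.ndeg_edgeJoin_inr, if_neg (by simpa using hvw.symm), add_zero,
      FinTree.ndeg_attach_inl, if_neg hvw.symm, add_zero, hw]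
  · intro L R
    refine (join_single_fill ⟨H.attach v S, .inl v⟩ (.inl w) L R).trans ?_
    exact bracket_cons_congr (hβ S R) L

end RootedFinTree

/-! ### Diagrams whose finished branches are collapsed to ends. -/

/-- A finite tree diagram, some of whose end nodes stand for arbitrary rooted trees. -/
inductive ConfigTree
  | blob (A : RootedFinTree)
  | node (L : List ConfigTree)

namespace ConfigTree

/-- Structural induction through the lists of children; the inductive type is nested. -/
theorem induct {P : ConfigTree → Prop} (hb : ∀ A, P (blob A))
    (hn : ∀ L, (∀ x ∈ L, P x) → P (node L)) : ∀ t, P t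
  | blob A => hb A
  | node L => hn L fun x _ => induct hb hn x

/-- The rooted tree described by a diagram. -/
def real : ConfigTree → RootedFinTree
  | blob A => A
  | node L => bracket (L.map real)

/-- The rooted trees at the ends of a diagram. -/
def blobs : ConfigTree → Multiset RootedFinTree
  | blob A => {A}
  | node L => (L.map blobs).sum

/-- The degrees of the nodes of a diagram; the root has an additional neighbour outside. -/
def degs : ConfigTree → Multiset ℕ
  | blob _ => 0
  | node L => (L.length + 1) ::ₘ (L.map degs).sum

theorem real_blob (A : RootedFinTree) : (blob A).real = A := by rw [real]
theorem real_node (L : List ConfigTree) : (node L).real = bracket (L.map real) := by rw [real]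
theorem blobs_blob (A : RootedFinTree) : (blob A).blobs = {A} := by rw [blobs]
theorem blobs_node (L : List ConfigTree) : (node L).blobs = (L.map blobs).sum := by rw [blobs]
theorem degs_blob (A : RootedFinTree) : (blob A).degs = 0 := by rw [degs]
theorem degs_node (L : List ConfigTree) :
    (node L).degs = (L.length + 1) ::ₘ (L.map degs).sum := by rw [degs]

/-- The rooted trees at the ends of a diagram whose root has the children `L`. -/
def rootBlobs (L : List ConfigTree) : Multiset RootedFinTree := (L.map blobs).sum

/-- The degrees of the nodes of a diagram whose root has the children `L` and no other
neighbours. -/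
def rootDegs (L : List ConfigTree) : Multiset ℕ := L.length ::ₘ (L.map degs).sum

/-- The tree described by a diagram whose root has the children `L`. -/
def tree (L : List ConfigTree) : FinTree := (bracket (L.map real)).toFinTree

/-- Two diagrams describe isomorphic rooted trees, with the same ends and degrees. -/
def Sim (t t' : ConfigTree) : Prop :=
  t.real.Equivalent t'.real ∧ t.blobs = t'.blobs ∧ t.degs = t'.degs

/-- Two lists of children describe isomorphic trees, with the same ends and degrees. -/
def UEquiv (L M : List ConfigTree) : Prop :=
  Nonempty ((tree L).graph ≃g (tree M).graph) ∧ rootBlobs L = rootBlobs M ∧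
    rootDegs L = rootDegs M

theorem Sim.refl (t : ConfigTree) : Sim t t := ⟨.refl _, rfl, rfl⟩

theorem Sim.trans {t t' t'' : ConfigTree} (h : Sim t t') (h' : Sim t' t'') : Sim t t'' :=
  ⟨h.1.trans h'.1, h.2.1.trans h'.2.1, h.2.2.trans h'.2.2⟩

theorem UEquiv.trans {L M N : List ConfigTree} (h : UEquiv L M) (h' : UEquiv M N) :
    UEquiv L N := by
  obtain ⟨⟨e⟩, h2, h3⟩ := h
  obtain ⟨⟨e'⟩, h2', h3'⟩ := h'
  exact ⟨⟨e.trans e'⟩, h2.trans h2', h3.trans h3'⟩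

theorem UEquiv.of_perm {L M : List ConfigTree} (h : L.Perm M) : UEquiv L M := by
  obtain ⟨e, -⟩ := bracket_perm (h.map real)
  refine ⟨⟨e⟩, (h.map _).sum_eq, ?_⟩
  rw [rootDegs, rootDegs, h.length_eq, (h.map degs).sum_eq]

theorem UEquiv.refl (L : List ConfigTree) : UEquiv L L := .of_perm (.refl _)

theorem UEquiv.cons {t t' : ConfigTree} (h : Sim t t') (L : List ConfigTree) :
    UEquiv (t :: L) (t' :: L) := by
  obtain ⟨h1, h2, h3⟩ := h
  obtain ⟨e, -⟩ := bracket_cons_congr h1 (L.map real)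
  refine ⟨⟨e⟩, ?_, ?_⟩
  · simp [rootBlobs, h2]
  · simp [rootDegs, h3]

theorem Sim.node_perm {L M : List ConfigTree} (h : L.Perm M) : Sim (node L) (node M) := by
  refine ⟨?_, ?_, ?_⟩
  · rw [real_node, real_node]
    exact bracket_perm (h.map _)
  · rw [blobs_node, blobs_node, (h.map _).sum_eq]
  · rw [degs_node, degs_node, h.length_eq, (h.map degs).sum_eq]

theorem Sim.node_cons {t t' : ConfigTree} (h : Sim t t') (L : List ConfigTree) :
    Sim (node (t :: L)) (node (t' :: L)) := by
  obtain ⟨h1, h2, h3⟩ := h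
  refine ⟨?_, ?_, ?_⟩
  · rw [real_node, real_node]
    exact bracket_cons_congr h1 _
  · simp [blobs_node, h2]
  · simp [degs_node, h3]

/-- The same edge is viewed from its other end: both nodes keep their neighbours, and only the
choice of the root changes. -/
theorem UEquiv.reroot (L M : List ConfigTree) : UEquiv (node M :: L) (node L :: M) := by
  refine ⟨?_, ?_, ?_⟩
  · have h := bracket_bracket_iso (L.map real) (M.map real)
    rw [← real_node, ← real_node] at h
    exact h
  · simp only [rootBlobs, List.map_cons, blobs_node, List.sum_cons]
    rw [add_comm]
  · simp only [rootDegs, List.map_cons, degs_node, List.sum_cons, List.length_cons]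
    rw [Multiset.cons_add, Multiset.cons_add, Multiset.cons_swap, add_comm (List.sum _)]

/-- A path of nodes: `S` lists the further children of the nodes on the path, and `R` the children
of its last node. -/
def path : List (List ConfigTree) → List ConfigTree → ConfigTree
  | [], R => node R
  | S :: Ss, R => node (path Ss R :: S)

theorem path_append (Ss : List (List ConfigTree)) (S R : List ConfigTree) :
    path (Ss ++ [S]) R = path Ss (node R :: S) := by
  induction Ss with
  | nil => rfl
  | cons T Ss ih => simp only [List.cons_append, path, ih]

/-- The root is moved along the path one node at a time. Each step turns the part already passed
into a side branch of the next node, and at the end the path is read backwards. -/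
theorem UEquiv.path_reverse (S : List (List ConfigTree)) (L R : List ConfigTree) :
    UEquiv (path S R :: L) (path S.reverse L :: R) := by
  induction S generalizing L with
  | nil => exact .reroot L R
  | cons S1 Ss ih =>
    rw [List.reverse_cons, path_append]
    refine .trans ?_ (ih (node L :: S1))
    exact (UEquiv.reroot L (path Ss R :: S1)).trans (.of_perm (.swap _ _ _))

theorem path_data (S : List (List ConfigTree)) : ∃ (X : Multiset ℕ) (Y : Multiset RootedFinTree),
    ∀ R, (path S R).degs = (R.length + 1) ::ₘ ((R.map degs).sum + X) ∧
      (path S R).blobs = rootBlobs R + Y := by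
  induction S with
  | nil => exact ⟨0, 0, fun R => by simp [path, degs_node, blobs_node, rootBlobs]⟩
  | cons S1 Ss ih =>
    obtain ⟨X, Y, h⟩ := ih
    refine ⟨(S1.length + 2) ::ₘ (X + (S1.map degs).sum), Y + rootBlobs S1, fun R => ⟨?_, ?_⟩⟩
    · rw [path, degs_node, List.map_cons, List.sum_cons, (h R).1]
      simp only [List.length_cons, Multiset.cons_add, Multiset.add_cons, add_assoc]
      rw [Multiset.cons_swap]
    · rw [path, blobs_node, List.map_cons, List.sum_cons, (h R).2, rootBlobs, rootBlobs, add_assoc]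

theorem exists_mem_of_mem_sum {α β : Type*} {a : β} {f : α → Multiset β} {L : List α}
    (h : a ∈ (L.map f).sum) : ∃ x ∈ L, a ∈ f x := by
  induction L with
  | nil => simp at h
  | cons x L ih =>
    rw [List.map_cons, List.sum_cons, Multiset.mem_add] at h
    rcases h with h | h
    · exact ⟨x, by simp, h⟩
    · obtain ⟨y, hy, h⟩ := ih h
      exact ⟨y, by simp [hy], h⟩

theorem le_sum_of_mem {α β : Type*} {f : α → Multiset β} {L : List α} {x : α} (h : x ∈ L) :
    f x ≤ (L.map f).sum := by
  obtain ⟨l1, l2, rfl⟩ := List.append_of_mem h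
  rw [(List.perm_middle.map f).sum_eq]
  simp

theorem exists_path_of_mem_blobs {a : RootedFinTree} (t : ConfigTree) (h : a ∈ t.blobs) :
    t = blob a ∨ ∃ S R, Sim t (path S (blob a :: R)) := by
  induction t using induct with
  | hb A =>
    rw [blobs_blob, Multiset.mem_singleton] at h
    exact .inl (by rw [h])
  | hn L ih =>
    right
    rw [blobs_node] at h
    obtain ⟨y, hy, h'⟩ := exists_mem_of_mem_sum h
    obtain ⟨l1, l2, rfl⟩ := List.append_of_mem hy
    rcases ih y hy h' with rfl | ⟨S, R, hS⟩
    · exact ⟨[], l1 ++ l2, .node_perm List.perm_middle⟩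
    · exact ⟨(l1 ++ l2) :: S, R, (Sim.node_perm List.perm_middle).trans (hS.node_cons _)⟩

theorem exists_path_of_mem_degs {d : ℕ} (t : ConfigTree) (h : d ∈ t.degs) :
    ∃ S R, R.length + 1 = d ∧ Sim t (path S R) := by
  induction t using induct with
  | hb A => simp [degs_blob] at h
  | hn L ih =>
    rw [degs_node, Multiset.mem_cons] at h
    rcases h with rfl | h
    · exact ⟨[], L, rfl, .refl _⟩
    · obtain ⟨y, hy, h'⟩ := exists_mem_of_mem_sum h
      obtain ⟨l1, l2, rfl⟩ := List.append_of_mem hy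
      obtain ⟨S, R, hR, hS⟩ := ih y hy h'
      exact ⟨(l1 ++ l2) :: S, R, hR, (Sim.node_perm List.perm_middle).trans (hS.node_cons _)⟩

/-- The root can be moved to a node of any degree that occurs. -/
theorem exists_reroot {d : ℕ} {L : List ConfigTree} (h : d ∈ rootDegs L) :
    ∃ L', L'.length = d ∧ UEquiv L L' := by
  rw [rootDegs, Multiset.mem_cons] at h
  rcases h with rfl | h
  · exact ⟨L, rfl, .refl _⟩
  · obtain ⟨y, hy, h'⟩ := exists_mem_of_mem_sum h
    obtain ⟨l1, l2, rfl⟩ := List.append_of_mem hy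
    obtain ⟨S, R, hR, hS⟩ := exists_path_of_mem_degs y h'
    exact ⟨path S.reverse (l1 ++ l2) :: R, by simpa using hR,
      (UEquiv.of_perm List.perm_middle).trans ((UEquiv.cons hS _).trans (.path_reverse _ _ _))⟩

/-- Handshake count: with `N ≥ 1` nodes, the sum of their degrees counts each of the `N - 1` edges
between nodes twice, each edge to an end once, and the edge out of the root once. -/
theorem card_blobs (t : ConfigTree) :
    t.blobs.card + 2 * t.degs.card = t.degs.sum + 1 := by
  induction t using induct with
  | hb A => simp [blobs_blob, degs_blob]
  | hn L ih =>
    have key : (L.map blobs).sum.card + 2 * (L.map degs).sum.card =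
        (L.map degs).sum.sum + L.length := by
      induction L with
      | nil => simp
      | cons x L ih' =>
        have h1 := ih x (by simp)
        have h2 := ih' fun y hy => ih y (by simp [hy])
        simp only [List.map_cons, List.sum_cons, Multiset.card_add, Multiset.sum_add,
          List.length_cons]
        omega
    simp only [blobs_node, degs_node, Multiset.card_cons, Multiset.sum_cons]
    omega

/-- The same count without an edge out of the root. It later guarantees that enough ends are
available for each merge. -/
theorem card_rootBlobs (L : List ConfigTree) :
    (rootBlobs L).card + 2 * (rootDegs L).card = (rootDegs L).sum + 2 := by
  have h := card_blobs (node L)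
  simp only [blobs_node, degs_node, Multiset.card_cons, Multiset.sum_cons] at h
  simp only [rootBlobs, rootDegs, Multiset.card_cons, Multiset.sum_cons]
  omega

theorem one_le_of_mem_degs {d : ℕ} {t : ConfigTree} (h : d ∈ t.degs) : 1 ≤ d := by
  obtain ⟨S, R, hR, -⟩ := exists_path_of_mem_degs t h
  omega

theorem branchDegrees_real (t : ConfigTree) :
    t.real.branchDegrees = t.degs + (t.blobs.map branchDegrees).sum := by
  induction t using induct with
  | hb A => simp [real_blob, blobs_blob, degs_blob]
  | hn L ih =>
    have key : ((L.map real).map branchDegrees).sum =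
        (L.map degs).sum + (((L.map blobs).sum).map branchDegrees).sum := by
      induction L with
      | nil => simp
      | cons x L ih' =>
        have h1 := ih x (by simp)
        have h2 := ih' fun y hy => ih y (by simp [hy])
        simp only [List.map_cons, List.sum_cons, Multiset.map_add, Multiset.sum_add, h1, h2]
        abel
    rw [real_node, branchDegrees_bracket, key, degs_node, blobs_node, List.length_map,
      Multiset.cons_add]

theorem degrees_tree (L : List ConfigTree) :
    (tree L).degrees = rootDegs L + ((rootBlobs L).map branchDegrees).sum := by
  have h := branchDegrees_real (node L)
  rw [real_node, branchDegrees_bracket, degs_node, blobs_node, List.length_map, Multiset.cons_add,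
    Multiset.cons_inj_right] at h
  rw [tree, degrees_bracket, h, rootDegs, rootBlobs, List.length_map, Multiset.cons_add]

/-- Strong induction on the number of vertices: an edge at the root divides the tree into two
smaller ones rooted at its ends, and the second one becomes a further child in the diagram of the
first. -/
theorem exists_equivalent_bracket (A : RootedFinTree) :
    ∃ L : List ConfigTree, (∀ x ∈ L, x.blobs = 0) ∧ A.Equivalent (bracket (L.map real)) := by
  classical
  induction hn : Fintype.card A.V using Nat.strong_induction_on generalizing A with
  | _ n ih =>
    by_cases hsub : Subsingleton A.V
    · refine ⟨[], by simp, ?_⟩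
      have e : A.V ≃ Unit := ⟨fun _ => (), fun _ => A.root, fun _ => Subsingleton.elim _ _,
        fun _ => rfl⟩
      refine .trans ⟨⟨e, ?_⟩, rfl⟩ ((attach_nil FinTree.single.marked ()).rooted ()).symm
      intro a b
      rw [Subsingleton.elim a b]
      exact iff_of_false (SimpleGraph.irrefl _) (SimpleGraph.irrefl _)
    · have : Nontrivial A.V := not_subsingleton_iff_nontrivial.mp hsub
      obtain ⟨x, hx⟩ := A.isTree.connected.preconnected.exists_adj_of_nontrivial A.root
      obtain ⟨U, W, hU, hW, hTU, hTW, e, he, hUW⟩ := A.isTree.exists_iso_edgeJoin hx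
      have hxU : x ∉ U := by rw [hUW]; simpa using hW
      have hrW : A.root ∉ W := by rw [hUW] at hU; simpa using hU
      have cU : Fintype.card U < Fintype.card A.V := by
        refine Fintype.card_subtype_lt (x := x) hxU
      have cW : Fintype.card W < Fintype.card A.V := by
        refine Fintype.card_subtype_lt (x := A.root) hrW
      obtain ⟨L, hL, hL'⟩ := ih _ (hn ▸ cU) ⟨⟨U, inferInstance, A.graph.induce U, hTU⟩, ⟨_, hU⟩⟩ rfl
      obtain ⟨M, hM, hM'⟩ := ih _ (hn ▸ cW) ⟨⟨W, inferInstance, A.graph.induce W, hTW⟩, ⟨_, hW⟩⟩ rfl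
      refine ⟨node M :: L, ?_, ?_⟩
      · intro y hy
        rcases List.mem_cons.1 hy with rfl | hy
        · rw [blobs_node]
          refine Multiset.eq_zero_of_forall_notMem fun q hq => ?_
          obtain ⟨z, hz, hq⟩ := exists_mem_of_mem_sum hq
          simp [hM z hz] at hq
        · exact hL y hy
      · rw [List.map_cons, real_node]
        refine .trans ?_ (bracket_cons_equivalent_join _ _).symm
        obtain ⟨f, hf⟩ := hL'
        obtain ⟨g, hg⟩ := hM'
        refine ⟨e.trans (SimpleGraph.edgeJoinCongr f hf g hg), ?_⟩
        change SimpleGraph.edgeJoinCongr f hf g hg (e A.root) = _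
        rw [he _ hU]
        exact congrArg Sum.inl hf

theorem exists_tree_iso (T : FinTree) :
    ∃ L : List ConfigTree, rootBlobs L = 0 ∧ Nonempty (T.graph ≃g (tree L).graph) := by
  obtain ⟨v⟩ := T.isTree.connected.nonempty
  obtain ⟨L, hL, e, -⟩ := exists_equivalent_bracket ⟨T, v⟩
  refine ⟨L, Multiset.eq_zero_of_forall_notMem fun q hq => ?_, ⟨e⟩⟩
  obtain ⟨z, hz, hq⟩ := exists_mem_of_mem_sum hq
  simp [hL z hz] at hq

/-- Gluing to the two ends of a path of nodes. -/
theorem isGluing_path (S : List (List ConfigTree)) :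
    ∃ β, IsGluing β ∧ ∀ R, (path S R).real = β (R.map real) := by
  induction S with
  | nil => exact ⟨bracket, isGluing_bracket, fun R => by rw [path, real_node]⟩
  | cons S1 Ss ih =>
    obtain ⟨β, hβ, h⟩ := ih
    exact ⟨_, hβ.step (S1.map real), fun R => by rw [path, real_node, List.map_cons, h]⟩

end ConfigTree

/-! ### Exchanges along a path, and merging ends. -/

namespace ConfigTree

theorem eq_of_isTreeInvariant {I : FinTree → ℝ} (hI : IsTreeInvariant I) {L M : List ConfigTree}
    (h : UEquiv L M) : I (tree L) = I (tree M) := hI _ _ h.1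

/-- Maximum-compatibility, stated for a path of nodes. -/
theorem exchange {I : FinTree → ℝ} (hI : IsTreeInvariant I) {ρ : RootedFinTree → ℝ}
    (hc : MaxCompatible ρ I) (S : List (List ConfigTree)) {L R M : List ConfigTree} {s : ℕ}
    (hM : (L ++ R).Perm M) (hsort : M.Pairwise fun x y => ρ y.real ≤ ρ x.real)
    (h1 : M.length ≤ 2 * s) (h2 : s ≤ M.length) (h3 : M.length - s ≤ L.length)
    (h4 : L.length ≤ s) :
    I (tree (path S R :: L)) ≤ I (tree (path S (M.drop s) :: M.take s)) ∨
    I (tree (path S R :: L)) ≤ I (tree (path S (M.take s) :: M.drop s)) := by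
  obtain ⟨β, ⟨H, v, w, hvw, hv, hw, hβ⟩, hS⟩ := isGluing_path S
  have key : ∀ L R : List ConfigTree,
      I (H.glue v w (L.map real) (R.map real)) = I (tree (path S R :: L)) := fun L R => by
    obtain ⟨e, -⟩ := hβ (L.map real) (R.map real)
    rw [← hS] at e
    exact hI _ _ ⟨e⟩
  have hmem : H.glue v w (L.map real) (R.map real) ∈ distributions H v w (M.map real) s :=
    ⟨_, _, by rw [← List.map_append]; exact hM.map real, by simpa using h3, by simpa using h4, rfl⟩
  have := hc H v w hvw hv hw (M.map real) (List.pairwise_map.2 hsort) s (by simpa using h1)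
    (by simpa using h2)
  rw [← List.map_take, ← List.map_drop, key, key] at this
  rw [← key L R]
  exact this.imp (fun h => h _ hmem) (fun h => h _ hmem)

/-- The contributions `X` and `Y` come from the path alone. A redistribution of `L ++ R` therefore
keeps the ends, and it changes the degrees only through the two list lengths. -/
theorem path_root_data (S : List (List ConfigTree)) :
    ∃ (X : Multiset ℕ) (Y : Multiset RootedFinTree), ∀ L R,
      rootDegs (path S R :: L) =
        (L.length + 1) ::ₘ (R.length + 1) ::ₘ (((L ++ R).map degs).sum + X) ∧
      rootBlobs (path S R :: L) = ((L ++ R).map blobs).sum + Y := by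
  obtain ⟨X, Y, hXY⟩ := path_data S
  refine ⟨X, Y, fun L R => ⟨?_, ?_⟩⟩
  · simp only [rootDegs, List.map_cons, List.sum_cons, (hXY R).1, List.length_cons,
      Multiset.cons_add, List.map_append, List.sum_append]
    congr 2
    abel
  · simp only [rootBlobs, List.map_cons, List.sum_cons, (hXY R).2, List.map_append,
      List.sum_append]
    abel

theorem exists_perm_sorted (ρ : RootedFinTree → ℝ) (A : List ConfigTree) :
    ∃ A' : List ConfigTree, A'.Perm A ∧ A'.Pairwise fun x y => ρ y.real ≤ ρ x.real := by
  classical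
  let r : ConfigTree → ConfigTree → Prop := fun x y => ρ y.real ≤ ρ x.real
  have : Std.Total r := ⟨fun x y => le_total _ _⟩
  have : IsTrans ConfigTree r := ⟨fun x y z h h' => le_trans h' h⟩
  exact ⟨A.insertionSort r, A.perm_insertionSort r, A.pairwise_insertionSort r⟩

/-- `A` may be put on the side of the exchange that has the better of the two sizes. -/
theorem exchange_to_front {I : FinTree → ℝ} (hI : IsTreeInvariant I) {ρ : RootedFinTree → ℝ}
    (hc : MaxCompatible ρ I) (S : List (List ConfigTree)) {L R A N : List ConfigTree}
    (hp : (L ++ R).Perm (A ++ N)) (hA : A.length ≤ L.length)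
    (h : (R.length ≤ L.length ∧ ∀ a ∈ A, ∀ n ∈ N, ρ n.real ≤ ρ a.real) ∨
      (L.length ≤ R.length ∧ ∀ a ∈ A, ∀ n ∈ N, ρ a.real ≤ ρ n.real)) :
    ∃ (S' : List (List ConfigTree)) (L' R' : List ConfigTree), L'.length = L.length ∧ (↑A : Multiset ConfigTree) ≤ ↑L' ∧
      rootBlobs (path S' R' :: L') = rootBlobs (path S R :: L) ∧
      rootDegs (path S' R' :: L') = rootDegs (path S R :: L) ∧
      I (tree (path S R :: L)) ≤ I (tree (path S' R' :: L')) := by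
  obtain ⟨A', hA', sA⟩ := exists_perm_sorted ρ A
  obtain ⟨N', hN', sN⟩ := exists_perm_sorted ρ N
  obtain ⟨X, Y, hXY⟩ := path_root_data S
  -- Compatibility does not say at which node the group with `A` ends up. If it is the far one, the
  -- path is reversed to bring it to the root.
  suffices hs : ∃ L' R' : List ConfigTree, L'.length = L.length ∧ (L' ++ R').Perm (L ++ R) ∧
      (↑A : Multiset ConfigTree) ≤ ↑L' ∧
      (I (tree (path S R :: L)) ≤ I (tree (path S R' :: L')) ∨
        I (tree (path S R :: L)) ≤ I (tree (path S L' :: R'))) by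
    obtain ⟨L', R', hL', hLR, hAL, hle⟩ := hs
    have hlen : R'.length = R.length := by
      have := hLR.length_eq
      simp only [List.length_append] at this
      omega
    have h1 := hLR.map blobs
    have h2 := hLR.map degs
    rcases hle with hle | hle
    · refine ⟨S, L', R', hL', hAL, ?_, ?_, hle⟩
      · rw [(hXY _ _).2, (hXY _ _).2, h1.sum_eq]
      · rw [(hXY _ _).1, (hXY _ _).1, h2.sum_eq, hL', hlen]
    · have hu := UEquiv.path_reverse S R' L'
      refine ⟨S.reverse, L', R', hL', hAL, ?_, ?_, hle.trans (eq_of_isTreeInvariant hI hu).le⟩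
      · rw [← hu.2.1, (hXY _ _).2, (hXY _ _).2,
          ((List.perm_append_comm.trans hLR).map blobs).sum_eq]
      · rw [← hu.2.2, (hXY _ _).1, (hXY _ _).1,
          ((List.perm_append_comm.trans hLR).map degs).sum_eq, hL', hlen, Multiset.cons_swap]
  have hperm : (L ++ R).Perm (A' ++ N') := hp.trans (hA'.append hN').symm
  have hlen : L.length + R.length = A'.length + N'.length := by
    simpa using hperm.length_eq
  have hlA : A'.length = A.length := hA'.length_eq
  rcases h with ⟨hRL, h⟩ | ⟨hLR, h⟩
  · have hsort : (A' ++ N').Pairwise fun x y => ρ y.real ≤ ρ x.real :=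
      List.pairwise_append.2 ⟨sA, sN, fun a ha n hn => h a (hA'.mem_iff.1 ha) n (hN'.mem_iff.1 hn)⟩
    -- Here `s` is the larger of the two sizes, so both candidates have groups of the original
    -- sizes, and the `s` largest branches include `A`.
    have := exchange hI hc S (s := L.length) hperm hsort (by simp; omega) (by simp; omega)
      (by simp; omega) le_rfl
    refine ⟨(A' ++ N').take L.length, (A' ++ N').drop L.length, by simp; omega, ?_, ?_, this⟩
    · rw [List.take_append_drop]
      exact hperm.symm
    · rw [List.take_append, List.take_of_length_le (by omega), ← Multiset.coe_add,
        Multiset.coe_eq_coe.2 hA']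
      exact Multiset.le_add_right _ _
  · have hsort : (N' ++ A').Pairwise fun x y => ρ y.real ≤ ρ x.real :=
      List.pairwise_append.2 ⟨sN, sA, fun n hn a ha => h a (hA'.mem_iff.1 ha) n (hN'.mem_iff.1 hn)⟩
    -- Now `L` is the shorter side: its size is that of the group left over after the `|R|` largest
    -- branches, and that group includes the small branches `A`.
    have := exchange hI hc S (s := R.length) (hperm.trans List.perm_append_comm) hsort
      (by simp; omega) (by simp; omega) (by simp; omega) hLR
    refine ⟨(N' ++ A').drop R.length, (N' ++ A').take R.length, by simp; omega, ?_, ?_,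
      this.symm⟩
    · refine List.perm_append_comm.trans ?_
      rw [List.take_append_drop]
      exact (hperm.trans List.perm_append_comm).symm
    · rw [List.drop_append, ← Multiset.coe_add, show R.length - N'.length = 0 by omega,
        List.drop_zero, Multiset.coe_eq_coe.2 hA']
      exact Multiset.le_add_left _ _

/-- Given a diagram with ends `K` and `Q` such that all members of `K` come before all other
branches with respect to `ρ`, there is a node of extremal degree that is joined to all members of
`K`. -/
theorem exists_blobs_le_root {I : FinTree → ℝ} (hI : IsTreeInvariant I) {ρ : RootedFinTree → ℝ}
    (hc : MaxCompatible ρ I) {K : List RootedFinTree} {Q : Multiset RootedFinTree}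
    {E : Multiset ℕ} {r : ℝ → ℝ → Prop}
    (hr : (r = (fun x y => y ≤ x) ∧ ∀ e ∈ E, e ≤ K.length + 1) ∨
      (r = (fun x y => x ≤ y) ∧ ∀ e ∈ E, K.length + 1 ≤ e))
    (hQ : ∀ k ∈ K, ∀ q ∈ Q, r (ρ k) (ρ q))
    (hN : ∀ k ∈ K, ∀ M : List ConfigTree, (∀ b ∈ (node M).blobs, b ∈ (K : Multiset _) + Q) →
      (∀ e ∈ (node M).degs, e ∈ (K.length + 1) ::ₘ E) → r (ρ k) (ρ (node M).real))
    (L : List ConfigTree) (hlen : L.length = K.length + 1) (hB : rootBlobs L = K + Q)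
    (hD : rootDegs L = (K.length + 1) ::ₘ E) :
    ∃ L' : List ConfigTree, L'.length = K.length + 1 ∧ rootBlobs L' = K + Q ∧
      rootDegs L' = (K.length + 1) ::ₘ E ∧
      (↑(K.map blob) : Multiset ConfigTree) ≤ ↑L' ∧ I (tree L) ≤ I (tree L') := by
  classical
  set Kc : Multiset ConfigTree := ↑(K.map blob) with hKc
  have blob_inj : Function.Injective blob := fun a b h => by cases h; rfl
  have hcount : ∀ q, Kc.count (blob q) = (K : Multiset RootedFinTree).count q := fun q => by
    rw [hKc, ← Multiset.map_coe, Multiset.count_map_eq_count' _ _ blob_inj]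
  have hcard : Kc.card = K.length := by simp [hKc]
  -- the number of ends at a node is bounded by the number of all ends
  have count_le : ∀ (q : RootedFinTree) (l : List ConfigTree),
      (l : Multiset ConfigTree).count (blob q) ≤ (rootBlobs l).count q := fun q l => by
    induction l with
    | nil => simp
    | cons x l ih =>
      rw [rootBlobs, List.map_cons, List.sum_cons, ← Multiset.cons_coe, Multiset.count_cons,
        Multiset.count_add]
      have : (if blob q = x then 1 else 0) ≤ Multiset.count q x.blobs := by
        split_ifs with h
        · rw [← h, blobs_blob]; simp
        · exact Nat.zero_le _
      rw [rootBlobs] at ih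
      omega
  -- The measure is the number of members of `K`, with multiplicity, that are not yet adjacent to
  -- the root.
  induction hn : (Kc - (L : Multiset ConfigTree)).card using Nat.strong_induction_on
    generalizing L with
  | _ n ih =>
    by_cases hle : Kc ≤ (L : Multiset ConfigTree)
    · exact ⟨L, hlen, hB, hD, hle, le_rfl⟩
    -- find a member of `K` that is not at the root
    obtain ⟨a, haK, hacount⟩ : ∃ a ∈ K, (L : Multiset ConfigTree).count (blob a) <
        Kc.count (blob a) := by
      rw [Multiset.le_iff_count] at hle
      push Not at hle
      obtain ⟨y, hy⟩ := hle
      have hyK : y ∈ Kc := Multiset.count_pos.1 (by omega)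
      rw [hKc, Multiset.mem_coe, List.mem_map] at hyK
      obtain ⟨a, ha, rfl⟩ := hyK
      exact ⟨a, ha, hy⟩
    -- The diagram has at least as many copies of `a` as `K`, and fewer of them are at the root, so
    -- one copy lies deeper, inside a child `x`.
    obtain ⟨x, hx, hxa, hxb⟩ : ∃ x ∈ L, x ≠ blob a ∧ a ∈ x.blobs := by
      by_contra hcon
      push Not at hcon
      have : ∀ l : List ConfigTree, (∀ x ∈ l, x ≠ blob a → a ∉ x.blobs) →
          (rootBlobs l).count a ≤ (l : Multiset ConfigTree).count (blob a) := fun l => by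
        induction l with
        | nil => simp [rootBlobs]
        | cons x l ih =>
          intro h
          have h1 := ih fun y hy => h y (by simp [hy])
          rw [rootBlobs, List.map_cons, List.sum_cons, ← Multiset.cons_coe, Multiset.count_cons,
            Multiset.count_add]
          rw [rootBlobs] at h1
          by_cases hxa : x = blob a
          · subst hxa
            rw [blobs_blob]
            simp only [Multiset.count_singleton_self, if_true]
            omega
          · rw [Multiset.count_eq_zero_of_notMem (h x (by simp) hxa)]
            omega
      have h1 := this L hcon
      rw [hB, Multiset.count_add, ← hcount] at h1
      omega
    obtain ⟨l1, l2, rfl⟩ := List.append_of_mem hx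
    obtain hS | ⟨S, R, hS⟩ := exists_path_of_mem_blobs x hxb
    · exact absurd hS hxa
    set L0 := l1 ++ l2 with hL0
    have hxK : x ∉ Kc := by
      intro h
      rw [hKc, Multiset.mem_coe, List.mem_map] at h
      obtain ⟨b, -, rfl⟩ := h
      rw [blobs_blob, Multiset.mem_singleton] at hxb
      exact hxa (by rw [hxb])
    have hu : UEquiv (l1 ++ x :: l2) (path S (blob a :: R) :: L0) :=
      (UEquiv.of_perm List.perm_middle).trans (.cons hS _)
    have hL : ((l1 ++ x :: l2 : List ConfigTree) : Multiset ConfigTree) = x ::ₘ ↑L0 :=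
      Multiset.coe_eq_coe.2 List.perm_middle
    have hlen0 : L0.length = K.length := by
      simp only [List.length_append, List.length_cons, hL0] at hlen ⊢
      omega
    have hB1 := hu.2.1.symm.trans hB
    have hD1 := hu.2.2.symm.trans hD
    obtain ⟨X, Y, hXY⟩ := path_root_data S
    have hB2 := (hXY L0 (blob a :: R)).2.symm.trans hB1
    have hD2 := (hXY L0 (blob a :: R)).1.symm.trans hD1
    set U : Multiset ConfigTree := ↑(L0 ++ blob a :: R) with hU
    -- All members of `K` found at either end of the path are to be collected at the root. There are
    -- at most `|K|` of them, which is the number of places left beside the path.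
    set A : Multiset ConfigTree := Kc ∩ U with hA
    have hAU : A ≤ U := Multiset.inter_le_right
    have hAK : A ≤ Kc := Multiset.inter_le_left
    have hperm : (L0 ++ blob a :: R).Perm (A.toList ++ (U - A).toList) := by
      rw [← Multiset.coe_eq_coe, ← hU, ← Multiset.coe_add A.toList, Multiset.coe_toList,
        Multiset.coe_toList, add_tsub_cancel_of_le hAU]
    have hAlen : A.toList.length ≤ L0.length := by
      rw [Multiset.length_toList, hlen0, ← hcard]
      exact Multiset.card_le_card hAK
    have hbeat : ∀ y ∈ A.toList, ∀ z ∈ (U - A).toList, r (ρ y.real) (ρ z.real) := by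
      intro y hy z hz
      rw [Multiset.mem_toList] at hy hz
      have hyK := Multiset.mem_of_le hAK hy
      rw [hKc, Multiset.mem_coe, List.mem_map] at hyK
      obtain ⟨k, hk, rfl⟩ := hyK
      rw [real_blob]
      have hzU : z ∈ L0 ++ blob a :: R := by
        have := Multiset.mem_of_le (Multiset.sub_le_self U A) hz
        rwa [hU, Multiset.mem_coe] at this
      cases z with
      | blob q =>
        rw [real_blob]
        refine hQ k hk q ?_
        -- The end `q` occurs in `U` more often than in `K`, so at least one copy belongs to `Q` and
        -- the comparison `hQ` applies.
        have h1 := Multiset.count_pos.2 hz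
        rw [Multiset.count_sub, hA, Multiset.count_inter, hcount] at h1
        have h2 := count_le q (L0 ++ blob a :: R)
        rw [← hU] at h2
        have h3 := congrArg (Multiset.count q) hB2
        rw [Multiset.count_add, Multiset.count_add] at h3
        rw [rootBlobs] at h2
        rw [← Multiset.count_pos]
        omega
      | node M =>
        refine hN k hk M (fun b hb => ?_) fun e he => ?_
        · rw [← hB2]
          exact Multiset.mem_add.2 (.inl (Multiset.mem_of_le (le_sum_of_mem hzU) hb))
        · rw [← hD2, Multiset.mem_cons, Multiset.mem_cons]
          exact .inr (.inr (Multiset.mem_add.2 (.inl (Multiset.mem_of_le (le_sum_of_mem hzU) he))))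
    have hRE : R.length + 1 + 1 ∈ E := by
      rw [hlen0, Multiset.cons_inj_right] at hD2
      rw [← hD2]
      simp
    obtain ⟨S', L', R', hL', hAL, hB', hD', hle'⟩ := exchange_to_front hI hc S hperm hAlen (by
      rcases hr with ⟨rfl, h⟩ | ⟨rfl, h⟩
      · left
        have := h _ hRE
        exact ⟨by simp only [List.length_cons]; omega, hbeat⟩
      · right
        have := h _ hRE
        exact ⟨by simp only [List.length_cons]; omega, hbeat⟩)
    have hlt : (Kc - ((path S' R' :: L' : List ConfigTree) : Multiset ConfigTree)).card < n := by
      have h1 : A ≤ ((path S' R' :: L' : List ConfigTree) : Multiset ConfigTree) := by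
        rw [Multiset.coe_toList] at hAL
        exact hAL.trans (by rw [← Multiset.cons_coe]; exact Multiset.le_cons_self _ _)
      have h2 : (Kc - ((path S' R' :: L' : List ConfigTree) : Multiset ConfigTree)).card ≤
          Kc.card - A.card := by
        rw [← Multiset.card_sub hAK]
        exact Multiset.card_le_card (tsub_le_tsub_left h1 _)
      have h3 : Kc - ((l1 ++ x :: l2 : List ConfigTree) : Multiset ConfigTree) = Kc - (Kc ∩ ↑L0) := by
        ext y
        rw [hL, Multiset.count_sub, Multiset.count_sub, Multiset.count_inter, Multiset.count_cons]
        by_cases hy : y = x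
        · subst hy
          rw [Multiset.count_eq_zero_of_notMem hxK]
          omega
        · rw [if_neg hy]
          omega
      rw [h3, Multiset.card_sub Multiset.inter_le_left] at hn
      -- Progress: the root keeps the members of `K` that it already had and gains at least one copy
      -- of `a`.
      have h4 : blob a ::ₘ (Kc ∩ ↑L0) ≤ A := by
        rw [Multiset.le_iff_count]
        intro y
        rw [hA, hU, Multiset.count_inter, ← Multiset.coe_add L0, ← Multiset.cons_coe (blob a),
          Multiset.count_add, Multiset.count_cons, Multiset.count_cons, Multiset.count_inter]
        by_cases hy : y = blob a
        · subst hy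
          rw [hL, Multiset.count_cons] at hacount
          simp only [if_true]
          split_ifs at hacount <;> omega
        · rw [if_neg hy]
          omega
      have h5 := Multiset.card_le_card h4
      rw [Multiset.card_cons] at h5
      have h6 := Multiset.card_le_card hAK
      omega
    obtain ⟨L'', h1, h2, h3, h4, h5⟩ := ih _ hlt (path S' R' :: L')
      (by rw [List.length_cons, hL', hlen0]) (hB'.trans hB1) (hD'.trans hD1) rfl
    exact ⟨L'', h1, h2, h3, h4, (eq_of_isTreeInvariant hI hu).le.trans (hle'.trans h5)⟩

/-- The ends `K` can be replaced by the single end `[K]`. -/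
theorem merge {I : FinTree → ℝ} (hI : IsTreeInvariant I) {ρ : RootedFinTree → ℝ}
    (hc : MaxCompatible ρ I) {K : List RootedFinTree} {Q : Multiset RootedFinTree}
    {E : Multiset ℕ} (hE : E ≠ 0) {r : ℝ → ℝ → Prop}
    (hr : (r = (fun x y => y ≤ x) ∧ ∀ e ∈ E, e ≤ K.length + 1) ∨
      (r = (fun x y => x ≤ y) ∧ ∀ e ∈ E, K.length + 1 ≤ e))
    (hQ : ∀ k ∈ K, ∀ q ∈ Q, r (ρ k) (ρ q))
    (hN : ∀ k ∈ K, ∀ M : List ConfigTree, (∀ b ∈ (node M).blobs, b ∈ (K : Multiset _) + Q) →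
      (∀ e ∈ (node M).degs, e ∈ (K.length + 1) ::ₘ E) → r (ρ k) (ρ (node M).real))
    (L : List ConfigTree) (hB : rootBlobs L = K + Q) (hD : rootDegs L = (K.length + 1) ::ₘ E) :
    ∃ L' : List ConfigTree, rootBlobs L' = bracket K ::ₘ Q ∧ rootDegs L' = E ∧
      I (tree L) ≤ I (tree L') := by
  classical
  obtain ⟨L1, hlen1, hu1⟩ := exists_reroot (L := L) (d := K.length + 1) (by rw [hD]; simp)
  obtain ⟨L2, hlen2, hB2, hD2, hK2, hle2⟩ := exists_blobs_le_root hI hc hr hQ hN L1 hlen1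
    (hu1.2.1.symm.trans hB) (hu1.2.2.symm.trans hD)
  obtain ⟨W, hW⟩ := Multiset.le_iff_exists_add.1 hK2
  -- The root has `|K| + 1` neighbours, hence exactly one besides `K`. It cannot be an end, because
  -- nodes with degrees `E ≠ 0` remain.
  obtain ⟨x, rfl⟩ : ∃ x, W = {x} := by
    rw [← Multiset.card_eq_one]
    have := congrArg Multiset.card hW
    rw [Multiset.card_add, Multiset.coe_card, Multiset.coe_card, List.length_map] at this
    omega
  have hperm : L2.Perm (x :: K.map blob) := by
    rw [← Multiset.coe_eq_coe, hW, add_comm, Multiset.singleton_add, Multiset.cons_coe]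
  have hu2 := UEquiv.of_perm hperm
  have hKb : ((K.map blob).map blobs).sum = (K : Multiset RootedFinTree) := by
    clear * -
    induction K with
    | nil => rfl
    | cons k K ih =>
      rw [List.map_cons, List.map_cons, List.sum_cons, ih, blobs_blob, Multiset.singleton_add,
        Multiset.cons_coe]
  have hKd : ((K.map blob).map degs).sum = 0 := by
    clear * -
    induction K with
    | nil => rfl
    | cons k K ih => rw [List.map_cons, List.map_cons, List.sum_cons, ih, degs_blob, add_zero]
  have hB3 := hu2.2.1.symm.trans hB2
  have hD3 := hu2.2.2.symm.trans hD2
  rw [rootBlobs, List.map_cons, List.sum_cons, hKb, add_comm, add_right_inj] at hB3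
  rw [rootDegs, List.map_cons, List.sum_cons, hKd, add_zero, List.length_cons, List.length_map,
    Multiset.cons_inj_right] at hD3
  cases x with
  | blob q => exact absurd (hD3.symm.trans (degs_blob q)) hE
  | node M =>
    -- Seen from the other neighbour, the old root is a node all of whose children are ends, so its
    -- whole branch can be declared an end.
    have hu3 := UEquiv.reroot (K.map blob) M
    have hreal : (node (K.map blob)).real = (blob (bracket K)).real := by
      rw [real_node, real_blob, List.map_map]
      congr 1
      conv_rhs => rw [← List.map_id K]
      exact List.map_congr_left fun k _ => real_blob k
    refine ⟨blob (bracket K) :: M, ?_, ?_, ?_⟩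
    · rw [rootBlobs, List.map_cons, List.sum_cons, blobs_blob, Multiset.singleton_add,
        ← blobs_node, hB3]
    · rw [rootDegs, List.map_cons, List.sum_cons, degs_blob, zero_add, List.length_cons,
        ← degs_node, hD3]
    · have h1 := eq_of_isTreeInvariant hI ((hu2.trans hu3))
      have h2 : tree (node (K.map blob) :: M) = tree (blob (bracket K) :: M) := by
        rw [tree, tree, List.map_cons, List.map_cons, hreal]
      rw [← h2, ← h1]
      exact (eq_of_isTreeInvariant hI hu1).le.trans hle2

end ConfigTree

/-! ### Comparing brackets by means of the recurrence rule. -/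

section rules

variable {ρ : RootedFinTree → ℝ} {f : Multiset ℝ → ℝ}

/-- Only the rule is negated, while `ρ` and the order of the variables stay. Comparisons for
decreasing rules thus follow from those for increasing ones. -/
theorem StrictlyDecreasingRule.neg (hf : StrictlyDecreasingRule ρ f) :
    StrictlyIncreasingRule ρ (fun s => -f s) := fun s hs =>
  ⟨fun x hx y hy hxy => neg_lt_neg ((hf s hs).1 x hx y hy hxy),
    fun x hx => neg_lt_neg ((hf s hs).2 x hx)⟩

/-- Variables are replaced one at a time. The multiset `C` collects those already replaced, and the
surplus members of `T` are added at the end. -/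
theorem StrictlyIncreasingRule.add_le_add (hf : StrictlyIncreasingRule ρ f) (S : Multiset ℝ) :
    ∀ T C : Multiset ℝ, (∀ z ∈ S, z ∈ Set.range ρ) → (∀ z ∈ T, z ∈ Set.range ρ) →
      (∀ z ∈ C, z ∈ Set.range ρ) → S.card ≤ T.card → (∀ x ∈ S, ∀ y ∈ T, x ≤ y) →
      f (C + S) ≤ f (C + T) := by
  induction S using Multiset.induction with
  | empty =>
    intro T
    induction T using Multiset.induction with
    | empty => intros; exact le_rfl
    | cons b T ih =>
      intro C hS hT hC _ _
      have h1 := ih C hS (fun z hz => hT z (Multiset.mem_cons_of_mem hz)) hC (by simp) (by simp)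
      refine h1.trans ?_
      rw [Multiset.add_cons]
      refine ((hf (C + T) fun z hz => ?_).2 b (hT b (by simp))).le
      rcases Multiset.mem_add.1 hz with hz | hz
      · exact hC z hz
      · exact hT z (Multiset.mem_cons_of_mem hz)
  | cons a S ih =>
    intro T C hS hT hC hcard hST
    induction T using Multiset.induction with
    | empty => simp at hcard
    | cons b T _ =>
      have hS' : ∀ z ∈ S, z ∈ Set.range ρ := fun z hz => hS z (Multiset.mem_cons_of_mem hz)
      have h1 : f (C + a ::ₘ S) ≤ f (C + b ::ₘ S) := by
        rw [Multiset.add_cons, Multiset.add_cons]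
        rcases (hST a (by simp) b (by simp)).lt_or_eq with hab | rfl
        · refine ((hf (C + S) fun z hz => ?_).1 a (hS a (by simp)) b (hT b (by simp)) hab).le
          rcases Multiset.mem_add.1 hz with hz | hz
          · exact hC z hz
          · exact hS' z hz
        · exact le_rfl
      refine h1.trans ?_
      have h2 := ih T (b ::ₘ C) hS' (fun z hz => hT z (Multiset.mem_cons_of_mem hz))
        (fun z hz => by
          rcases Multiset.mem_cons.1 hz with rfl | hz
          · exact hT z (by simp)
          · exact hC z hz)
        (by simpa using hcard)
        (fun x hx y hy => hST x (Multiset.mem_cons_of_mem hx) y (Multiset.mem_cons_of_mem hy))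
      rwa [Multiset.cons_add, Multiset.cons_add, ← Multiset.add_cons, ← Multiset.add_cons] at h2

theorem StrictlyIncreasingRule.map_le_map (hf : StrictlyIncreasingRule ρ f)
    {S T : List RootedFinTree} (hcard : S.length ≤ T.length)
    (h : ∀ x ∈ S, ∀ y ∈ T, ρ x ≤ ρ y) :
    f ((S.map ρ : List ℝ) : Multiset ℝ) ≤ f ((T.map ρ : List ℝ) : Multiset ℝ) := by
  have h1 : ∀ S : List RootedFinTree, ∀ z ∈ ((S.map ρ : List ℝ) : Multiset ℝ), z ∈ Set.range ρ :=
    fun S z hz => by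
      rw [Multiset.mem_coe, List.mem_map] at hz
      obtain ⟨A, -, rfl⟩ := hz
      exact ⟨A, rfl⟩
  have := hf.add_le_add _ _ 0 (h1 S) (h1 T) (by simp) (by simpa using hcard) (by
    intro x hx y hy
    rw [Multiset.mem_coe, List.mem_map] at hx hy
    obtain ⟨A, hA, rfl⟩ := hx
    obtain ⟨A', hA', rfl⟩ := hy
    exact h A hA A' hA')
  rwa [zero_add, zero_add] at this

/-- An increasing rule makes `[S]` at most `[T]` if `T` has at least as many branches, all of them
at least as large. -/
theorem bracket_le_bracket (hr : HasRecurrenceRule ρ f) (hf : StrictlyIncreasingRule ρ f)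
    {S T : List RootedFinTree} (hcard : S.length ≤ T.length)
    (h : ∀ x ∈ S, ∀ y ∈ T, ρ x ≤ ρ y) : ρ (bracket S) ≤ ρ (bracket T) := by
  rw [hr, hr]
  exact hf.map_le_map hcard h

/-- A decreasing rule makes `[T]` at most `[S]` if `T` has at least as many branches, all of them
at least as large. -/
theorem bracket_le_bracket' (hr : HasRecurrenceRule ρ f) (hf : StrictlyDecreasingRule ρ f)
    {S T : List RootedFinTree} (hcard : S.length ≤ T.length)
    (h : ∀ x ∈ S, ∀ y ∈ T, ρ x ≤ ρ y) : ρ (bracket T) ≤ ρ (bracket S) := by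
  rw [hr, hr]
  exact neg_le_neg_iff.1 (hf.neg.map_le_map hcard h)

end rules

/-! ### Increasing rules: the queue of ends. -/

namespace ConfigTree

theorem mem_blobs_node {t : ConfigTree} {M : List ConfigTree} (ht : t ∈ M) {b : RootedFinTree}
    (hb : b ∈ t.blobs) : b ∈ (node M).blobs := by
  rw [blobs_node]
  exact Multiset.mem_of_le (le_sum_of_mem ht) hb

theorem mem_degs_node {t : ConfigTree} {M : List ConfigTree} (ht : t ∈ M) {e : ℕ}
    (he : e ∈ t.degs) : e ∈ (node M).degs := by
  rw [degs_node, Multiset.mem_cons]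
  exact .inr (Multiset.mem_of_le (le_sum_of_mem ht) he)

/-- The branches of the greedy tree at the vertices that wait for their children, in the order of
their labels, when the vertices that follow have the degrees listed. -/
def queue : List ℕ → List RootedFinTree
  | [] => []
  | d :: ds => bracket ((queue ds).drop ((queue ds).length - (d - 1))) ::
      (queue ds).take ((queue ds).length - (d - 1))

/-- There are always enough branches in the queue. -/
def QueueOk : List ℕ → Prop
  | [] => True
  | d :: ds => 1 ≤ d ∧ d - 1 ≤ (queue ds).length ∧ QueueOk ds

theorem QueueOk.sum_branchDegrees {ds : List ℕ} (h : QueueOk ds) :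
    ((queue ds).map branchDegrees).sum = ds := by
  induction ds with
  | nil => rfl
  | cons d ds ih =>
    obtain ⟨h1, h2, h3⟩ := h
    have h4 := ih h3
    rw [← List.take_append_drop ((queue ds).length - (d - 1)) (queue ds), List.map_append,
      List.sum_append, add_comm] at h4
    rw [queue, List.map_cons, List.sum_cons, branchDegrees_bracket, Multiset.cons_add, h4,
      List.length_drop, Multiset.cons_coe]
    congr 2
    omega

section increasing

variable {ρ : RootedFinTree → ℝ} {f : Multiset ℝ → ℝ}

/-- The queue is sorted, and its members are at most `[S]` for all sufficiently large `S`. -/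
structure QueueBound (ρ : RootedFinTree → ℝ) (ds : List ℕ) (c : ℝ) : Prop where
  sorted : (queue ds).Pairwise fun x y => ρ y ≤ ρ x
  lower : ∀ x ∈ queue ds, c ≤ ρ x
  upper : ∀ D, (∀ e ∈ ds, e ≤ D) → ∀ x ∈ queue ds, ∀ S : List RootedFinTree,
    D - 1 ≤ S.length → (∀ z ∈ S, c ≤ ρ z) → ρ x ≤ ρ (bracket S)
  -- Needed while only vertices of degree one have been processed: the next merged branch may then
  -- be `bracket []`, which must not fall below `c`.
  init : (∀ e ∈ ds, e ≤ 1) → c ≤ ρ (bracket [])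

/-- Induction over the branch: its ends are at least `c`, and a node of degree at least `D` with
such children exceeds the whole queue by `upper`, hence also `c`. -/
theorem QueueBound.le_node {ds : List ℕ} {c : ℝ} (h : QueueBound ρ ds c) {D : ℕ}
    (hD : ∀ e ∈ ds, e ≤ D) {k : RootedFinTree} (hk : k ∈ queue ds) (t : ConfigTree)
    (hb : ∀ b ∈ t.blobs, b ∈ queue ds) (hd : ∀ e ∈ t.degs, D ≤ e) :
    c ≤ ρ t.real ∧ (t.degs ≠ 0 → ∀ x ∈ queue ds, ρ x ≤ ρ t.real) := by
  induction t using induct with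
  | hb A =>
    rw [real_blob]
    refine ⟨h.lower A (hb A (by rw [blobs_blob]; simp)), fun h => absurd (degs_blob A) h⟩
  | hn M ih =>
    have h1 : ∀ x ∈ queue ds, ρ x ≤ ρ (node M).real := fun x hx => by
      rw [real_node]
      refine h.upper D hD x hx _ ?_ ?_
      · have := hd (M.length + 1) (by rw [degs_node]; simp)
        rw [List.length_map]
        omega
      · intro z hz
        obtain ⟨t, ht, rfl⟩ := List.mem_map.1 hz
        exact (ih t ht (fun b hb' => hb b (mem_blobs_node ht hb'))
          (fun e he => hd e (mem_degs_node ht he))).1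
    exact ⟨(h.lower k hk).trans (h1 k hk), fun _ => h1⟩

/-- The new branch `[K]` exceeds the old queue, so the order persists. The new bound is the largest
value in `K`: a branch with at least `|K|` children, each at least that large, is at least `[K]`. If
`K` is empty, `c` can stay. -/
theorem QueueBound.cons (hr : HasRecurrenceRule ρ f) (hf : StrictlyIncreasingRule ρ f) {d : ℕ}
    {ds : List ℕ} {c : ℝ} (h : QueueBound ρ ds c) (hd : ∀ e ∈ ds, e ≤ d)
    (hlen : d - 1 ≤ (queue ds).length) : ∃ c', QueueBound ρ (d :: ds) c' := by
  set F := (queue ds).take ((queue ds).length - (d - 1)) with hF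
  set K := (queue ds).drop ((queue ds).length - (d - 1)) with hK
  have hQ : queue (d :: ds) = bracket K :: F := by rw [queue]
  have hFK : queue ds = F ++ K := (List.take_append_drop _ _).symm
  have hKlen : K.length = d - 1 := by rw [hK, List.length_drop]; omega
  have hs := h.sorted
  rw [hFK] at hs
  obtain ⟨sF, sK, sFK⟩ := List.pairwise_append.1 hs
  have mF : ∀ x ∈ F, x ∈ queue ds := fun x hx => List.mem_of_mem_take hx
  have mK : ∀ x ∈ K, x ∈ queue ds := fun x hx => List.mem_of_mem_drop hx
  have hbig : ∀ x ∈ queue ds, ρ x ≤ ρ (bracket K) := fun x hx =>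
    h.upper d hd x hx K hKlen.ge fun z hz => h.lower z (mK z hz)
  have sorted' : (queue (d :: ds)).Pairwise fun x y => ρ y ≤ ρ x := by
    rw [hQ]
    exact List.pairwise_cons.2 ⟨fun x hx => hbig x (mF x hx), sF⟩
  rcases hK0 : K with _ | ⟨k, K'⟩
  · rw [hK0] at hQ hKlen
    refine ⟨c, sorted', ?_, ?_, ?_⟩
    · rw [hQ]
      intro x hx
      rcases List.mem_cons.1 hx with rfl | hx
      · exact h.init fun e he => (hd e he).trans (by simpa [Nat.sub_eq_zero_iff_le] using hKlen.symm)
      · exact h.lower x (mF x hx)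
    · rw [hQ]
      intro D hD x hx S hS hz
      rcases List.mem_cons.1 hx with rfl | hx
      · exact bracket_le_bracket hr hf (by simp) (by simp)
      · exact h.upper D (fun e he => hD e (by simp [he])) x (mF x hx) S hS hz
    · exact fun h1 => h.init fun e he => h1 e (by simp [he])
  · have hk : k ∈ K := by rw [hK0]; simp
    have hkmax : ∀ x ∈ K, ρ x ≤ ρ k := by
      intro x hx
      rw [hK0] at hx sK
      rcases List.mem_cons.1 hx with rfl | hx
      · exact le_rfl
      · exact (List.pairwise_cons.1 sK).1 x hx
    refine ⟨ρ k, sorted', ?_, ?_, ?_⟩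
    · rw [hQ]
      intro x hx
      rcases List.mem_cons.1 hx with rfl | hx
      · exact hbig k (mK k hk)
      · exact sFK x hx k hk
    · rw [hQ]
      intro D hD x hx S hS hz
      rcases List.mem_cons.1 hx with rfl | hx
      · have := hD d (by simp)
        exact bracket_le_bracket hr hf (by omega) fun x hx y hy => (hkmax x hx).trans (hz y hy)
      · exact h.upper D (fun e he => hD e (by simp [he])) x (mF x hx) S hS
          fun z hz' => (h.lower k (mK k hk)).trans (hz z hz')
    · intro h1
      have := h1 d (by simp)
      rw [hK0, List.length_cons] at hKlen
      omega

/-- Merging the ends of a diagram step by step according to the queue. -/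
theorem exists_config_queue {I : FinTree → ℝ} (hI : IsTreeInvariant I)
    (hc : MaxCompatible ρ I) (hr : HasRecurrenceRule ρ f) (hf : StrictlyIncreasingRule ρ f)
    (L : List ConfigTree) (hB : rootBlobs L = 0) (suf : List ℕ) :
    ∀ pre : List ℕ, pre ≠ [] → (pre ++ suf).Pairwise (· ≥ ·) → (∀ e ∈ pre ++ suf, 1 ≤ e) →
      rootDegs L = ↑(pre ++ suf) →
      ∃ L', rootBlobs L' = ↑(queue suf) ∧ rootDegs L' = ↑pre ∧ I (tree L) ≤ I (tree L') ∧
        QueueOk suf ∧ ∃ c, QueueBound ρ suf c := by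
  induction suf with
  | nil =>
    intro pre _ _ _ hD
    refine ⟨L, hB, by simpa using hD, le_rfl, trivial, ρ (bracket []), ?_, ?_, ?_, ?_⟩ <;> simp [queue]
  | cons d ds ih =>
    intro pre hpre hs h1 hD
    obtain ⟨L1, hB1, hD1, hle, hok, c, hq⟩ := ih (pre ++ [d]) (by simp) (by simpa using hs)
      (by simpa using h1) (by simpa using hD)
    obtain ⟨-, s2, s3⟩ := List.pairwise_append.1 hs
    have hds : ∀ e ∈ ds, e ≤ d := (List.pairwise_cons.1 s2).1
    have hpre_ge : ∀ e ∈ pre, d ≤ e := fun e he => s3 e he d (by simp)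
    have hd1 : 1 ≤ d := h1 d (by simp)
    have hcard := card_rootBlobs L1
    rw [hB1, hD1] at hcard
    simp only [Multiset.coe_card, Multiset.sum_coe, List.length_append, List.length_singleton,
      List.sum_append, List.sum_singleton] at hcard
    -- All remaining degrees are at least `d`; by the handshake count the queue then has at least `d
    -- - 1` members.
    have hsum : pre.length * d ≤ pre.sum := by
      simpa using List.card_nsmul_le_sum pre d hpre_ge
    have hpl : 1 ≤ pre.length := List.length_pos_iff.2 hpre
    have hlen : d - 1 ≤ (queue ds).length := by
      obtain ⟨e, rfl⟩ := Nat.exists_eq_add_of_le hd1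
      rcases e with _ | e
      · simp
      · have : pre.length * (1 + (e + 1)) = pre.length * e + 2 * pre.length := by ring
        omega
    set F := (queue ds).take ((queue ds).length - (d - 1)) with hF
    set K := (queue ds).drop ((queue ds).length - (d - 1)) with hK
    have hQ : queue (d :: ds) = bracket K :: F := by rw [queue]
    have hFK : queue ds = F ++ K := (List.take_append_drop _ _).symm
    have hKlen : K.length + 1 = d := by rw [hK, List.length_drop]; omega
    have hsort := hq.sorted
    rw [hFK] at hsort
    obtain ⟨-, -, sFK⟩ := List.pairwise_append.1 hsort
    have hKF : (queue ds : Multiset RootedFinTree) = K + (F : Multiset RootedFinTree) := by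
      rw [hFK, ← Multiset.coe_add, add_comm]
    -- Smallest remaining degree, smallest ends: `K` is the tail of the sorted queue, and every
    -- composite branch exceeds the queue.
    obtain ⟨L2, hB2, hD2, hle2⟩ := merge hI hc (K := K) (Q := F) (E := ↑pre) (by simpa using hpre)
      (r := fun x y => x ≤ y) (.inr ⟨rfl, fun e he => by rw [hKlen]; exact hpre_ge e (by simpa using he)⟩)
      (fun k hk q hq' => sFK q (by simpa using hq') k hk)
      (fun k hk M hb hd => by
        refine (hq.le_node hds (k := k) (List.mem_of_mem_drop hk) (node M) (fun b hb' => ?_)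
          (fun e he => ?_)).2 (by rw [degs_node]; simp) k (List.mem_of_mem_drop hk)
        · have := hb b hb'
          rwa [← hKF, Multiset.mem_coe] at this
        · have := hd e he
          rw [hKlen, Multiset.mem_cons, Multiset.mem_coe] at this
          rcases this with rfl | this
          · exact le_rfl
          · exact hpre_ge e this)
      L1 (hB1.trans hKF) (by
        rw [hD1, hKlen, ← Multiset.coe_add, add_comm, Multiset.coe_singleton, Multiset.singleton_add])
    exact ⟨L2, by rw [hB2, hQ, Multiset.cons_coe], hD2, hle.trans hle2, ⟨hd1, hlen, hok⟩,
      hq.cons hr hf hds hlen⟩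

end increasing

/-- A diagram with a single node. -/
theorem tree_iso_of_rootDegs {L : List ConfigTree} {d : ℕ} (h : rootDegs L = {d})
    {Q : List RootedFinTree} (hQ : rootBlobs L = Q) :
    Nonempty ((tree L).graph ≃g (bracket Q).graph) ∧ Q.length = d := by
  rw [rootDegs, ← Multiset.singleton_add] at h
  have hd : ∀ t ∈ L, t.degs = 0 := fun t ht => by
    have h1 := congrArg Multiset.card h
    rw [Multiset.card_add, Multiset.card_singleton, Multiset.card_singleton] at h1
    have h2 := Multiset.card_le_card (le_sum_of_mem (f := degs) ht)
    exact Multiset.card_eq_zero.1 (by omega)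
  have hreal : (L.map real : Multiset RootedFinTree) = rootBlobs L := by
    clear h hQ
    induction L with
    | nil => rfl
    | cons t L ih =>
      simp only [rootBlobs, List.map_cons, List.sum_cons]
      rw [← Multiset.cons_coe, ih fun t ht => hd t (by simp [ht])]
      cases t with
      | blob A => rw [blobs_blob, real_blob, Multiset.singleton_add]; rfl
      | node M =>
        have := hd (node M) (by simp)
        rw [degs_node] at this
        simp at this
  rw [hQ, Multiset.coe_eq_coe] at hreal
  obtain ⟨e, -⟩ := bracket_perm hreal
  refine ⟨⟨e⟩, ?_⟩
  rw [← hreal.length_eq, List.length_map]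
  have h1 := congrArg Multiset.sum h
  have h3 : (L.map degs).sum = 0 := by
    refine Multiset.eq_zero_of_forall_notMem fun e he => ?_
    obtain ⟨t, ht, he⟩ := exists_mem_of_mem_sum he
    simp [hd t ht] at he
  rw [h3] at h1
  simpa using h1

/-- A diagram without ends for a given tree. -/
theorem exists_config (T : FinTree) : ∃ L : List ConfigTree, rootBlobs L = 0 ∧
    rootDegs L = T.degrees ∧ Nonempty (T.graph ≃g (tree L).graph) := by
  obtain ⟨L, hB, hT⟩ := exists_tree_iso T
  refine ⟨L, hB, ?_, hT⟩
  rw [FinTree.degrees_eq_of_iso hT, degrees_tree, hB]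
  simp

/-- Nodes below the root have positive degree, so an entry `0` can only come from a root without
children, which is then the whole tree. -/
theorem one_le_of_mem_degrees {T : FinTree} {d : ℕ} {ds : List ℕ}
    (hT : T.degrees = ↑(d :: ds)) (hds : ds ≠ []) :
    ∀ e ∈ d :: ds, 1 ≤ e := by
  obtain ⟨L, hB, hD, -⟩ := exists_config T
  rw [hT, rootDegs] at hD
  have key : ∀ e ∈ d :: ds, e = 0 → e = L.length ∧ L.length = 0 := fun e he h0 => by
    rw [← Multiset.mem_coe, ← hD, Multiset.mem_cons] at he
    rcases he with rfl | he
    · exact ⟨rfl, h0⟩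
    · obtain ⟨t, -, he⟩ := exists_mem_of_mem_sum he
      have := one_le_of_mem_degs he
      omega
  intro e he
  by_contra hcon
  obtain ⟨-, h1⟩ := key e he (by omega)
  rw [List.length_eq_zero_iff] at h1
  subst h1
  have := congrArg Multiset.card hD
  simp only [List.length_nil, List.map_nil, List.sum_nil, Multiset.card_cons, Multiset.card_zero,
    Multiset.coe_card, List.length_cons] at this
  exact hds (List.length_eq_zero_iff.1 (by omega))

/-- Among the trees with degree sequence `d :: ds`, the one given by the queue is optimal. -/
theorem le_queue {I : FinTree → ℝ} (hI : IsTreeInvariant I) {ρ : RootedFinTree → ℝ}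
    {f : Multiset ℝ → ℝ} (hc : MaxCompatible ρ I) (hr : HasRecurrenceRule ρ f)
    (hf : StrictlyIncreasingRule ρ f) {T : FinTree} {d : ℕ} {ds : List ℕ}
    (hT : T.degrees = ↑(d :: ds)) (hs : (d :: ds).Pairwise (· ≥ ·)) :
    I T ≤ I (bracket (queue ds)).toFinTree ∧ (queue ds).length = d ∧ QueueOk ds ∧
      (bracket (queue ds)).degrees = ↑(d :: ds) := by
  obtain ⟨L, hB, hD, hiso⟩ := exists_config T
  obtain ⟨L', hB', hD', hle, hok⟩ : ∃ L', rootBlobs L' = ↑(queue ds) ∧ rootDegs L' = {d} ∧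
      I (tree L) ≤ I (tree L') ∧ QueueOk ds := by
    rcases eq_or_ne ds [] with rfl | hds
    · exact ⟨L, hB, by rw [hD, hT]; rfl, le_rfl, trivial⟩
    · obtain ⟨L', h1, h2, h3, h4, -⟩ := exists_config_queue hI hc hr hf L hB ds [d] (by simp) hs
        (one_le_of_mem_degrees hT hds) (hD.trans hT)
      exact ⟨L', h1, h2, h3, h4⟩
  obtain ⟨h1, h2⟩ := tree_iso_of_rootDegs hD' hB'
  refine ⟨?_, h2, hok, ?_⟩
  · rw [hI _ _ hiso, ← hI _ _ h1]
    exact hle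
  · rw [degrees_bracket, hok.sum_branchDegrees, h2, Multiset.cons_coe]

end ConfigTree

/-! ### The greedy tree as a queue. -/

namespace MarkedTree

variable {α β : Type}

/-- The pairs that describe merging the roots of the trees `[C]`, `C` in the second list, with the
vertices in the first list. -/
def mergePairs (vs : List α) (Cs : List (List RootedFinTree)) : List (α × RootedFinTree) :=
  (vs.zip Cs).flatMap fun p => p.2.map fun A => (p.1, A)

theorem mergePairs_cons (v : α) (vs : List α) (C : List RootedFinTree)
    (Cs : List (List RootedFinTree)) :
    mergePairs (v :: vs) (C :: Cs) = (C.map fun A => (v, A)) ++ mergePairs vs Cs := rfl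

theorem mergePairs_append {vs ws : List α} {Cs Ds : List (List RootedFinTree)}
    (h : vs.length = Cs.length) :
    mergePairs (vs ++ ws) (Cs ++ Ds) = mergePairs vs Cs ++ mergePairs ws Ds := by
  rw [mergePairs, List.zip_append h, List.flatMap_append]
  rfl

theorem mergePairs_map (g : α → β) (vs : List α) (Cs : List (List RootedFinTree)) :
    mergePairs (vs.map g) Cs = (mergePairs vs Cs).map (Prod.map g id) := by
  induction vs generalizing Cs with
  | nil => rfl
  | cons v vs ih =>
    cases Cs with
    | nil => rfl
    | cons C Cs =>
      rw [List.map_cons, mergePairs_cons, mergePairs_cons, ih, List.map_append, List.map_map]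
      rfl

theorem eq_map_finRange {α : Type*} {n : ℕ} (l : List α) (h : l.length = n) :
    l = (List.finRange n).map fun i => l.get (i.cast h.symm) := by
  subst h
  exact (List.map_get_finRange l).symm

theorem mergePairs_finRange {n : ℕ} (g : Fin n → α) (Cs : List (List RootedFinTree))
    (h : Cs.length = n) :
    mergePairs ((List.finRange n).map g) Cs =
      (List.finRange n).flatMap fun i => (Cs.get (i.cast h.symm)).map fun A => (g i, A) := by
  conv_lhs => rw [eq_map_finRange Cs h]
  rw [mergePairs, List.zip_map', List.flatMap_map]

end MarkedTree

namespace LabelledTree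

/-- Filling after new neighbours have been added to `x`. -/
theorem fill_attach_single (T : FinTree) (x : T.V) (k : ℕ) (rest : List T.V)
    (F K : List (List RootedFinTree)) (hF : rest.length = F.length) (hK : K.length = k) :
    ((T.attach x (List.replicate k single)).marked.fill
      (mergePairs (rest.map Sum.inl ++ (List.finRange (List.replicate k single).length).map
        fun i => Sum.inr ⟨i, ((List.replicate k single).get i).root⟩) (F ++ K))).comap Sum.inl ≋
      T.marked.fill (mergePairs rest F ++ (K.map bracket).map fun A => (x, A)) := by
  have hK' : K.length = (List.replicate k single).length := by rw [hK, List.length_replicate]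
  rw [mergePairs_append (by simpa using hF), mergePairs_map, mergePairs_finRange _ K hK']
  have h := FinTree.fill_attach T x (List.replicate k single) (mergePairs rest F)
    fun i => (K.get (i.cast hK'.symm)).map fun A => (((List.replicate k single).get i).root, A)
  simp only [List.map_map] at h
  refine h.trans (fill_congr (.refl _) (List.rel_append (List.forall₂_same.2
    fun _ _ => ⟨rfl, .refl _⟩) ?_))
  conv => arg 3; rw [eq_map_finRange K hK']
  rw [List.map_map, List.map_map, List.forall₂_map_left_iff, List.forall₂_map_right_iff,
    List.forall₂_same]
  intro i _
  refine ⟨rfl, ?_⟩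
  have key : ∀ (A : RootedFinTree) (C : List RootedFinTree), A = single →
      ((A.marked.fill (C.map fun B => (A.root, B))).rooted A.root).Equivalent (bracket C) := by
    rintro A C rfl
    exact (bracket_equivalent_fill C).symm
  exact key _ _ (by simp)

end LabelledTree

namespace ConfigTree

open LabelledTree

/-- The children of the roots of the branches in the queue. -/
def queueChildren : List ℕ → List (List RootedFinTree)
  | [] => []
  | d :: ds =>
    ((queueChildren ds).drop ((queueChildren ds).length - (d - 1))).map bracket ::
      (queueChildren ds).take ((queueChildren ds).length - (d - 1))

theorem queue_eq_map (ds : List ℕ) : queue ds = (queueChildren ds).map bracket := by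
  induction ds with
  | nil => rfl
  | cons d ds ih =>
    rw [queue, queueChildren, ih, List.map_cons, List.length_map, List.map_drop, List.map_take]

/-- Invariant of the greedy algorithm: the vertices labelled from `i` on are waiting, and the
remaining steps give them the children listed in `queueChildren`. Processing a vertex appends its `d
- 1` children to the end of the waiting list, which matches `queue` taking its last `d - 1`
branches. The condition `i ≠ 0` means that the vertex already has a parent. -/
theorem greedySteps_iso (ds : List ℕ) : ∀ (S : LabelledTree) (i : ℕ), i ≠ 0 →
    QueueOk ds → (S.labels.drop i).length = (queueChildren ds).length →
    Nonempty ((greedySteps S i ds).tree.graph ≃g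
      (S.tree.marked.fill (mergePairs (S.labels.drop i) (queueChildren ds))).tree.graph) := by
  induction ds with
  | nil =>
    intro S i _ _ _
    have : mergePairs (S.labels.drop i) (queueChildren []) = [] := by
      simp [mergePairs, queueChildren]
    rw [this]
    exact ⟨.refl⟩
  | cons d ds ih =>
    intro S i hi hok hlen
    obtain ⟨h1, h2, h3⟩ := hok
    rw [queue_eq_map, List.length_map] at h2
    set Q := queueChildren ds with hQ
    set F := Q.take (Q.length - (d - 1)) with hF
    set K := Q.drop (Q.length - (d - 1)) with hK
    have hqc : queueChildren (d :: ds) = K.map bracket :: F := by rw [queueChildren]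
    have hFK : F ++ K = Q := List.take_append_drop _ _
    have hKlen : K.length = d - 1 := by rw [hK, List.length_drop]; omega
    rw [hqc, List.length_cons] at hlen
    have hil : i < S.labels.length := by
      rw [List.length_drop] at hlen
      omega
    have hd : S.labels.drop i = S.labels[i] :: S.labels.drop (i + 1) :=
      List.drop_eq_getElem_cons hil
    have hadd : S.addNeighbours i (d - 1) =
        S.graft S.labels[i] (List.replicate (d - 1) RootedFinTree.single) := by
      rw [addNeighbours, List.getElem?_eq_getElem hil]
    have hrest : (S.labels.drop (i + 1)).length = F.length := by
      rw [hd, List.length_cons] at hlen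
      omega
    rw [greedySteps, if_neg hi, hadd]
    have hlab : (S.graft S.labels[i] (List.replicate (d - 1) single)).labels.drop (i + 1) = (S.labels.drop (i + 1)).map Sum.inl ++
        (List.finRange (List.replicate (d - 1) single).length).map
          fun i => Sum.inr ⟨i, ((List.replicate (d - 1) single).get i).root⟩ := by
      rw [List.drop_append_of_le_length (by simpa using hil), List.map_drop]
    obtain ⟨e⟩ := ih (S.graft S.labels[i] (List.replicate (d - 1) single)) (i + 1) (by omega) h3 (by
      rw [hlab, ← hFK]
      simp only [List.length_append, List.length_map, hrest, List.length_finRange,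
        List.length_replicate, hKlen])
    have h4 := fill_attach_single S.tree S.labels[i] (d - 1) (S.labels.drop (i + 1)) F K hrest hKlen
    obtain ⟨e'⟩ := h4.nonempty_iso
    obtain ⟨e''⟩ := (fill_perm S.tree.marked (List.perm_append_comm (l₁ := mergePairs _ F)
      (l₂ := (K.map bracket).map fun A => (S.labels[i], A)))).nonempty_iso
    rw [← hFK, hlab] at e
    rw [hqc, hd, mergePairs_cons]
    exact ⟨(e.trans e').trans e''⟩

/-- The root has no parent and receives `d` rather than `d - 1` neighbours, so its step is treated
separately; afterwards exactly `d` vertices are waiting. -/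
theorem greedyTree_iso {d : ℕ} {ds : List ℕ} (hok : QueueOk ds) (hd : (queue ds).length = d) :
    Nonempty ((greedyTree (d :: ds)).graph ≃g (bracket (queue ds)).graph) := by
  rw [queue_eq_map, List.length_map] at hd
  have h0 : greedyTree (d :: ds) =
      (greedySteps (start.graft () (List.replicate d single)) 1 ds).tree := by
    rw [greedyTree, greedySteps]
    rfl
  have hlab : (start.graft () (List.replicate d single)).labels.drop 1 = ([] : List Unit).map Sum.inl ++
      (List.finRange (List.replicate d single).length).map
        fun i => Sum.inr ⟨i, ((List.replicate d single).get i).root⟩ := rfl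
  obtain ⟨e⟩ := greedySteps_iso ds (start.graft () (List.replicate d single)) 1 one_ne_zero hok (by
    rw [hlab]
    simp only [List.map_nil, List.nil_append, List.length_map, List.length_finRange,
      List.length_replicate, hd])
  have h4 := fill_attach_single FinTree.single () d [] [] (queueChildren ds) rfl hd
  obtain ⟨e'⟩ := h4.nonempty_iso
  rw [hlab] at e
  rw [h0, queue_eq_map]
  obtain ⟨e'', -⟩ := bracket_equivalent_fill ((queueChildren ds).map bracket)
  exact ⟨(e.trans e').trans e''.symm⟩

end ConfigTree

/-! ### Decreasing rules: the pool of ends. -/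

namespace ConfigTree

/-- Take off the branches for stars whose centres have the degrees `es`, one after the other, from
the beginning of `P`. The result consists of the new branches and the remaining list. -/
def chop : List ℕ → List RootedFinTree → List RootedFinTree × List RootedFinTree
  | [], P => ([], P)
  | e :: es, P => (bracket (P.take (e - 1)) :: (chop es (P.drop (e - 1))).1,
      (chop es (P.drop (e - 1))).2)

theorem chop_append (es es' : List ℕ) (P : List RootedFinTree) :
    chop (es ++ es') P =
      ((chop es P).1 ++ (chop es' (chop es P).2).1, (chop es' (chop es P).2).2) := by
  induction es generalizing P with
  | nil => rfl
  | cons e es ih => simp [chop, ih]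

theorem chop_length (es : List ℕ) (P : List RootedFinTree) : (chop es P).1.length = es.length := by
  induction es generalizing P with
  | nil => rfl
  | cons e es ih => simp [chop, ih]

theorem chop_snd_suffix (es : List ℕ) (P : List RootedFinTree) : (chop es P).2 <:+ P := by
  induction es generalizing P with
  | nil => exact List.suffix_refl _
  | cons e es ih => exact (ih _).trans (List.drop_suffix _ _)

/-- The branches at the root `v₁` of the `M`-tree with degrees `ds` when its leaves are replaced by
the branches `P`; the end of `P` belongs to the vertices with small labels. -/
def mFill (ds : List ℕ) (P : List RootedFinTree) : List RootedFinTree :=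
  if h : ds = [] then P
  else
    let t := ds.length
    let dt := ds.getLast h
    if t ≤ dt + 1 then (chop (ds.take (t - 1)) P).1 ++ (chop (ds.take (t - 1)) P).2
    else
      mFill ((ds.take (t - 1)).drop (dt - 1))
        ((chop (ds.take (dt - 1)) P).2 ++ [bracket (chop (ds.take (dt - 1)) P).1])
termination_by ds.length
decreasing_by
  have : 0 < ds.length := List.length_pos_iff.mpr h
  simp only [List.length_drop, List.length_take]
  omega

variable {ρ : RootedFinTree → ℝ} {f : Multiset ℝ → ℝ}

/-- Bounds for the values of `ρ` on `P` and on branches with degrees between `d` and `D`. -/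
structure PoolBound (ρ : RootedFinTree → ℝ) (D d : ℕ) (P : List RootedFinTree) (c a : ℝ) :
    Prop where
  sorted : P.Pairwise fun x y => ρ y ≤ ρ x
  lower : ∀ x ∈ P, c ≤ ρ x
  upper : ∀ x ∈ P, ρ x ≤ a
  -- The fields `lo` and `hi` together confine every branch built later to values from `c` up to the
  -- smallest member of the pool.
  lo : ∀ S : List RootedFinTree, S.length ≤ D - 1 → (∀ z ∈ S, ρ z ≤ a) → c ≤ ρ (bracket S)
  hi : ∀ S : List RootedFinTree, d - 1 ≤ S.length → (∀ z ∈ S, c ≤ ρ z) →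
    ∀ x ∈ P, ρ (bracket S) ≤ ρ x

/-- Both bounds are proved in one induction, since `lo` needs the upper bound `a` for the children
and `hi` needs the lower bound `c`. -/
theorem PoolBound.node_le {D d : ℕ} {P : List RootedFinTree} {c a : ℝ} (h : PoolBound ρ D d P c a)
    (hP : P ≠ []) (t : ConfigTree) (hb : ∀ b ∈ t.blobs, c ≤ ρ b ∧ ρ b ≤ a)
    (hd : ∀ e ∈ t.degs, d ≤ e ∧ e ≤ D) :
    c ≤ ρ t.real ∧ ρ t.real ≤ a ∧ (t.degs ≠ 0 → ∀ x ∈ P, ρ t.real ≤ ρ x) := by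
  induction t using induct with
  | hb A =>
    rw [real_blob]
    obtain ⟨h1, h2⟩ := hb A (by rw [blobs_blob]; simp)
    exact ⟨h1, h2, fun h => absurd (degs_blob A) h⟩
  | hn M ih =>
    have h0 := hd (M.length + 1) (by rw [degs_node]; simp)
    have ih' : ∀ z ∈ M.map real, c ≤ ρ z ∧ ρ z ≤ a := fun z hz => by
      obtain ⟨t, ht, rfl⟩ := List.mem_map.1 hz
      have := ih t ht (fun b hb' => hb b (mem_blobs_node ht hb'))
        (fun e he => hd e (mem_degs_node ht he))
      exact ⟨this.1, this.2.1⟩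
    rw [real_node]
    have h1 := h.hi (M.map real) (by rw [List.length_map]; omega) fun z hz => (ih' z hz).1
    obtain ⟨p, hp⟩ := List.exists_mem_of_ne_nil P hP
    exact ⟨h.lo _ (by rw [List.length_map]; omega) fun z hz => (ih' z hz).2,
      (h1 p hp).trans (h.upper p hp), fun _ => h1⟩

/-- The degree `|K| + 1` passes from the list of nodes to the root of the branch `[K]`, so the
degrees of the tree itself are unchanged. -/
theorem degrees_merge {K : List RootedFinTree} {Q : Multiset RootedFinTree} {E : Multiset ℕ}
    {L L' : List ConfigTree} (hB : rootBlobs L = K + Q) (hD : rootDegs L = (K.length + 1) ::ₘ E)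
    (hB' : rootBlobs L' = bracket K ::ₘ Q) (hD' : rootDegs L' = E) :
    (tree L').degrees = (tree L).degrees := by
  rw [degrees_tree, degrees_tree, hB, hD, hB', hD', Multiset.map_cons, Multiset.sum_cons,
    branchDegrees_bracket, Multiset.map_add, Multiset.sum_add, Multiset.map_coe, Multiset.sum_coe,
    Multiset.cons_add, Multiset.cons_add, Multiset.add_cons]

/-- A branch formed from the largest members of a pool, and its position in the pool. -/
structure IsTopBranch (ρ : RootedFinTree → ℝ) (es : List ℕ) (P P' : List RootedFinTree)
    (X : RootedFinTree) : Prop where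
  exists_eq : ∃ V : List RootedFinTree, X = bracket V ∧ (∃ e ∈ es, V.length = e - 1) ∧
    (∀ v ∈ V, v ∈ P) ∧ ∀ v ∈ V, ∀ p ∈ P', ρ p ≤ ρ v

/-- Forming stars around the nodes of largest degree. -/
theorem exists_config_chop {I : FinTree → ℝ} (hI : IsTreeInvariant I) (hc : MaxCompatible ρ I)
    {D d : ℕ} {P0 : List RootedFinTree} {c a : ℝ} (h : PoolBound ρ D d P0 c a) (hd2 : 2 ≤ d)
    {rest : List ℕ} (hrest : rest ≠ []) (es : List ℕ) :
    ∀ (X P : List RootedFinTree) (L : List ConfigTree), P <:+ P0 →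
      (∀ x ∈ X, c ≤ ρ x ∧ ∀ p ∈ P0, ρ x ≤ ρ p) → (es ++ rest).Pairwise (· ≥ ·) →
      (∀ e ∈ es ++ rest, d ≤ e ∧ e ≤ D) → X.length + es.length ≤ d →
      rootBlobs L = ↑(X ++ P) → rootDegs L = ↑(es ++ rest) →
      ∃ L', rootBlobs L' = ↑(X ++ (chop es P).1 ++ (chop es P).2) ∧ rootDegs L' = ↑rest ∧
        I (tree L) ≤ I (tree L') ∧ (tree L').degrees = (tree L).degrees ∧
        (∀ x ∈ (chop es P).1, (c ≤ ρ x ∧ ∀ p ∈ P0, ρ x ≤ ρ p) ∧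
          IsTopBranch ρ es P (chop es P).2 x) ∧
        (∀ e, es.getLast? = some e → e - 1 ≤ P.length) := by
  induction es with
  | nil =>
    intro X P L _ _ _ _ _ hB hD
    exact ⟨L, by simpa [chop] using hB, hD, le_rfl, rfl, by simp [chop], by simp⟩
  | cons e es ih =>
    intro X P L hPP0 hX hs hdD hlen hB hD
    have hd : ∀ e' ∈ es ++ rest, d ≤ e' := fun e' he => (hdD e' (by simp at he ⊢; tauto)).1
    -- Handshake count: one degree in `rest` is at least `d`, the other degrees after `e` are at
    -- least `2`, and at most `d - 1` ends lie in `X`, so at least `e - 1` ends are left for `P`.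
    have hPl : e - 1 ≤ P.length := by
      have hcard := card_rootBlobs L
      rw [hB, hD] at hcard
      simp only [Multiset.coe_card, Multiset.sum_coe, List.length_append, List.length_cons,
        List.sum_append, List.sum_cons, List.cons_append] at hcard hlen
      have h1 : es.length * 2 ≤ es.sum := by
        simpa using List.card_nsmul_le_sum es 2 fun x hx => hd2.trans (hd x (by simp [hx]))
      obtain ⟨r0, rest', rfl⟩ := List.exists_cons_of_ne_nil hrest
      have h2 : rest'.length * 2 ≤ rest'.sum := by
        simpa using List.card_nsmul_le_sum rest' 2 fun x hx => hd2.trans (hd x (by simp [hx]))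
      have h3 := hd r0 (by simp)
      simp only [List.length_cons, List.sum_cons] at hcard
      omega
    set K := P.take (e - 1) with hK
    set P' := P.drop (e - 1) with hP'
    have hKlen : K.length = e - 1 := by rw [hK, List.length_take]; omega
    have he := hdD e (by simp)
    have hKP : ∀ x ∈ K, x ∈ P := fun x hx => List.mem_of_mem_take hx
    have hP'P : ∀ x ∈ P', x ∈ P := fun x hx => List.mem_of_mem_drop hx
    have hPm : ∀ x ∈ P, x ∈ P0 := fun x hx => hPP0.subset hx
    have hsP := h.sorted.sublist hPP0.sublist
    have hsplit : P = K ++ P' := (List.take_append_drop _ _).symm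
    have hKne : K ≠ [] := by
      rw [← List.length_pos_iff, hKlen]
      omega
    have hP0 : P0 ≠ [] := by
      obtain ⟨k, hk⟩ := List.exists_mem_of_ne_nil K hKne
      exact List.ne_nil_of_mem (hPm k (hKP k hk))
    rw [hsplit] at hsP
    have sKP := (List.pairwise_append.1 hsP).2.2
    have hXP : ∀ b ∈ X ++ P, c ≤ ρ b ∧ ρ b ≤ a := fun b hb => by
      rcases List.mem_append.1 hb with hb | hb
      · obtain ⟨p, hp⟩ := List.exists_mem_of_ne_nil P0 hP0
        exact ⟨(hX b hb).1, ((hX b hb).2 p hp).trans (h.upper p hp)⟩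
      · exact ⟨h.lower b (hPm b hb), h.upper b (hPm b hb)⟩
    have hB1 : rootBlobs L = K + ((P' ++ X : List RootedFinTree) : Multiset RootedFinTree) := by
      rw [hB, hsplit, Multiset.coe_add, Multiset.coe_eq_coe]
      exact List.perm_append_comm.trans (by rw [List.append_assoc])
    have hD1 : rootDegs L = (K.length + 1) ::ₘ ((es ++ rest : List ℕ) : Multiset ℕ) := by
      rw [hD, hKlen, Nat.sub_add_cancel (by omega), Multiset.cons_coe]
      rfl
    obtain ⟨L1, hB2, hD2, hle⟩ := merge hI hc (K := K) (Q := ↑(P' ++ X)) (E := ↑(es ++ rest))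
      (by simp [hrest]) (r := fun x y => y ≤ x)
      (.inl ⟨rfl, fun e' he' => by
        rw [hKlen, Nat.sub_add_cancel (by omega)]
        exact (List.pairwise_cons.1 hs).1 e' (by simpa using he')⟩)
      (fun k hk q hq => by
        rw [Multiset.mem_coe, List.mem_append] at hq
        rcases hq with hq | hq
        · exact sKP k hk q hq
        · exact (hX q hq).2 k (hPm k (hKP k hk)))
      (fun k hk M hb hd' => by
        refine (h.node_le hP0 (node M) (fun b hb' => ?_) (fun e' he' => ?_)).2.2
          (by rw [degs_node]; simp) k (hPm k (hKP k hk))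
        · have := hb b hb'
          rw [← hB1, hB] at this
          exact hXP b (by simpa using this)
        · have := hd' e' he'
          rw [← hD1, hD] at this
          exact hdD e' (by simpa using this))
      L hB1 hD1
    -- The new branch falls below the whole pool, so it never competes with the members of `P` for a
    -- place in a later star.
    have hnew : c ≤ ρ (bracket K) ∧ ∀ p ∈ P0, ρ (bracket K) ≤ ρ p :=
      ⟨h.lo K (by omega) fun z hz => h.upper z (hPm z (hKP z hz)),
        h.hi K (by omega) fun z hz => h.lower z (hPm z (hKP z hz))⟩
    obtain ⟨L2, hB3, hD3, hle3, hdeg3, hnew3, hlast⟩ := ih (X ++ [bracket K]) P' L1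
      ((List.drop_suffix _ _).trans hPP0)
      (fun x hx => by
        rcases List.mem_append.1 hx with hx | hx
        · exact hX x hx
        · rw [List.mem_singleton.1 hx]
          exact hnew)
      (List.pairwise_cons.1 hs).2 (fun e' he' => hdD e' (by simp at he' ⊢; tauto))
      (by simp only [List.length_append, List.length_cons, List.length_nil] at hlen ⊢; omega)
      (by
        rw [hB2, Multiset.cons_coe, Multiset.coe_eq_coe, List.append_assoc]
        refine (List.Perm.cons _ List.perm_append_comm).trans ?_
        exact List.perm_middle.symm) hD2
    refine ⟨L2, ?_, hD3, hle.trans hle3, hdeg3.trans (degrees_merge hB1 hD1 hB2 hD2), ?_, ?_⟩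
    · rw [hB3]
      simp only [chop, List.append_assoc, List.cons_append]
      rfl
    · intro x hx
      simp only [chop, List.mem_cons] at hx
      rcases hx with rfl | hx
      · refine ⟨hnew, ⟨K, rfl, ⟨e, by simp, hKlen⟩, hKP, fun v hv p hp => sKP v hv p ?_⟩⟩
        exact (chop_snd_suffix es P').subset hp
      · obtain ⟨h1, ⟨V, hV1, ⟨e', he', hV2⟩, hV3, hV4⟩⟩ := hnew3 x hx
        exact ⟨h1, ⟨V, hV1, ⟨e', by simp [he'], hV2⟩, fun v hv => hP'P v (hV3 v hv), hV4⟩⟩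
    · intro e' he'
      rcases es with _ | ⟨e1, es⟩
      · simp only [List.getLast?_singleton, Option.some.injEq] at he'
        omega
      · rw [List.getLast?_cons_cons] at he'
        have := hlast e' he'
        rw [hP', List.length_drop] at this
        omega

/-- The optimum among the trees with a fixed degree sequence and ends `P`, for a decreasing rule. -/
theorem le_mFill {I : FinTree → ℝ} (hI : IsTreeInvariant I) (hc : MaxCompatible ρ I)
    (hr : HasRecurrenceRule ρ f) (hf : StrictlyDecreasingRule ρ f) (ds : List ℕ) :
    ∀ (P : List RootedFinTree) (L : List ConfigTree) (D d : ℕ) (c a : ℝ), ds ≠ [] → 2 ≤ d →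
      PoolBound ρ D d P c a → (∀ e ∈ ds, d ≤ e ∧ e ≤ D) → ds.Pairwise (· ≥ ·) →
      rootBlobs L = ↑P → rootDegs L = ↑ds →
      I (tree L) ≤ I (bracket (mFill ds P)).toFinTree ∧
        (bracket (mFill ds P)).degrees = (tree L).degrees := by
  induction hn : ds.length using Nat.strong_induction_on generalizing ds with
  | _ n ih =>
    intro P L D d c a hds hd2 h hdD hs hB hD
    obtain ⟨init, m, rfl⟩ : ∃ init m, ds = init ++ [m] :=
      ⟨ds.dropLast, ds.getLast hds, (List.dropLast_append_getLast hds).symm⟩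
    have hm2 : 2 ≤ m := hd2.trans (hdD m (by simp)).1
    have hinit : (init ++ [m]).take ((init ++ [m]).length - 1) = init := by
      simp
    have hmmin : ∀ e ∈ init, m ≤ e := fun e he => (List.pairwise_append.1 hs).2.2 e he m (by simp)
    have hdm : d ≤ m := (hdD m (by simp)).1
    -- Raising `d` to the smallest degree `m` only weakens `hi`, and it makes room for `m` branches
    -- in `exists_config_chop`.
    have hm : PoolBound ρ D m P c a := ⟨h.sorted, h.lower, h.upper, h.lo,
      fun S hS => h.hi S (by omega)⟩
    have hmD : ∀ e ∈ init ++ [m], m ≤ e ∧ e ≤ D := fun e he => by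
      refine ⟨?_, (hdD e he).2⟩
      rcases List.mem_append.1 he with he | he
      · exact hmmin e he
      · exact (List.mem_singleton.1 he).ge
    rw [mFill, dif_neg hds]
    simp only [List.getLast_append_singleton, hinit]
    split_ifs with hcase
    -- There are at most `m` other nodes. All of them become branches, and the node of degree `m` is
    -- the only one left.
    · obtain ⟨L', hB', hD', hle, hdeg, -, -⟩ := exists_config_chop hI hc hm hm2 (rest := [m])
        (by simp) init [] P L (List.suffix_refl _) (by simp) hs hmD (by
          simp only [List.length_append, List.length_singleton, List.length_nil] at hcase ⊢
          omega) (by simpa using hB) hD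
      obtain ⟨e, -⟩ := tree_iso_of_rootDegs (d := m) hD' hB'
      rw [List.nil_append] at e
      rw [← hI _ _ e, ← hdeg]
      exact ⟨hle, (FinTree.degrees_eq_of_iso e).symm⟩
    · simp only [List.length_append, List.length_singleton, not_le] at hcase
      -- the degrees of the stars, the last one of them, and the remaining degrees
      set es := init.take (m - 1) with hes
      set rest := init.drop (m - 1) with hrest
      have hes' : (init ++ [m]).take (m - 1) = es := by
        rw [hes, List.take_append_of_le_length (by omega)]
      rw [hes']
      have heslen : es.length = m - 1 := by rw [hes, List.length_take]; omega
      have hrestlen : rest.length = init.length - (m - 1) := by rw [hrest, List.length_drop]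
      have hrestne : rest ≠ [] := by rw [← List.length_pos_iff]; omega
      have hsplit : init = es ++ rest := (List.take_append_drop _ _).symm
      have hesne : es ≠ [] := by rw [← List.length_pos_iff]; omega
      obtain ⟨es0, l, hesl⟩ : ∃ es0 l, es = es0 ++ [l] :=
        ⟨es.dropLast, es.getLast hesne, (List.dropLast_append_getLast hesne).symm⟩
      have hall : init ++ [m] = es0 ++ ([l] ++ (rest ++ [m])) := by
        rw [hsplit, hesl]
        simp
      have hs' := hs
      rw [hall] at hs'
      have hsl := (List.pairwise_append.1 hs').2.1
      have hes0l : ∀ e ∈ es0, l ≤ e := fun e he =>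
        (List.pairwise_append.1 hs').2.2 e he l (by simp)
      have hlrest : ∀ e ∈ rest ++ [m], e ≤ l := fun e he =>
        (List.pairwise_append.1 hsl).2.2 l (by simp) e he
      have hml : m ≤ l := hlrest m (by simp)
      have hes0len : es0.length + 1 = m - 1 := by
        rw [← heslen, hesl]
        simp
      -- all stars but the last one
      obtain ⟨L1, hB1, hD1, hle1, hdeg1, hX1, -⟩ := exists_config_chop hI hc hm hm2
        (rest := [l] ++ (rest ++ [m])) (by simp) es0 [] P L (List.suffix_refl _) (by simp) hs'
        (hall ▸ hmD) (by simp only [List.length_nil]; omega) (by simpa using hB) (by rw [hD, hall])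
      rw [List.nil_append] at hB1
      set X0 := (chop es0 P).1 with hX0
      set P1 := (chop es0 P).2 with hP1
      have hP1P : P1 <:+ P := chop_snd_suffix es0 P
      -- the last star
      obtain ⟨L2, hB2, hD2, hle2, hdeg2, hX2, hUl⟩ := exists_config_chop hI hc hm hm2
        (rest := rest ++ [m]) (by simp) [l] X0 P1 L1 hP1P (fun x hx => (hX1 x hx).1) hsl
        (fun e he => hmD e (by rw [hall]; exact List.mem_append_right _ he))
        (by rw [chop_length, List.length_singleton]; omega) hB1 hD1
      set U := P1.take (l - 1) with hU
      set P2 := P1.drop (l - 1) with hP2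
      have hc1 : chop [l] P1 = ([bracket U], P2) := rfl
      have hchop : chop es P = (X0 ++ [bracket U], P2) := by
        rw [hesl, chop_append, ← hP1, hc1]
      rw [hc1] at hB2 hX2
      rw [hchop]
      simp only at hB2 hX2 ⊢
      set K := X0 ++ [bracket U] with hK
      have hKlen : K.length + 1 = m := by
        rw [hK, List.length_append, chop_length, List.length_singleton]
        omega
      have hUlen : U.length = l - 1 := by
        have := hUl l rfl
        rw [hU, List.length_take]
        omega
      have hUne : U ≠ [] := by rw [← List.length_pos_iff]; omega
      have hUP : ∀ u ∈ U, u ∈ P := fun u hu => hP1P.subset (List.mem_of_mem_take hu)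
      have hU1 : ∀ u ∈ U, u ∈ P1 := fun u hu => List.mem_of_mem_take hu
      have hP2P1 : ∀ p ∈ P2, p ∈ P1 := fun p hp => List.mem_of_mem_drop hp
      have hP2P : ∀ p ∈ P2, p ∈ P := fun p hp => hP1P.subset (hP2P1 p hp)
      have hsP1 := h.sorted.sublist hP1P.sublist
      have hP1split : P1 = U ++ P2 := (List.take_append_drop _ _).symm
      rw [hP1split] at hsP1
      obtain ⟨sU, sP2, sUP2⟩ := List.pairwise_append.1 hsP1
      -- The smallest member of the last star; its value becomes the next upper bound `a`.
      set u := U.getLast hUne with hu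
      have huU : u ∈ U := List.getLast_mem hUne
      have hUu : ∀ v ∈ U, ρ u ≤ ρ v := by
        intro v hv
        rw [← List.dropLast_append_getLast hUne] at hv sU
        rcases List.mem_append.1 hv with hv | hv
        · exact (List.pairwise_append.1 sU).2.2 v hv u (by simp [hu])
        · rw [List.mem_singleton.1 hv]
      have hKP : ∀ x ∈ K, c ≤ ρ x ∧ ∀ p ∈ P, ρ x ≤ ρ p := fun x hx => by
        rcases List.mem_append.1 hx with hx | hx
        · exact (hX1 x hx).1
        · exact (hX2 x hx).1
      -- Earlier branches have at least as many children, all of them at least as large as those in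
      -- `U`; a decreasing rule therefore makes `[U]` the largest member of `K`. This is why the
      -- last star is formed separately.
      have hKU : ∀ x ∈ K, ρ x ≤ ρ (bracket U) := fun x hx => by
        rcases List.mem_append.1 hx with hx | hx
        · obtain ⟨V, rfl, ⟨e, he, hV2⟩, -, hV4⟩ := (hX1 x hx).2
          have := hes0l e he
          exact bracket_le_bracket' hr hf (by omega) fun y hy v hv => hV4 v hv y (hU1 y hy)
        · rw [List.mem_singleton.1 hx]
      have hPne : P ≠ [] := List.ne_nil_of_mem (hUP u huU)
      have hbU : c ≤ ρ (bracket U) := (hKP (bracket U) (by simp [hK])).1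
      -- join the stars to a node of smallest degree
      have hB3 : rootBlobs L2 = K + (P2 : Multiset RootedFinTree) := by
        rw [hB2, Multiset.coe_add]
      have hD3 : rootDegs L2 = (K.length + 1) ::ₘ (rest : Multiset ℕ) := by
        rw [hD2, hKlen, Multiset.cons_coe, Multiset.coe_eq_coe]
        exact List.perm_append_comm
      obtain ⟨L3, hB4, hD4, hle3⟩ := merge hI hc (K := K) (Q := ↑P2) (E := ↑rest)
        (by simpa using hrestne) (r := fun x y => x ≤ y)
        (.inr ⟨rfl, fun e he => by
          rw [hKlen]
          exact hmmin e (List.mem_of_mem_drop (by simpa using he))⟩)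
        (fun k hk q hq => (hKP k hk).2 q (hP2P q (by simpa using hq)))
        -- A further composite branch has at most `l - 1` children, as `l` bounds the degrees left,
        -- and each of them is at most `ρ u`. So it is at least `[U]`, and hence at least every
        -- member of `K`.
        (fun k hk M hb hd' => by
          refine (hKU k hk).trans ?_
          rw [real_node]
          have hdM : ∀ e ∈ (node M).degs, m ≤ e ∧ e ≤ l := fun e he => by
            have := hd' e he
            rw [← hD3, hD2, Multiset.mem_coe] at this
            exact ⟨(hmD e (by rw [hall]; simp at this ⊢; tauto)).1, hlrest e this⟩
          have hM := hdM (M.length + 1) (by rw [degs_node]; simp)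
          refine bracket_le_bracket' hr hf (by rw [List.length_map]; omega) ?_
          intro x hx v hv
          refine le_trans ?_ (hUu v hv)
          obtain ⟨t, ht, rfl⟩ := List.mem_map.1 hx
          have hbt : ∀ b ∈ t.blobs, c ≤ ρ b ∧ ∀ w ∈ U, ρ b ≤ ρ w := fun b hb' => by
            have := hb b (mem_blobs_node ht hb')
            rw [Multiset.coe_add, Multiset.mem_coe, List.mem_append] at this
            rcases this with hb | hb
            · exact ⟨(hKP b hb).1, fun w hw => (hKP b hb).2 w (hUP w hw)⟩
            · exact ⟨h.lower b (hP2P b hb), fun w hw => sUP2 w hw b hb⟩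
          cases t with
          | blob A =>
            rw [real_blob]
            exact (hbt A (by rw [blobs_blob]; simp)).2 u huU
          | node N =>
            refine (h.node_le hPne (node N) (fun b hb' => ⟨(hbt b hb').1,
              ((hbt b hb').2 u huU).trans (h.upper u (hUP u huU))⟩) (fun e he => ?_)).2.2
              (by rw [degs_node]; simp) u (hUP u huU)
            have h1 := hdM e (mem_degs_node ht he)
            have h2 := (hdD l (by rw [hall]; simp)).2
            exact ⟨hdm.trans h1.1, h1.2.trans h2⟩)
        L2 hB3 hD3
      have hCP : ∀ p ∈ P, ρ (bracket K) ≤ ρ p :=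
        hm.hi K (by omega) fun z hz => (hKP z hz).1
      -- The interval shrinks to the one between `ρ [U]` and `ρ u`. At most `l - 1` children below
      -- `u` give at least `[U]`; at least `m - 1` children above `[U]`, hence above all of `K`,
      -- give at most `[K]`, the last member of the new pool.
      have hbound : PoolBound ρ l m (P2 ++ [bracket K]) (ρ (bracket U)) (ρ u) := by
        refine ⟨?_, ?_, ?_, ?_, ?_⟩
        · refine List.pairwise_append.2 ⟨sP2, by simp, fun p hp y hy => ?_⟩
          rw [List.mem_singleton.1 hy]
          exact hCP p (hP2P p hp)
        · intro x hx
          rcases List.mem_append.1 hx with hx | hx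
          · exact (hKP (bracket U) (by simp [hK])).2 x (hP2P x hx)
          · rw [List.mem_singleton.1 hx]
            exact bracket_le_bracket' hr hf (by omega) fun x hx y hy => (hKP x hx).2 y (hUP y hy)
        · intro x hx
          rcases List.mem_append.1 hx with hx | hx
          · exact sUP2 u huU x hx
          · rw [List.mem_singleton.1 hx]
            exact hCP u (hUP u huU)
        · intro S hS hz
          exact bracket_le_bracket' hr hf (by omega) fun x hx y hy => (hz x hx).trans (hUu y hy)
        · intro S hS hz x hx
          rcases List.mem_append.1 hx with hx | hx
          · exact hm.hi S hS (fun z hz' => hbU.trans (hz z hz')) x (hP2P x hx)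
          · rw [List.mem_singleton.1 hx]
            exact bracket_le_bracket' hr hf (by omega) fun x hx y hy => (hKU x hx).trans (hz y hy)
      have hrest_s : rest.Pairwise (· ≥ ·) :=
        (List.pairwise_append.1 hs).1.sublist (List.drop_sublist _ _)
      obtain ⟨hle4, hdeg4⟩ := ih rest.length (by
          rw [← hn, List.length_append, hrestlen, List.length_singleton]; omega) rest rfl
        (P2 ++ [bracket K]) L3 l m _ _ hrestne hm2 hbound
        (fun e he => ⟨hmmin e (List.mem_of_mem_drop he), hlrest e (by simp [he])⟩) hrest_s
        (by rw [hB4, Multiset.cons_coe, Multiset.coe_eq_coe]; exact (List.perm_append_singleton _ _).symm)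
        hD4
      exact ⟨hle1.trans (hle2.trans (hle3.trans hle4)),
        hdeg4.trans ((degrees_merge hB3 hD3 hB4 hD4).trans (hdeg2.trans hdeg1))⟩

end ConfigTree

namespace ConfigTree

variable {ρ : RootedFinTree → ℝ} {f : Multiset ℝ → ℝ}

/-- Nodes of degree one can be replaced by ends with one vertex. -/
theorem exists_config_ones {I : FinTree → ℝ} (hI : IsTreeInvariant I) (hc : MaxCompatible ρ I)
    {E : Multiset ℕ} (hE : E ≠ 0) (hE1 : ∀ e ∈ E, 1 ≤ e) (k : ℕ) (L : List ConfigTree)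
    (hB : rootBlobs L = 0) (hD : rootDegs L = Multiset.replicate k 1 + E) :
    ∃ L', rootBlobs L' = Multiset.replicate k (bracket []) ∧ rootDegs L' = E ∧
      I (tree L) ≤ I (tree L') ∧ (tree L').degrees = (tree L).degrees := by
  suffices h : ∀ j ≤ k, ∃ L', rootBlobs L' = Multiset.replicate j (bracket []) ∧
      rootDegs L' = Multiset.replicate (k - j) 1 + E ∧
      I (tree L) ≤ I (tree L') ∧ (tree L').degrees = (tree L).degrees by
    obtain ⟨L', h1, h2, h3⟩ := h k le_rfl
    exact ⟨L', h1, by simpa using h2, h3⟩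
  intro j hj
  induction j with
  | zero => exact ⟨L, by simpa using hB, by simpa using hD, le_rfl, rfl⟩
  | succ j ih =>
    obtain ⟨L1, hB1, hD1, hle1, hdeg1⟩ := ih (by omega)
    have hD1' : rootDegs L1 = (([] : List RootedFinTree).length + 1) ::ₘ
        (Multiset.replicate (k - (j + 1)) 1 + E) := by
      rw [hD1, show k - j = k - (j + 1) + 1 by omega, Multiset.replicate_succ, Multiset.cons_add]
      rfl
    have hB1' : rootBlobs L1 = (([] : List RootedFinTree) : Multiset RootedFinTree) +
        Multiset.replicate j (bracket []) := by
      rw [hB1, Multiset.coe_nil, zero_add]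
    -- With `K` empty the comparisons of `ρ` are void, and one is the smallest possible degree.
    obtain ⟨L2, hB2, hD2, hle2⟩ := merge hI hc (K := []) (Q := Multiset.replicate j (bracket []))
      (E := Multiset.replicate (k - (j + 1)) 1 + E) (fun h => hE (add_eq_zero.1 h).2)
      (r := fun x y => x ≤ y) (.inr ⟨rfl, fun e he => by
        rcases Multiset.mem_add.1 he with he | he
        · exact (Multiset.eq_of_mem_replicate he).ge
        · exact hE1 e he⟩) (by simp) (by simp) L1 hB1' hD1'
    exact ⟨L2, by rw [hB2, Multiset.replicate_succ], hD2, hle1.trans hle2,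
      (degrees_merge hB1' hD1' hB2 hD2).trans hdeg1⟩

/-- The optimum among the trees with a fixed degree sequence, for a decreasing rule. -/
theorem le_mFill_replicate {I : FinTree → ℝ} (hI : IsTreeInvariant I) (hc : MaxCompatible ρ I)
    (hr : HasRecurrenceRule ρ f) (hf : StrictlyDecreasingRule ρ f) {T : FinTree} {ds : List ℕ}
    {n : ℕ} (hT : T.degrees = ((ds ++ List.replicate n 1 : List ℕ) : Multiset ℕ)) (hds : ds ≠ [])
    (h2 : ∀ d ∈ ds, 2 ≤ d) (hs : ds.Pairwise (· ≥ ·)) :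
    I T ≤ I (bracket (mFill ds (List.replicate n (bracket [])))).toFinTree ∧
      (bracket (mFill ds (List.replicate n (bracket [])))).degrees = T.degrees ∧
      n + 2 * ds.length = ds.sum + 2 := by
  obtain ⟨L, hB, hD, hiso⟩ := exists_config T
  obtain ⟨L1, hB1, hD1, hle1, hdeg1⟩ := exists_config_ones hI hc (E := ↑ds) (by simpa using hds)
    (fun e he => one_le_two.trans (h2 e (by simpa using he))) n L hB (by
      rw [hD, hT, ← Multiset.coe_add, ← Multiset.coe_replicate, add_comm])
  have hcard := card_rootBlobs L1
  rw [hB1, hD1] at hcard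
  simp only [Multiset.card_replicate, Multiset.coe_card, Multiset.sum_coe] at hcard
  -- At the start all ends are single vertices. The lower bound is the value of a branch of largest
  -- degree with single vertices as its children.
  have hbound : PoolBound ρ (ds.head hds) 2 (List.replicate n (bracket []))
      (ρ (bracket (List.replicate (ds.head hds - 1) (bracket [])))) (ρ (bracket [])) := by
    refine ⟨by simp [List.pairwise_replicate], fun x hx => ?_, fun x hx => ?_, fun S hS h => ?_,
      fun S _ _ x hx => ?_⟩
    · rw [List.eq_of_mem_replicate hx]
      exact bracket_le_bracket' hr hf (by simp) (by simp)
    · rw [List.eq_of_mem_replicate hx]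
    · refine bracket_le_bracket' hr hf (by simpa using hS) fun x hx y hy => ?_
      rw [List.eq_of_mem_replicate hy]
      exact h x hx
    · rw [List.eq_of_mem_replicate hx]
      exact bracket_le_bracket' hr hf (by simp) (by simp)
  have hmax : ∀ e ∈ ds, e ≤ ds.head hds := by
    obtain ⟨d, ds, rfl⟩ := List.exists_cons_of_ne_nil hds
    intro e he
    rcases List.mem_cons.1 he with rfl | he
    · exact le_rfl
    · exact (List.pairwise_cons.1 hs).1 e he
  obtain ⟨hle2, hdeg2⟩ := le_mFill hI hc hr hf ds (List.replicate n (bracket [])) L1 _ 2 _ _ hds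
    le_rfl hbound (fun e he => ⟨h2 e he, hmax e he⟩) hs
    (by rw [hB1, Multiset.coe_replicate]) hD1
  rw [hI _ _ hiso, FinTree.degrees_eq_of_iso hiso]
  exact ⟨hle1.trans hle2, hdeg2.trans hdeg1, by omega⟩

end ConfigTree

/-! ### Stars and the leaves of the `M`-tree, grouped by their neighbours. -/

namespace RootedFinTree

/-- `A` is a star with `e` vertices rooted at its centre, and `ys` lists its leaves. -/
structure IsStar (A : RootedFinTree) (e : ℕ) (ys : List A.V) : Prop where
  nodup : ys.Nodup
  mem_iff : ∀ y, y ∈ ys ↔ y ≠ A.root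
  adj_iff : ∀ y, A.graph.Adj A.root y ↔ y ≠ A.root
  length_eq : ys.length = e - 1
  ndeg_root : A.graph.ndeg A.root = e - 1
  ndeg_eq_one : ∀ y, y ≠ A.root → A.graph.ndeg y = 1
  fill : ∀ Cs : List (List RootedFinTree), Cs.length = e - 1 →
    ((A.marked.fill (mergePairs ys Cs)).rooted A.root).Equivalent (bracket (Cs.map bracket))

theorem get_replicate_single (k : ℕ) (i : Fin (List.replicate k single).length) :
    (∀ y, y = ((List.replicate k single).get i).root) ∧
      ∀ y, ((List.replicate k single).get i).graph.ndeg y = 0 := by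
  have h : ∀ A : RootedFinTree, A = single → (∀ y, y = A.root) ∧ ∀ y, A.graph.ndeg y = 0 := by
    rintro A rfl
    exact ⟨fun _ => rfl, fun _ => ndeg_single⟩
  exact h _ (by simp)

theorem exists_isStar_star (e : ℕ) : ∃ ys, IsStar (star e) e ys := by
  classical
  refine ⟨(List.finRange _).map fun i =>
    Sum.inr ⟨i, ((List.replicate (e - 1) single).get i).root⟩, ?_, ?_, ?_, ?_, ?_, ?_, ?_⟩
  · refine (List.nodup_finRange _).map fun i j h => ?_
    exact congrArg Sigma.fst (Sum.inr.inj h)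
  · rintro (y | ⟨i, y⟩)
    · refine iff_of_false (fun h => ?_) (fun h => h rfl)
      obtain ⟨i, -, h⟩ := List.mem_map.1 h
      exact Sum.inr_ne_inl h
    · refine iff_of_true ?_ (by simp [star])
      rw [(get_replicate_single _ i).1 y]
      exact List.mem_map.2 ⟨i, List.mem_finRange i, rfl⟩
  · rintro (y | ⟨i, y⟩)
    · exact iff_of_false (SimpleGraph.irrefl _) (by simp [star])
    · refine iff_of_true ?_ (by simp [star])
      exact (FinTree.attachGraph_inl_inr _ _ _ _ _ _).2 ⟨rfl, (get_replicate_single _ i).1 y⟩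
  · exact (List.length_map _).trans (List.length_finRange.trans List.length_replicate)
  · change (FinTree.single.attach () (List.replicate (e - 1) single)).graph.ndeg (.inl ()) = _
    rw [FinTree.ndeg_attach_inl, ndeg_single]
    simp
  · rintro (y | ⟨i, y⟩) h
    · exact absurd rfl h
    · change (FinTree.single.attach () (List.replicate (e - 1) single)).graph.ndeg (.inr ⟨i, y⟩) = _
      rw [FinTree.ndeg_attach_inr, if_pos ((get_replicate_single _ i).1 y),
        (get_replicate_single _ i).2]
  · intro Cs hCs
    have h := LabelledTree.fill_attach_single FinTree.single () (e - 1) [] [] Cs rfl hCs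
    exact (h.rooted ()).trans (bracket_equivalent_fill _).symm

end RootedFinTree

namespace MarkedTree

/-- Interchanging two leaves with the same neighbour is an automorphism. -/
theorem comap_swap {T : FinTree} [DecidableEq T.V] {v x y : T.V} (hvx : T.graph.Adj v x)
    (hvy : T.graph.Adj v y) (hx : T.IsLeaf x) (hy : T.IsLeaf y) :
    T.marked.comap (Equiv.swap x y) ≋ T.marked := by
  have key : ∀ {z}, T.graph.Adj v z → T.IsLeaf z → ∀ a, T.graph.Adj z a ↔ a = v := by
    intro z hz hl a
    rw [FinTree.IsLeaf, FinTree.degree_eq_ndeg, SimpleGraph.ndeg, Set.ncard_eq_one] at hl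
    obtain ⟨b, hb⟩ := hl
    have h1 : ∀ c, T.graph.Adj z c ↔ c = b := fun c => by
      rw [← SimpleGraph.mem_neighborSet, hb, Set.mem_singleton_iff]
    rw [h1, (h1 v).1 hz.symm]
  have hx' := key hvx hx
  have hy' := key hvy hy
  have hxv := hvx.ne
  have hyv := hvy.ne
  have hmap : ∀ a b, T.graph.Adj a b → T.graph.Adj (Equiv.swap x y a) (Equiv.swap x y b) := by
    intro a b hab
    by_cases hax : a = x
    · subst hax
      rw [(hx' b).1 hab, Equiv.swap_apply_left, Equiv.swap_apply_of_ne_of_ne hxv hyv]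
      exact hvy.symm
    by_cases hay : a = y
    · subst hay
      rw [(hy' b).1 hab, Equiv.swap_apply_right, Equiv.swap_apply_of_ne_of_ne hxv hyv]
      exact hvx.symm
    rw [Equiv.swap_apply_of_ne_of_ne hax hay]
    by_cases hbx : b = x
    · subst hbx
      rw [(hx' a).1 hab.symm, Equiv.swap_apply_left]
      exact hvy
    by_cases hby : b = y
    · subst hby
      rw [(hy' a).1 hab.symm, Equiv.swap_apply_right]
      exact hvx
    rwa [Equiv.swap_apply_of_ne_of_ne hbx hby]
  refine ⟨(⟨Equiv.swap x y, fun {a b} => ⟨fun h => ?_, hmap a b⟩⟩ : T.graph ≃g T.graph),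
    fun a => Equiv.swap_apply_self x y a⟩
  have := hmap _ _ h
  rwa [Equiv.swap_apply_self, Equiv.swap_apply_self] at this

/-- Leaves with a common neighbour are interchangeable in every filling. This compensates for the
arbitrary choice of a leaf in `graftAtFirstLeaf`. -/
theorem fill_swap {T : FinTree} [DecidableEq T.V] {v x y : T.V} (hvx : T.graph.Adj v x)
    (hvy : T.graph.Adj v y) (hx : T.IsLeaf x) (hy : T.IsLeaf y) (vs : List T.V)
    (Cs : List (List RootedFinTree)) :
    Nonempty ((T.marked.fill (mergePairs vs Cs)).tree.graph ≃g
      (T.marked.fill (mergePairs (vs.map (Equiv.swap x y)) Cs)).tree.graph) := by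
  have h := fill_congr_left (comap_swap hvx hvy hx hy) (mergePairs vs Cs)
  rw [fill_comap, ← mergePairs_map] at h
  exact h.symm.nonempty_iso

theorem mergePairs_flatMap {α ι : Type} (l : List ι) (g : ι → List α)
    (Q : ι → List (List RootedFinTree)) (h : ∀ i ∈ l, (g i).length = (Q i).length) :
    mergePairs (l.flatMap g) (l.flatMap Q) = l.flatMap fun i => mergePairs (g i) (Q i) := by
  induction l with
  | nil => rfl
  | cons i l ih =>
    rw [List.flatMap_cons, List.flatMap_cons, List.flatMap_cons,
      mergePairs_append (h i (by simp)), ih fun j hj => h j (by simp [hj])]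

/-- The list `K` of branches for stars whose ends are replaced as the lists in `Qs` say. -/
def starBranches (Qs : List (List (List RootedFinTree))) : List RootedFinTree :=
  (Qs.map fun Q => bracket (Q.map bracket).reverse).reverse

/-- Filling after stars have been attached to `x`. -/
theorem fill_attach_star (T : FinTree) (x : T.V) (L : List RootedFinTree)
    (es : Fin L.length → ℕ) (ys : ∀ i, List (L.get i).V)
    (hys : ∀ i, IsStar (L.get i) (es i) (ys i)) (vs : List T.V)
    (F : List (List RootedFinTree)) (hF : vs.length = F.length)
    (Qs : List (List (List RootedFinTree))) (hQs : Qs.length = L.length)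
    (hQ : ∀ i : Fin L.length, (Qs.get (i.cast hQs.symm)).length = es i - 1) :
    ((T.attach x L).marked.fill (mergePairs (vs.map Sum.inl ++
      (List.finRange L.length).flatMap fun i => (ys i).map fun y => Sum.inr ⟨i, y⟩)
        (F ++ Qs.flatten))).comap Sum.inl ≋
      T.marked.fill (((starBranches Qs).map fun A => (x, A)) ++ mergePairs vs F) := by
  have hQs' : Qs.flatten = (List.finRange L.length).flatMap
      fun i => Qs.get (i.cast hQs.symm) := by
    conv_lhs => rw [eq_map_finRange Qs hQs]
    rw [List.flatMap_def]
  rw [mergePairs_append (by simpa using hF), mergePairs_map, hQs', mergePairs_flatMap _ _ _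
    fun i _ => by rw [List.length_map, (hys i).length_eq, hQ]]
  have h := FinTree.fill_attach T x L (mergePairs vs F)
    fun i => mergePairs (ys i) (Qs.get (i.cast hQs.symm))
  simp only [← mergePairs_map] at h
  simp only [← mergePairs_map]
  refine h.trans (.trans ?_ (fill_perm _ List.perm_append_comm))
  refine .trans ?_ (fill_perm _ (List.Perm.append_left _ (List.Perm.map _
    (List.reverse_perm _).symm)))
  refine fill_congr (.refl _) (List.rel_append (List.forall₂_same.2 fun _ _ => ⟨rfl, .refl _⟩) ?_)
  conv => arg 3; rw [eq_map_finRange Qs hQs]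
  rw [List.map_map, List.map_map, List.forall₂_map_left_iff, List.forall₂_map_right_iff,
    List.forall₂_same]
  intro i _
  exact ⟨rfl, ((hys i).fill _ (hQ i)).trans (bracket_perm (List.reverse_perm _).symm)⟩

end MarkedTree

namespace FinTree

/-- Each pair in `gs` consists of a vertex and a list of its neighbours that satisfy `p`. -/
structure LeafGroups (T : FinTree) (p : T.V → Prop) (gs : List (T.V × List T.V)) : Prop where
  mem_iff : ∀ g ∈ gs, ∀ x, x ∈ g.2 ↔ T.graph.Adj g.1 x ∧ p x
  nodup : (gs.flatMap Prod.snd).Nodup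

theorem LeafGroups.congr {T : FinTree} {p q : T.V → Prop} {gs : List (T.V × List T.V)}
    (h : T.LeafGroups p gs) (hpq : ∀ x, p x ↔ q x) : T.LeafGroups q gs :=
  ⟨fun g hg x => by rw [h.mem_iff g hg, hpq], h.nodup⟩

/-- The groups are disjoint, so a leaf that is used up has to be deleted from one group only. -/
theorem LeafGroups.remove {T : FinTree} {p : T.V → Prop} {gs₀ gs₁ : List (T.V × List T.V)}
    {v x : T.V} {xs : List T.V} (h : T.LeafGroups p (gs₀ ++ (v, x :: xs) :: gs₁)) :
    T.LeafGroups (fun y => p y ∧ y ≠ x) (gs₀ ++ (v, xs) :: gs₁) := by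
  have hn := h.nodup
  have hperm : ((gs₀ ++ (v, x :: xs) :: gs₁).flatMap Prod.snd).Perm
      (x :: (gs₀ ++ (v, xs) :: gs₁).flatMap Prod.snd) := by
    simp only [List.flatMap_append, List.flatMap_cons, List.cons_append]
    exact List.perm_middle
  rw [hperm.nodup_iff, List.nodup_cons] at hn
  have hx : ∀ g ∈ gs₀ ++ (v, xs) :: gs₁, x ∉ g.2 := fun g hg hxg =>
    hn.1 (List.mem_flatMap.2 ⟨g, hg, hxg⟩)
  refine ⟨fun g hg y => ?_, hn.2⟩
  by_cases hyx : y = x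
  · subst hyx
    exact iff_of_false (hx g hg) (by simp)
  · rcases List.mem_append.1 hg with hg | hg
    · rw [h.mem_iff g (List.mem_append_left _ hg)]
      tauto
    · rcases List.mem_cons.1 hg with rfl | hg
      · have := h.mem_iff (v, x :: xs) (by simp) y
        rw [List.mem_cons] at this
        tauto
      · rw [h.mem_iff g (by simp [hg])]
        tauto

/-- The groups of leaves after stars have been attached to `x`. -/
def attachGroups (T : FinTree) (x : T.V) (L : List RootedFinTree) (ys : ∀ i, List (L.get i).V)
    (gs : List (T.V × List T.V)) : List ((T.attach x L).V × List (T.attach x L).V) :=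
  gs.map (Prod.map Sum.inl (List.map Sum.inl)) ++ (List.finRange L.length).map fun i =>
    (Sum.inr ⟨i, (L.get i).root⟩, (ys i).map fun y => Sum.inr ⟨i, y⟩)

theorem attachGroups_flatMap (T : FinTree) (x : T.V) (L : List RootedFinTree)
    (ys : ∀ i, List (L.get i).V) (gs : List (T.V × List T.V)) :
    (T.attachGroups x L ys gs).flatMap Prod.snd = (gs.flatMap Prod.snd).map Sum.inl ++
      (List.finRange L.length).flatMap fun i => (ys i).map fun y => Sum.inr ⟨i, y⟩ := by
  rw [attachGroups, List.flatMap_append, List.flatMap_map, List.flatMap_map, List.map_flatMap]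
  rfl

theorem attachGroups_fst (T : FinTree) (x : T.V) (L : List RootedFinTree)
    (ys : ∀ i, List (L.get i).V) (gs : List (T.V × List T.V)) :
    (T.attachGroups x L ys gs).map Prod.fst = (gs.map Prod.fst).map Sum.inl ++
      (List.finRange L.length).map fun i => Sum.inr ⟨i, (L.get i).root⟩ := by
  rw [attachGroups, List.map_append, List.map_map, List.map_map, List.map_map]
  rfl

/-- The vertex `x` must no longer satisfy `p`: the new centres are adjacent to it, and otherwise it
would have to appear in their groups. -/
theorem LeafGroups.attach {T : FinTree} {p : T.V → Prop} {gs : List (T.V × List T.V)}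
    (h : T.LeafGroups p gs) {x : T.V} (hx : ¬ p x) {L : List RootedFinTree}
    {es : Fin L.length → ℕ} {ys : ∀ i, List (L.get i).V}
    (hys : ∀ i, IsStar (L.get i) (es i) (ys i)) :
    (T.attach x L).LeafGroups (Sum.elim p fun z => z.2 ≠ (L.get z.1).root)
      (T.attachGroups x L ys gs) := by
  refine ⟨fun g hg => ?_, ?_⟩
  · rcases List.mem_append.1 hg with hg | hg
    · obtain ⟨⟨a, as⟩, hga, rfl⟩ := List.mem_map.1 hg
      have ha := h.mem_iff _ hga
      rintro (z | ⟨i, z⟩)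
      · refine (List.mem_map_of_injective Sum.inl_injective).trans ((ha z).trans ?_)
        exact and_congr_left fun _ => (attachGraph_inl_inl T x L a z).symm
      · refine iff_of_false (fun h => ?_) fun h => h.2 ?_
        · obtain ⟨_, -, h⟩ := List.mem_map.1 h
          exact Sum.inl_ne_inr h
        · exact ((attachGraph_inl_inr T x L a i z).1 h.1).2
    · obtain ⟨i, -, rfl⟩ := List.mem_map.1 hg
      rintro (z | ⟨j, z⟩)
      · refine iff_of_false (fun h => ?_) fun h => hx ?_
        · obtain ⟨_, -, h⟩ := List.mem_map.1 h
          exact Sum.inr_ne_inl h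
        · rw [← ((attachGraph_inr_inl T x L z i _).1 h.1).1]
          exact h.2
      · by_cases hij : i = j
        · subst hij
          refine (List.mem_map_of_injective (f := fun y : (L.get i).V =>
            (Sum.inr ⟨i, y⟩ : T.V ⊕ (Σ i : Fin L.length, (L.get i).V)))
            (Sum.inr_injective.comp sigma_mk_injective)).trans (((hys i).mem_iff z).trans ?_)
          refine Iff.trans ?_ (and_congr_left' (attachGraph_inr_inr T x L i _ z).symm)
          rw [(hys i).adj_iff]
          exact (and_self_iff).symm
        · refine iff_of_false (fun h => ?_) fun h =>
            attachGraph_inr_inr_of_ne T x L hij _ _ h.1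
          obtain ⟨y, -, h⟩ := List.mem_map.1 h
          exact hij (congrArg Sigma.fst (Sum.inr_injective h))
  · rw [attachGroups_flatMap]
    refine List.Nodup.append (h.nodup.map Sum.inl_injective) ?_ ?_
    · rw [List.nodup_flatMap]
      refine ⟨fun i _ => (hys i).nodup.map (Sum.inr_injective.comp sigma_mk_injective), ?_⟩
      refine (List.nodup_finRange _).imp fun {i j} hij z hz hz' => ?_
      obtain ⟨y, -, rfl⟩ := List.mem_map.1 hz
      obtain ⟨y', -, h⟩ := List.mem_map.1 hz'
      exact hij (congrArg Sigma.fst (Sum.inr_injective h)).symm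
    · intro z hz hz'
      obtain ⟨y, -, rfl⟩ := List.mem_map.1 hz
      obtain ⟨i, -, hz'⟩ := List.mem_flatMap.1 hz'
      obtain ⟨y', -, h⟩ := List.mem_map.1 hz'
      exact Sum.inr_ne_inl h

/-- Which vertices are leaves after stars have been attached to `x`. -/
theorem isLeaf_attach_iff (T : FinTree) (x : T.V) (L : List RootedFinTree)
    {es : Fin L.length → ℕ} {ys : ∀ i, List (L.get i).V}
    (hys : ∀ i, IsStar (L.get i) (es i) (ys i)) (hes : ∀ i, 2 ≤ es i)
    (hx : 2 ≤ T.graph.ndeg x + L.length) (z : (T.attach x L).V) :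
    (T.attach x L).IsLeaf z ↔
      Sum.elim (fun y => T.IsLeaf y ∧ y ≠ x) (fun z => z.2 ≠ (L.get z.1).root) z := by
  classical
  rw [IsLeaf, degree_eq_ndeg]
  rcases z with z | ⟨i, z⟩
  · rw [ndeg_attach_inl, Sum.elim_inl, IsLeaf, degree_eq_ndeg]
    split_ifs with h
    · subst h
      simp only [ne_eq, not_true_eq_false, and_false, iff_false]
      omega
    · simp [h]
  · rw [ndeg_attach_inr, Sum.elim_inr]
    split_ifs with h
    · subst h
      rw [(hys i).ndeg_root]
      have := hes i
      simp only [ne_eq, not_true_eq_false, iff_false]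
      omega
    · exact iff_of_true (by rw [(hys i).ndeg_eq_one z h]) h

/-- The groups of leaves after single vertices have been attached to `x`. -/
theorem LeafGroups.attach_single {T : FinTree} {p : T.V → Prop} {x : T.V}
    {gs : List (T.V × List T.V)} (h : T.LeafGroups p ((x, []) :: gs)) (hx : x ∉ gs.map Prod.fst)
    (k : ℕ) :
    (T.attach x (List.replicate k RootedFinTree.single)).LeafGroups (Sum.elim p fun _ => True)
      ((Sum.inl x, (List.finRange (List.replicate k RootedFinTree.single).length).map fun i =>
        Sum.inr ⟨i, ((List.replicate k RootedFinTree.single).get i).root⟩) ::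
          gs.map (Prod.map Sum.inl (List.map Sum.inl))) := by
  refine ⟨fun g hg => ?_, ?_⟩
  · rcases List.mem_cons.1 hg with rfl | hg
    · rintro (z | ⟨i, z⟩)
      · refine iff_of_false (fun h => ?_) fun h' => ?_
        · obtain ⟨_, -, h⟩ := List.mem_map.1 h
          exact Sum.inr_ne_inl h
        · have := (h.mem_iff (x, []) (by simp) z).2 ⟨(attachGraph_inl_inl T x _ x z).1 h'.1, h'.2⟩
          simp at this
      · refine iff_of_true ?_ ⟨(attachGraph_inl_inr T x _ x i z).2 ⟨rfl, (get_replicate_single k i).1 z⟩, trivial⟩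
        rw [(get_replicate_single k i).1 z]
        exact List.mem_map.2 ⟨i, List.mem_finRange i, rfl⟩
    · obtain ⟨⟨a, as⟩, hga, rfl⟩ := List.mem_map.1 hg
      have ha := h.mem_iff _ (List.mem_cons_of_mem _ hga)
      rintro (z | ⟨i, z⟩)
      · refine (List.mem_map_of_injective Sum.inl_injective).trans ((ha z).trans ?_)
        exact and_congr_left fun _ => (attachGraph_inl_inl T x _ a z).symm
      · refine iff_of_false (fun h => ?_) fun h => hx ?_
        · obtain ⟨_, -, h⟩ := List.mem_map.1 h
          exact Sum.inl_ne_inr h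
        · rw [← ((attachGraph_inl_inr T x _ a i z).1 h.1).1]
          exact List.mem_map.2 ⟨_, hga, rfl⟩
  · rw [List.flatMap_cons, List.flatMap_map]
    have hn := h.nodup
    rw [List.flatMap_cons, List.nil_append] at hn
    have h2 : (gs.flatMap fun g => ((Prod.map Sum.inl (List.map Sum.inl) g :
        (T.attach x (List.replicate k RootedFinTree.single)).V × List (T.attach x (List.replicate k RootedFinTree.single)).V)).2) =
        (gs.flatMap Prod.snd).map Sum.inl := by
      rw [List.map_flatMap]
      rfl
    rw [h2]
    refine List.Nodup.append ((List.nodup_finRange _).map fun i j h => ?_)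
      (hn.map Sum.inl_injective) ?_
    · exact congrArg Sigma.fst (Sum.inr_injective h)
    · intro z hz hz'
      obtain ⟨y, -, rfl⟩ := List.mem_map.1 hz'
      obtain ⟨i, -, h⟩ := List.mem_map.1 hz
      exact Sum.inr_ne_inl h

end FinTree

/-! ### The `M`-tree as the recursion `mFill`. -/

namespace ConfigTree

theorem chop_flatten (es : List ℕ) (Rs : List (List RootedFinTree)) (R : List RootedFinTree)
    (h : Rs.map List.length = es.map fun e => e - 1) :
    chop es (Rs.flatten ++ R) = (Rs.map bracket, R) := by
  induction es generalizing Rs with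
  | nil =>
    rw [List.map_nil, List.map_eq_nil_iff] at h
    subst h
    rfl
  | cons e es ih =>
    cases Rs with
    | nil => simp at h
    | cons C Rs =>
      rw [List.map_cons, List.map_cons, List.cons.injEq] at h
      rw [chop, List.flatten_cons, List.append_assoc, ← h.1, List.take_left, List.drop_left,
        ih Rs h.2, List.map_cons]

/-- Leaves are listed by increasing label, but `chop` starts with the ends that belong to large
labels. Hence the reversal: the stars labelled last are taken off first. -/
theorem chop_reverse (es : List ℕ) (Qs : List (List (List RootedFinTree)))
    (F : List (List RootedFinTree))
    (h : Qs.map List.length = es.reverse.map fun e => e - 1) :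
    chop es ((F ++ Qs.flatten).map bracket).reverse =
      (starBranches Qs, (F.map bracket).reverse) := by
  have h1 : ((F ++ Qs.flatten).map bracket).reverse =
      ((Qs.map fun Q => (Q.map bracket).reverse).reverse).flatten ++ (F.map bracket).reverse := by
    rw [List.map_append, List.reverse_append, List.map_flatten, List.reverse_flatten, List.map_map]
    rfl
  rw [h1, chop_flatten, starBranches, List.map_reverse, List.map_map]
  · rfl
  · rw [List.map_reverse, List.map_map, ← List.reverse_inj, List.reverse_reverse, ← List.map_reverse, ← h]
    refine List.map_congr_left fun Q _ => ?_
    simp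

end ConfigTree

namespace LabelledTree

open ConfigTree FinTree

/-- A labelled tree with groups `gs` of leaves that belong to its labels such that every filling of
these leaves gives a tree `mFill`. -/
structure IsMTree (S : LabelledTree) (ds : List ℕ) (gs : List (S.tree.V × List S.tree.V)) :
    Prop where
  labels_eq : S.labels = gs.map Prod.fst
  groups : S.tree.LeafGroups S.tree.IsLeaf gs
  length_eq : (gs.flatMap Prod.snd).length + 2 * ds.length = ds.sum + 2
  fill_iso : ∀ Ps : List (List RootedFinTree), Ps.length = (gs.flatMap Prod.snd).length →
    Nonempty ((S.tree.marked.fill (mergePairs (gs.flatMap Prod.snd) Ps)).tree.graph ≃g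
      (bracket (mFill ds (Ps.map bracket).reverse)).graph)

/-- The groups can be chosen such that the next leaf to be used is the first one. -/
theorem IsMTree.exists_graft {S : LabelledTree} {ds : List ℕ}
    {gs : List (S.tree.V × List S.tree.V)} (h : S.IsMTree ds gs) (hne : gs.flatMap Prod.snd ≠ [])
    (L : List RootedFinTree) :
    ∃ gs₀ v x xs gs₁, S.IsMTree ds (gs₀ ++ (v, x :: xs) :: gs₁) ∧ gs₀.flatMap Prod.snd = [] ∧
      S.tree.IsLeaf x ∧ S.graftAtFirstLeaf L = S.graft x L := by
  classical
  obtain ⟨gs₀, v, y, ys, gs₁, rfl, h0⟩ : ∃ gs₀ v y ys gs₁, gs = gs₀ ++ (v, y :: ys) :: gs₁ ∧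
      gs₀.flatMap Prod.snd = [] := by
    clear h
    induction gs with
    | nil => simp at hne
    | cons g gs ih =>
      obtain ⟨a, as⟩ := g
      cases as with
      | nil =>
        obtain ⟨gs₀, v, y, ys, gs₁, rfl, h0⟩ := ih (by simpa using hne)
        exact ⟨(a, []) :: gs₀, v, y, ys, gs₁, rfl, by simpa using h0⟩
      | cons y ys => exact ⟨[], a, y, ys, gs, rfl, rfl⟩
  have hy := (h.groups.mem_iff (v, y :: ys) (by simp) y).1 (by simp)
  have hv : ∃ x, S.tree.graph.Adj v x ∧ S.tree.IsLeaf x := ⟨y, hy⟩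
  -- The groups in front of `v` are empty, so no earlier label has a leaf as neighbour.
  have hfind : S.labels.find? (fun v => ∃ x, S.tree.graph.Adj v x ∧ S.tree.IsLeaf x) = some v := by
    rw [h.labels_eq, List.map_append, List.map_cons, List.find?_append, List.find?_eq_none.2,
      Option.none_or, List.find?_cons_of_pos]
    · simpa using hv
    · intro a ha
      obtain ⟨g, hg, rfl⟩ := List.mem_map.1 ha
      simp only [decide_eq_true_eq, not_exists]
      intro x hx
      have hx' := (h.groups.mem_iff g (List.mem_append_left _ hg) x).2 hx
      rw [List.flatMap_eq_nil_iff] at h0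
      rw [h0 g hg] at hx'
      simp at hx'
  have hgraft : S.graftAtFirstLeaf L = S.graft hv.choose L := by
    unfold graftAtFirstLeaf
    rw [hfind]
    exact dif_pos hv
  -- The chosen leaf need not be the first one, `y`, of its group. Interchanging both is an
  -- automorphism, and it yields a list of the same leaves that begins with the chosen one.
  have hx := hv.choose_spec
  set x := hv.choose with hxdef
  have hmem : x ∈ y :: ys := (h.groups.mem_iff (v, y :: ys) (by simp) x).2 hx
  have hn := h.groups.nodup
  have hflat : ∀ l : List S.tree.V, (gs₀ ++ (v, l) :: gs₁).flatMap Prod.snd =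
      l ++ gs₁.flatMap Prod.snd := fun l => by
    rw [List.flatMap_append, h0, List.nil_append, List.flatMap_cons]
  rw [hflat] at hn
  have hnot : ∀ z ∈ y :: ys, z ∉ gs₁.flatMap Prod.snd := fun z hz hz' =>
    List.disjoint_of_nodup_append hn hz hz'
  have hswap : (gs₁.flatMap Prod.snd).map (Equiv.swap y x) = gs₁.flatMap Prod.snd := by
    conv_rhs => rw [← List.map_id (gs₁.flatMap Prod.snd)]
    refine List.map_congr_left fun z hz => Equiv.swap_apply_of_ne_of_ne ?_ ?_
    · rintro rfl
      exact hnot z (by simp) hz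
    · rintro rfl
      exact hnot _ hmem hz
  have hperm : ((y :: ys).map (Equiv.swap y x)).Perm (y :: ys) := by
    refine (List.perm_ext_iff_of_nodup ((List.nodup_append.1 hn).1.map
      (Equiv.swap y x).injective) (List.nodup_append.1 hn).1).2 fun a => ?_
    rw [List.mem_map]
    have hs : ∀ a ∈ y :: ys, Equiv.swap y x a ∈ y :: ys := fun a ha => by
      rw [Equiv.swap_apply_def]
      split_ifs
      · exact hmem
      · exact List.mem_cons_self
      · exact ha
    refine ⟨?_, fun ha => ⟨_, hs a ha, Equiv.swap_apply_self _ _ _⟩⟩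
    rintro ⟨b, hb, rfl⟩
    exact hs b hb
  have hcons : (y :: ys).map (Equiv.swap y x) = x :: ys.map (Equiv.swap y x) := by
    rw [List.map_cons, Equiv.swap_apply_left]
  have hmap : (x :: ys.map (Equiv.swap y x)) ++ gs₁.flatMap Prod.snd =
      ((y :: ys) ++ gs₁.flatMap Prod.snd).map (Equiv.swap y x) := by
    rw [List.map_append, hswap, hcons]
  rw [hcons] at hperm
  refine ⟨gs₀, v, x, ys.map (Equiv.swap y x), gs₁, ⟨?_, ⟨fun g hg => ?_, ?_⟩, ?_, fun Ps hPs => ?_⟩,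
    h0, hx.2, hgraft⟩
  · rw [h.labels_eq]
    simp
  · rcases List.mem_append.1 hg with hg | hg
    · exact h.groups.mem_iff g (List.mem_append_left _ hg)
    · rcases List.mem_cons.1 hg with rfl | hg
      · exact fun z => hperm.mem_iff.trans (h.groups.mem_iff (v, y :: ys) (by simp) z)
      · exact h.groups.mem_iff g (by simp [hg])
  · rw [hflat, hmap]
    exact hn.map (Equiv.swap y x).injective
  · have := h.length_eq
    rw [hflat] at this ⊢
    simpa using this
  · rw [hflat, hmap] at hPs ⊢
    rw [List.length_map, ← hflat] at hPs
    have h1 := h.fill_iso Ps hPs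
    rw [hflat] at h1
    obtain ⟨e1⟩ := h1
    obtain ⟨e2⟩ := fill_swap hy.1 hx.1 hy.2 hx.2 ((y :: ys) ++ gs₁.flatMap Prod.snd) Ps
    exact ⟨e2.symm.trans e1⟩

end LabelledTree

namespace LabelledTree

open ConfigTree FinTree

theorem exists_isStar (es : List ℕ) (h : (es.map RootedFinTree.star).length = es.length) :
    ∃ ys : ∀ i : Fin (es.map RootedFinTree.star).length, List ((es.map RootedFinTree.star).get i).V,
      ∀ i, IsStar ((es.map RootedFinTree.star).get i) (es.get (i.cast h)) (ys i) := by
  have key : ∀ (A : RootedFinTree) (e : ℕ), A = RootedFinTree.star e → ∃ ys, IsStar A e ys := by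
    rintro A e rfl
    exact exists_isStar_star e
  have : ∀ i : Fin (es.map RootedFinTree.star).length, ∃ ys,
      IsStar ((es.map RootedFinTree.star).get i) (es.get (i.cast h)) ys := fun i => key _ _ (by simp)
  choose ys hys using this
  exact ⟨ys, hys⟩

theorem length_flatMap_isStar {es : List ℕ} {h : (es.map RootedFinTree.star).length = es.length}
    {ys : ∀ i : Fin (es.map RootedFinTree.star).length, List ((es.map RootedFinTree.star).get i).V} {α : Type}
    (hys : ∀ i, IsStar ((es.map RootedFinTree.star).get i) (es.get (i.cast h)) (ys i))
    (g : ∀ i, ((es.map RootedFinTree.star).get i).V → α) :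
    ((List.finRange (es.map RootedFinTree.star).length).flatMap fun i => (ys i).map (g i)).length =
      (es.map fun e => e - 1).sum := by
  rw [List.length_flatMap]
  conv_rhs => rw [eq_map_finRange es h.symm, List.map_map]
  refine congrArg List.sum (List.map_congr_left fun i _ => ?_)
  rw [List.length_map, (hys i).length_eq]
  rfl

theorem exists_split (es : List ℕ) (n : ℕ) (Ps : List (List RootedFinTree))
    (h : Ps.length = n + (es.map fun e => e - 1).sum) :
    ∃ (F : List (List RootedFinTree)) (Qs : List (List (List RootedFinTree))), Ps = F ++ Qs.flatten ∧ F.length = n ∧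
      Qs.map List.length = es.map fun e => e - 1 := by
  have hl : (Ps.drop n).length = (es.map fun e => e - 1).sum := by
    rw [List.length_drop]
    omega
  refine ⟨Ps.take n, (es.map fun e => e - 1).splitLengths (Ps.drop n), ?_, ?_,
    List.map_splitLengths_length _ _ hl.ge⟩
  · rw [List.flatten_splitLengths _ _ hl.le, List.take_append_drop]
  · rw [List.length_take]
    omega

/-- `fill_attach_star` for the stars with numbers of vertices `es`. -/
theorem fill_attach_map_star (T : FinTree) (x : T.V) {es : List ℕ}
    {h : (es.map RootedFinTree.star).length = es.length}
    {ys : ∀ i : Fin (es.map RootedFinTree.star).length, List ((es.map RootedFinTree.star).get i).V}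
    (hys : ∀ i, IsStar ((es.map RootedFinTree.star).get i) (es.get (i.cast h)) (ys i)) (vs : List T.V)
    (F : List (List RootedFinTree)) (hF : F.length = vs.length)
    (Qs : List (List (List RootedFinTree))) (hQ : Qs.map List.length = es.map fun e => e - 1) :
    ((T.attach x (es.map RootedFinTree.star)).marked.fill (mergePairs (vs.map Sum.inl ++
      (List.finRange (es.map RootedFinTree.star).length).flatMap fun i => (ys i).map fun y => Sum.inr ⟨i, y⟩)
        (F ++ Qs.flatten))).comap Sum.inl ≋
      T.marked.fill (((starBranches Qs).map fun A => (x, A)) ++ mergePairs vs F) := by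
  have hlen : Qs.length = es.length := by simpa using congrArg List.length hQ
  refine fill_attach_star T x _ _ ys hys vs F hF.symm Qs (hlen.trans h.symm) fun i => ?_
  have h1 : (Qs.map List.length)[i.1]? = (es.map fun e => e - 1)[i.1]? := by rw [hQ]
  have hi : i.1 < es.length := h ▸ i.2
  rw [List.getElem?_map, List.getElem?_map, List.getElem?_eq_getElem (by omega),
    List.getElem?_eq_getElem hi] at h1
  exact Option.some.inj h1

theorem sum_map_sub_one {es : List ℕ} (h : ∀ e ∈ es, 2 ≤ e) :
    (es.map fun e => e - 1).sum + es.length = es.sum := by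
  induction es with
  | nil => rfl
  | cons e es ih =>
    have := ih fun e he => h e (by simp [he])
    have := h e (by simp)
    simp only [List.map_cons, List.sum_cons, List.length_cons]
    omega

/-- The used leaf is first among the leaves, hence last in the reversed pool, where `mFill` appends
its merged branch. The new stars have the last labels, so their leaves are at the front of the pool,
where `chop` begins. -/
theorem IsMTree.graftAtFirstLeaf {S : LabelledTree} {rest ds es : List ℕ}
    {gs : List (S.tree.V × List S.tree.V)} (h : S.IsMTree rest gs)
    (hrest : 2 * rest.length ≤ rest.sum) (hne : es ≠ []) (hes : ∀ e ∈ es, 2 ≤ e)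
    (hlen : ds.length = rest.length + es.length + 1)
    (hsum : ds.sum = rest.sum + es.sum + es.length + 1)
    (hm : ∀ P, mFill ds P = mFill rest ((chop es P).2 ++ [bracket (chop es P).1])) :
    ∃ gs', (S.graftAtFirstLeaf (es.reverse.map RootedFinTree.star)).IsMTree ds gs' := by
  have hgs : gs.flatMap Prod.snd ≠ [] := by
    rw [← List.length_pos_iff]
    have := h.length_eq
    omega
  obtain ⟨gs₀, v, x, xs, gs₁, h', h0, hx, hgr⟩ := h.exists_graft hgs (es.reverse.map RootedFinTree.star)
  obtain ⟨ys, hys⟩ := exists_isStar es.reverse (by simp)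
  rw [hgr]
  have hflat : ∀ l : List S.tree.V, (gs₀ ++ (v, l) :: gs₁).flatMap Prod.snd =
      l ++ gs₁.flatMap Prod.snd := fun l => by
    rw [List.flatMap_append, h0, List.nil_append, List.flatMap_cons]
  have hpos : 0 < es.length := List.length_pos_iff.2 hne
  have hsumes : (es.reverse.map fun e => e - 1).sum + es.length = es.sum := by
    have := sum_map_sub_one (es := es.reverse) fun e he => hes e (by simpa using he)
    rwa [List.length_reverse, List.sum_reverse] at this
  have hflatlen : ((S.tree.attachGroups x (es.reverse.map RootedFinTree.star) ys
      (gs₀ ++ (v, xs) :: gs₁)).flatMap Prod.snd).length =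
        (xs ++ gs₁.flatMap Prod.snd).length + (es.reverse.map fun e => e - 1).sum := by
    rw [attachGroups_flatMap, hflat, List.length_append, List.length_map,
      length_flatMap_isStar hys]
  refine ⟨S.tree.attachGroups x (es.reverse.map RootedFinTree.star) ys (gs₀ ++ (v, xs) :: gs₁),
    ⟨?_, ?_, ?_, fun Ps hPs => ?_⟩⟩
  · rw [attachGroups_fst]
    change S.labels.map Sum.inl ++ _ = _
    rw [h'.labels_eq]
    simp
  · refine (h'.groups.remove.attach (by simp) hys).congr fun z =>
      (isLeaf_attach_iff S.tree x _ hys (fun i => hes _ ?_) ?_ z).symm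
    · exact List.mem_reverse.1 (List.get_mem es.reverse (i.cast (by simp)))
    · rw [← FinTree.degree_eq_ndeg, show S.tree.degree x = 1 from hx, List.length_map,
        List.length_reverse]
      omega
  · rw [hflatlen]
    have := h'.length_eq
    rw [hflat, List.length_append, List.length_cons] at this
    rw [List.length_append]
    omega
  · rw [hflatlen] at hPs
    obtain ⟨F, Qs, rfl, hF, hQ⟩ := exists_split es.reverse _ Ps hPs
    have h1 := fill_attach_map_star S.tree x hys _ F hF Qs hQ
    obtain ⟨e1⟩ := h1.nonempty_iso
    have h2 := h'.fill_iso (starBranches Qs :: F) (by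
      rw [hflat, List.length_cons, hF, List.cons_append, List.length_cons])
    rw [hflat, List.cons_append, mergePairs_cons, List.map_cons, List.reverse_cons] at h2
    obtain ⟨e2⟩ := h2
    rw [attachGroups_flatMap, hflat, hm, chop_reverse es Qs F hQ]
    exact ⟨e1.trans e2⟩

theorem map_map_fst {α β γ δ : Type*} (f : α → β) (g : γ → δ) (X : List (α × γ)) :
    (X.map (Prod.map f g)).map Prod.fst = (X.map Prod.fst).map f := by
  rw [List.map_map, List.map_map]
  rfl

/-- The `M`-tree whose degrees are at most one more than the smallest one in number. -/
theorem isMTree_start {es : List ℕ} {m : ℕ} (hes : ∀ e ∈ es, 2 ≤ e) (hm : 2 ≤ m)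
    (hle : es.length ≤ m) :
    ∃ gs, ((start.graft () (es.map RootedFinTree.star)).graftUnlabelled (.inl ())
      (List.replicate (m - es.length) RootedFinTree.single)).IsMTree (es.reverse ++ [m]) gs := by
  classical
  obtain ⟨ys, hys⟩ := exists_isStar es (by simp)
  set k := m - es.length with hk
  have hg0 : FinTree.single.LeafGroups (fun _ => False) [((), [])] :=
    ⟨by simp, by simp⟩
  have hg1 := hg0.attach (x := ()) not_false hys
  have hgs1 : FinTree.single.attachGroups () _ ys [((), [])] =
      (Sum.inl (), []) :: FinTree.single.attachGroups () _ ys [] := rfl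
  rw [hgs1] at hg1
  have hnot : (Sum.inl () : (FinTree.single.attach () (es.map RootedFinTree.star)).V) ∉
      (FinTree.single.attachGroups () _ ys []).map Prod.fst := fun h => by
    rw [attachGroups_fst] at h
    obtain ⟨i, -, h⟩ := List.mem_map.1 h
    exact Sum.inr_ne_inl h
  have hg2 := hg1.attach_single hnot k
  have hsumes := sum_map_sub_one hes
  have hstarslen := length_flatMap_isStar hys fun i y =>
    (Sum.inr ⟨i, y⟩ : (FinTree.single.attach () (es.map RootedFinTree.star)).V)
  have hstars := attachGroups_flatMap FinTree.single () _ ys []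
  rw [List.flatMap_nil, List.map_nil, List.nil_append] at hstars
  set stars : List (FinTree.single.attach () (es.map RootedFinTree.star)).V :=
    (List.finRange _).flatMap fun i => (ys i).map fun y => Sum.inr ⟨i, y⟩
  set singles : List ((FinTree.single.attach () (es.map RootedFinTree.star)).attach (.inl ())
      (List.replicate k RootedFinTree.single)).V :=
    (List.finRange (List.replicate k RootedFinTree.single).length).map fun i =>
        Sum.inr ⟨i, ((List.replicate k RootedFinTree.single).get i).root⟩ with hsingles
  have hsingleslen : singles.length = k := by simp [hsingles]
  have hflat : (((Sum.inl (Sum.inl ()) : ((FinTree.single.attach () (es.map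
      RootedFinTree.star)).attach (.inl ()) (List.replicate k RootedFinTree.single)).V),
        singles) :: (FinTree.single.attachGroups () _ ys []).map
      (Prod.map Sum.inl (List.map Sum.inl))).flatMap Prod.snd = singles ++ stars.map Sum.inl := by
    rw [← hstars, List.flatMap_cons, List.flatMap_map, List.map_flatMap]
    rfl
  have hlen : (singles ++ stars.map Sum.inl).length = k + (es.map fun e => e - 1).sum := by
    rw [List.length_append, hsingleslen, List.length_map, hstarslen]
  refine ⟨_, ⟨?_, hg2.congr fun z => ?_, ?_, fun Ps hPs => ?_⟩⟩
  · rw [List.map_cons, map_map_fst, attachGroups_fst]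
    rfl
  · rw [IsLeaf, degree_eq_ndeg]
    rcases z with (⟨⟩ | ⟨i, z⟩) | ⟨i, z⟩
    · refine iff_of_false not_false ?_
      rw [ndeg_attach_inl, ndeg_attach_inl, ndeg_single, if_pos rfl, if_pos rfl, List.length_map,
        List.length_replicate]
      omega
    · rw [ndeg_attach_inl, if_neg Sum.inr_ne_inl, add_zero, ndeg_attach_inr, Sum.elim_inl,
        Sum.elim_inr]
      split_ifs with h
      · subst h
        rw [(hys i).ndeg_root]
        have := hes _ (List.get_mem es (i.cast (by simp)))
        refine iff_of_false (fun h => h rfl) ?_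
        omega
      · exact iff_of_true h (by rw [(hys i).ndeg_eq_one z h])
    · refine iff_of_true trivial ?_
      rw [ndeg_attach_inr, if_pos ((get_replicate_single k i).1 z), (get_replicate_single k i).2]
  · rw [hflat, hlen]
    simp only [List.length_append, List.sum_append, List.length_singleton, List.sum_singleton,
      List.length_reverse, List.sum_reverse]
    omega
  · rw [hflat] at hPs ⊢
    rw [hlen] at hPs
    obtain ⟨F, Qs, rfl, hF, hQ⟩ := exists_split es k Ps hPs
    have hQlen : stars.length = Qs.flatten.length := by
      rw [hstarslen, List.length_flatten, hQ]
    have hm : mFill (es.reverse ++ [m]) ((F ++ Qs.flatten).map bracket).reverse =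
        starBranches Qs ++ (F.map bracket).reverse := by
      rw [mFill, dif_neg (by simp)]
      simp only [List.getLast_append_singleton, List.length_append, List.length_singleton,
        List.length_reverse, Nat.add_sub_cancel]
      rw [if_pos (by omega), List.take_left' (by simp), chop_reverse _ _ _ (by
        rw [List.reverse_reverse, hQ])]
    -- The root has the first label, so its own leaves precede those of the stars in the list,
    -- although they are attached after the stars.
    obtain ⟨e1⟩ := (fill_perm ((FinTree.single.attach () (es.map RootedFinTree.star)).attach
      (.inl ()) (List.replicate k RootedFinTree.single)).marked
      (l := mergePairs (singles ++ stars.map Sum.inl) (F ++ Qs.flatten))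
      (l' := mergePairs (stars.map Sum.inl ++ singles) (Qs.flatten ++ F)) (by
        rw [mergePairs_append (by rw [hsingleslen, hF]),
          mergePairs_append (by rw [List.length_map, hQlen])]
        exact List.perm_append_comm)).nonempty_iso
    obtain ⟨e2⟩ := (fill_attach_single (FinTree.single.attach () (es.map RootedFinTree.star))
      (.inl ()) k stars Qs.flatten F hQlen hF).nonempty_iso
    obtain ⟨e3⟩ := (fill_perm (FinTree.single.attach () (es.map RootedFinTree.star)).marked
      (l := mergePairs stars Qs.flatten ++ (F.map bracket).map fun A => (Sum.inl (), A))
      (l' := mergePairs (([()] : List Unit).map Sum.inl ++ stars) ([F.map bracket] ++ Qs.flatten))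
      List.perm_append_comm).nonempty_iso
    obtain ⟨e4⟩ := (fill_attach_map_star FinTree.single () hys [()] [F.map bracket] rfl Qs
      hQ).nonempty_iso
    have h5 : ((starBranches Qs).map fun A => ((), A)) ++ mergePairs [()] [F.map bracket] =
        (starBranches Qs ++ F.map bracket).map fun A => ((), A) := by
      rw [mergePairs_cons, List.map_append]
      simp [mergePairs]
    rw [h5] at e4
    obtain ⟨e5, -⟩ := bracket_equivalent_fill (starBranches Qs ++ F.map bracket)
    obtain ⟨e6, -⟩ := bracket_perm ((List.reverse_perm (F.map bracket)).symm.append_left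
      (starBranches Qs))
    rw [hm]
    exact ⟨((((e1.trans e2).trans e3).trans e4).trans e5.symm).trans e6⟩

end LabelledTree

namespace LabelledTree

open ConfigTree FinTree

theorem mTree_append_of_le {init : List ℕ} {m : ℕ} (h : init.length ≤ m) :
    mTree (init ++ [m]) = (start.graft () (init.reverse.map RootedFinTree.star)).graftUnlabelled
      (.inl ()) (List.replicate (m - init.length) RootedFinTree.single) := by
  rw [mTree, dif_neg (by simp)]
  simp only [List.getLast_append_singleton, List.length_append, List.length_singleton,
    Nat.add_sub_cancel, List.take_left]
  rw [if_pos (by omega)]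
  have key : ∀ l R, l = init → (start.graft () (l.reverse.map RootedFinTree.star)).graftUnlabelled
      (.inl ()) R = (start.graft () (init.reverse.map RootedFinTree.star)).graftUnlabelled
        (.inl ()) R := by
    rintro l R rfl
    rfl
  exact key _ _ (by simp)

theorem mTree_append_of_lt {init : List ℕ} {m : ℕ} (h : m < init.length) :
    mTree (init ++ [m]) = (mTree (init.drop (m - 1))).graftAtFirstLeaf
      ((init.take (m - 1)).reverse.map RootedFinTree.star) := by
  rw [mTree, dif_neg (by simp)]
  simp only [List.getLast_append_singleton, List.length_append, List.length_singleton,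
    Nat.add_sub_cancel, List.take_left]
  rw [if_neg (by omega), List.take_append_of_le_length (by omega)]

theorem mFill_append_of_lt {init : List ℕ} {m : ℕ} (h : m < init.length)
    (P : List RootedFinTree) : mFill (init ++ [m]) P = mFill (init.drop (m - 1))
      ((chop (init.take (m - 1)) P).2 ++ [bracket (chop (init.take (m - 1)) P).1]) := by
  rw [mFill, dif_neg (by simp)]
  simp only [List.getLast_append_singleton, List.length_append, List.length_singleton,
    Nat.add_sub_cancel, List.take_left]
  rw [if_neg (by omega), List.take_append_of_le_length (by omega)]

/-- Strong induction along the common recursion of `mTree` and `mFill`: both remove the smallest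
degree `m` together with the `m - 1` largest ones. -/
theorem exists_isMTree (ds : List ℕ) : ds ≠ [] → (∀ d ∈ ds, 2 ≤ d) →
    ∃ gs, (mTree ds).IsMTree ds gs := by
  induction hn : ds.length using Nat.strong_induction_on generalizing ds with
  | _ n ih =>
    intro hds h2
    obtain ⟨init, m, rfl⟩ : ∃ init m, ds = init ++ [m] :=
      ⟨ds.dropLast, ds.getLast hds, (List.dropLast_append_getLast hds).symm⟩
    have hm : 2 ≤ m := h2 m (by simp)
    have hinit : ∀ e ∈ init, 2 ≤ e := fun e he => h2 e (by simp [he])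
    have hlen : (init ++ [m]).length = init.length + 1 := by simp
    rcases le_or_gt init.length m with hcase | hcase
    · have h := isMTree_start (es := init.reverse) (by simpa using hinit) hm (by
        rwa [List.length_reverse])
      rw [List.length_reverse, List.reverse_reverse] at h
      rwa [mTree_append_of_le hcase]
    · rw [mTree_append_of_lt hcase]
      have heslen : (init.take (m - 1)).length = m - 1 := by rw [List.length_take]; omega
      have hrestlen : (init.drop (m - 1)).length = init.length - (m - 1) := List.length_drop
      have hsum : (init.take (m - 1)).sum + (init.drop (m - 1)).sum = init.sum := by
        rw [← List.sum_append, List.take_append_drop]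
      have hrest2 : ∀ e ∈ init.drop (m - 1), 2 ≤ e := fun e he =>
        hinit e (List.mem_of_mem_drop he)
      obtain ⟨gs, hgs⟩ := ih (init.drop (m - 1)).length (by omega) (init.drop (m - 1)) rfl
        (by rw [← List.length_pos_iff]; omega) hrest2
      refine hgs.graftAtFirstLeaf ?_ (by rw [← List.length_pos_iff]; omega)
        (fun e he => hinit e (List.mem_of_mem_take he)) (by omega) ?_ (mFill_append_of_lt hcase)
      · simpa [mul_comm] using List.card_nsmul_le_sum (init.drop (m - 1)) 2 hrest2
      · rw [List.sum_append, List.sum_singleton]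
        omega

/-- The `M`-tree in terms of `mFill`. -/
theorem mTree_iso {ds : List ℕ} (hds : ds ≠ []) (h2 : ∀ d ∈ ds, 2 ≤ d) {n : ℕ}
    (hn : n + 2 * ds.length = ds.sum + 2) :
    Nonempty ((mTree ds).tree.graph ≃g
      (bracket (mFill ds (List.replicate n (bracket [])))).graph) := by
  obtain ⟨gs, hgs⟩ := exists_isMTree ds hds h2
  have hlen := hgs.length_eq
  -- Every leaf is filled with the empty list, so the tree itself is left as it is.
  have h := hgs.fill_iso (List.replicate n []) (by rw [List.length_replicate]; omega)
  have h0 : ∀ (vs : List (mTree ds).tree.V) k, mergePairs vs (List.replicate k []) = [] := by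
    intro vs
    induction vs with
    | nil => exact fun k => rfl
    | cons v vs ih =>
      rintro (_ | k)
      · rfl
      · rw [List.replicate_succ, mergePairs_cons, ih, List.map_nil, List.append_nil]
  rw [h0, List.map_replicate, List.reverse_replicate] at h
  exact h

end LabelledTree

/-! ### The optimum for a fixed degree sequence. -/

namespace ConfigTree

variable {ρ : RootedFinTree → ℝ} {f : Multiset ℝ → ℝ}

/-- The greedy tree is the optimum for an increasing rule. -/
theorem le_greedyTree {I : FinTree → ℝ} (hI : IsTreeInvariant I) (hc : MaxCompatible ρ I)
    (hr : HasRecurrenceRule ρ f) (hf : StrictlyIncreasingRule ρ f) {T : FinTree} {B : List ℕ}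
    (hT : T.degrees = ↑B) (hs : B.Pairwise (· ≥ ·)) :
    I T ≤ I (greedyTree B) ∧ (greedyTree B).degrees = ↑B := by
  obtain _ | ⟨d, ds⟩ := B
  · obtain ⟨v⟩ := T.isTree.connected.nonempty
    have : (0 : Multiset ℕ) = T.degrees := hT.symm
    rw [FinTree.degrees, eq_comm, Multiset.map_eq_zero] at this
    exact absurd (Finset.mem_univ_val v) (by rw [this]; simp)
  · obtain ⟨hle, hd, hok, hdeg⟩ := le_queue hI hc hr hf hT hs
    have e := greedyTree_iso hok hd
    rw [hI _ _ e, FinTree.degrees_eq_of_iso e]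
    exact ⟨hle, hdeg⟩

/-- The `M`-tree is the optimum for a decreasing rule. -/
theorem le_mTree {I : FinTree → ℝ} (hI : IsTreeInvariant I) (hc : MaxCompatible ρ I)
    (hr : HasRecurrenceRule ρ f) (hf : StrictlyDecreasingRule ρ f) {T : FinTree} {B : List ℕ}
    (hT : T.degrees = ↑B) (hs : B.Pairwise (· ≥ ·)) :
    I T ≤ I (mTree B) ∧ (mTree B).degrees = ↑B := by
  have hcardT : Fintype.card T.V = B.length := by
    have := congrArg Multiset.card hT
    rwa [FinTree.degrees, Multiset.card_map, Multiset.coe_card] at this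
  obtain ⟨v⟩ := T.isTree.connected.nonempty
  rw [mTree]
  split_ifs with h1
  · have h1' : Fintype.card T.V = 1 :=
      le_antisymm (hcardT ▸ h1) (Fintype.card_pos_iff.2 ⟨v⟩)
    have hsub : Subsingleton T.V := Fintype.card_le_one_iff_subsingleton.1 h1'.le
    have e : Nonempty (T.graph ≃g FinTree.single.graph) :=
      ⟨⟨⟨fun _ => (), fun _ => v, fun _ => Subsingleton.elim _ _, fun _ => rfl⟩, fun {a b} => by
        rw [Subsingleton.elim a b]
        simp⟩⟩
    rw [← hI _ _ e, ← FinTree.degrees_eq_of_iso e]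
    exact ⟨le_rfl, hT⟩
  have hpos : ∀ d ∈ B, 1 ≤ d := by
    obtain _ | ⟨d, ds⟩ := B
    · simp
    · exact one_le_of_mem_degrees hT (by rintro rfl; simp at h1)
  have hperm : (B.filter (2 ≤ ·) ++ List.replicate (B.filter fun d => ¬ 2 ≤ d).length 1).Perm B := by
    have : B.filter (fun d => ¬ 2 ≤ d) =
        List.replicate (B.filter fun d => ¬ 2 ≤ d).length 1 := by
      refine List.eq_replicate_iff.2 ⟨rfl, fun d hd => ?_⟩
      rw [List.mem_filter] at hd
      have := hpos d hd.1
      have := hd.2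
      simp at this
      omega
    rw [← this]
    simpa only [decide_not] using List.filter_append_perm (fun d => decide (2 ≤ d)) B
  set n := (B.filter fun d => ¬ 2 ≤ d).length with hn
  have hT' : T.degrees = ((B.filter (2 ≤ ·) ++ List.replicate n 1 : List ℕ) : Multiset ℕ) := by
    rw [hT]
    exact (Multiset.coe_eq_coe.2 hperm).symm
  by_cases hds : B.filter (2 ≤ ·) = []
  · rw [hds, List.nil_append] at hT'
    obtain ⟨L, hB, hD, e⟩ := exists_config T
    have hcard := card_rootBlobs L
    rw [hB, hD, hT'] at hcard
    simp only [Multiset.card_zero, Multiset.coe_card, List.length_replicate, Multiset.sum_coe,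
      List.sum_replicate, smul_eq_mul, mul_one] at hcard
    -- If all degrees are one, the handshake count leaves only the tree with two vertices.
    have hn2 : n = 2 := by omega
    rw [hT', hn2] at hD
    obtain ⟨L1, hB1, hD1, hle1, hdeg1⟩ := exists_config_ones hI hc (E := {1}) (by simp) (by simp) 1
      L hB (by rw [hD]; rfl)
    obtain ⟨e1, -⟩ := tree_iso_of_rootDegs (d := 1) (Q := [bracket []]) hD1 hB1
    have e2 : (bracket []).Equivalent single := ⟨FinTree.attachNilIso _ _, rfl⟩
    obtain ⟨e3, -⟩ := bracket_cons_congr e2 []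
    obtain ⟨e1⟩ := e1
    have e4 : Nonempty ((tree L1).graph ≃g (LabelledTree.mTree []).tree.graph) := by
      rw [LabelledTree.mTree, dif_pos rfl]
      exact ⟨e1.trans e3⟩
    rw [hds, ← hI _ _ e4, ← FinTree.degrees_eq_of_iso e4, hdeg1, ← FinTree.degrees_eq_of_iso e,
      hI _ _ e]
    exact ⟨hle1, hT⟩
  · have h2 : ∀ d ∈ B.filter (2 ≤ ·), 2 ≤ d := fun d hd => by simpa using (List.mem_filter.1 hd).2
    obtain ⟨hle, hdeg, hlen⟩ := le_mFill_replicate hI hc hr hf hT' hds h2 (hs.sublist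
      List.filter_sublist)
    have e := LabelledTree.mTree_iso hds h2 hlen
    rw [hI _ _ e, FinTree.degrees_eq_of_iso e]
    exact ⟨hle, hdeg.trans hT⟩

end ConfigTree

/-! ### From majorised sequences to `B` by unit transfers. -/

namespace ConfigTree

/-- Moving a branch from a vertex of small degree to a vertex of large degree. -/
theorem exists_le_of_transfer {I : FinTree → ℝ} (hI : IsTreeInvariant I) {ρ : RootedFinTree → ℝ}
    (hc : MaxCompatible ρ I) {T : FinTree} {d e : ℕ} {E : Multiset ℕ}
    (hT : T.degrees = d ::ₘ e ::ₘ E) (hed : e ≤ d) (he : 2 ≤ e) :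
    ∃ T' : FinTree, T'.degrees = (d + 1) ::ₘ (e - 1) ::ₘ E ∧ I T ≤ I T' := by
  obtain ⟨L0, hB0, hD0, hiso⟩ := exists_config T
  rw [hT] at hD0
  obtain ⟨L1, hlen1, hu1⟩ := exists_reroot (L := L0) (d := d) (by rw [hD0]; simp)
  have hmem : e ∈ (L1.map degs).sum := by
    have := hu1.2.2
    rw [hD0, rootDegs, hlen1, Multiset.cons_inj_right] at this
    rw [← this]
    simp
  obtain ⟨y, hy, hey⟩ := exists_mem_of_mem_sum hmem
  obtain ⟨l1, l2, rfl⟩ := List.append_of_mem hy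
  obtain ⟨S, R, hR, hS⟩ := exists_path_of_mem_degs y hey
  have hu : UEquiv L0 (path S R :: (l1 ++ l2)) :=
    hu1.trans ((UEquiv.of_perm List.perm_middle).trans (UEquiv.cons hS _))
  set L := l1 ++ l2 with hL
  have hlen : L.length + 1 = d := by
    rw [← hlen1, hL]
    simp only [List.length_append, List.length_cons]
    omega
  obtain ⟨X, Y, hXY⟩ := path_root_data S
  obtain ⟨M, hM, hsort⟩ := exists_perm_sorted ρ (L ++ R)
  have hMlen : M.length = L.length + R.length := by rw [hM.length_eq, List.length_append]
  have hE : ((L ++ R).map degs).sum + X = E := by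
    have := hu.2.2
    rw [hD0, (hXY L R).1, hlen, hR, Multiset.cons_inj_right, Multiset.cons_inj_right] at this
    exact this.symm
  have hY : ((L ++ R).map blobs).sum + Y = 0 := by
    rw [← (hXY L R).2, ← hu.2.1, hB0]
  have key : ∀ L' R' : List ConfigTree, (L' ++ R').Perm M →
      (L'.length + 1) ::ₘ (R'.length + 1) ::ₘ E = (d + 1) ::ₘ (e - 1) ::ₘ E →
      I (tree (path S R :: L)) ≤ I (tree (path S R' :: L')) →
      ∃ T' : FinTree, T'.degrees = (d + 1) ::ₘ (e - 1) ::ₘ E ∧ I T ≤ I T' := by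
    intro L' R' hp hdeg hle
    have hp' := hp.trans hM
    refine ⟨tree (path S R' :: L'), ?_, ?_⟩
    · rw [degrees_tree, (hXY L' R').1, (hXY L' R').2, (hp'.map blobs).sum_eq,
        (hp'.map degs).sum_eq, hE, hY, hdeg]
      simp
    · rw [hI _ _ hiso, eq_of_isTreeInvariant hI hu]
      exact hle
  have h1 : (M.take d).length + 1 = d + 1 := by rw [List.length_take]; omega
  have h2 : (M.drop d).length + 1 = e - 1 := by rw [List.length_drop]; omega
  -- There are `d + e - 2` branches beside the path, `d - 1` of them at the root. The value `s = d`
  -- is admissible as `2 ≤ e ≤ d`, and with the edge of the path it gives the degrees `d + 1` and `e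
  -- - 1`.
  rcases exchange hI hc S (s := d) hM.symm hsort (by omega) (by omega) (by omega) (by omega)
    with hle | hle
  · exact key _ _ (by rw [List.take_append_drop]) (by rw [h1, h2]) hle
  · exact key _ _ (List.perm_append_comm.trans (by rw [List.take_append_drop]))
      (by rw [h1, h2, Multiset.cons_swap]) hle

end ConfigTree

/-- `B` dominates `D`: its partial sums, increased by `c`, are at least those of `D`, with equality
for the whole sums. -/
def Dominates : ℕ → List ℕ → List ℕ → Prop
  | c, [], [] => c = 0
  | c, b :: B, d :: D => d ≤ b + c ∧ Dominates (b + c - d) B D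
  | _, _, _ => False

/-- The sum of the entries, weighted with their positions. -/
def positionWeight : List ℕ → ℕ
  | [] => 0
  | _ :: D => D.sum + positionWeight D

/-- Carrying the surplus `c` along turns the conditions on partial sums into a local one at each
position, suited to induction. -/
theorem dominates_of_sum_take {c : ℕ} {B D : List ℕ} (hlen : B.length = D.length)
    (hsum : B.sum + c = D.sum)
    (h : ∀ k, k < B.length → (D.take k).sum ≤ (B.take k).sum + c) : Dominates c B D := by
  induction B generalizing c D with
  | nil =>
    obtain rfl := List.length_eq_zero_iff.1 hlen.symm
    simpa [Dominates] using hsum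
  | cons b B ih =>
    obtain _ | ⟨d, D⟩ := D
    · simp at hlen
    simp only [List.length_cons, Nat.add_right_cancel_iff, List.sum_cons] at hlen hsum
    have h1 : d ≤ b + c := by
      by_cases hB : B = []
      · subst hB
        obtain rfl := List.length_eq_zero_iff.1 hlen.symm
        simp at hsum
        omega
      · have := h 1 (by simpa [List.length_pos_iff] using hB)
        simpa using this
    refine ⟨h1, ih hlen (by omega) fun k hk => ?_⟩
    have := h (k + 1) (by simpa using hk)
    simp only [List.take_succ_cons, List.sum_cons] at this
    omega

/-- Without a carried surplus the first entry of `D` is at most that of `B`, and the later entries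
of `D` are no larger. -/
theorem Dominates.le_of_le {B D : List ℕ} (h : Dominates 0 B D) (hs : D.Pairwise (· ≥ ·)) {b : ℕ}
    (hb : ∀ x ∈ B, x ≤ b) : ∀ x ∈ D, x ≤ b := by
  obtain _ | ⟨d, D⟩ := D
  · simp
  obtain _ | ⟨b', B⟩ := B
  · exact h.elim
  intro x hx
  have h1 : d ≤ b := h.1.trans (hb b' (by simp))
  rcases List.mem_cons.1 hx with rfl | hx
  · exact h1
  · exact ((List.pairwise_cons.1 hs).1 x hx).trans h1

/-- The entry to be lowered is the one at which the surplus is first used up. There `e` exceeds `b`,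
so `e ≥ 2`. No surplus is passed on, so all following entries are at most `b ≤ e - 1` and the order
survives. -/
theorem Dominates.exists_lower {c : ℕ} {B D : List ℕ} (h : Dominates c B D) (hc : c ≠ 0)
    (hB : B.Pairwise (· ≥ ·)) (hD : D.Pairwise (· ≥ ·)) (hpos : ∀ b ∈ B, 1 ≤ b) :
    ∃ M e N, D = M ++ e :: N ∧ 2 ≤ e ∧ Dominates (c - 1) B (M ++ (e - 1) :: N) ∧
      (M ++ (e - 1) :: N).Pairwise (· ≥ ·) := by
  induction B generalizing c D with
  | nil =>
    obtain _ | ⟨d, D⟩ := D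
    · exact absurd h hc
    · exact h.elim
  | cons b B ih =>
    obtain _ | ⟨e, D⟩ := D
    · exact h.elim
    obtain ⟨h1, h2⟩ := h
    have hDc := List.pairwise_cons.1 hD
    have hBc := List.pairwise_cons.1 hB
    have hb := hpos b (by simp)
    by_cases h0 : b + c - e = 0
    · refine ⟨[], e, D, rfl, by omega, ⟨by omega, ?_⟩, ?_⟩
      · rwa [show b + (c - 1) - (e - 1) = b + c - e by omega]
      · refine List.pairwise_cons.2 ⟨fun x hx => ?_, hDc.2⟩
        rw [h0] at h2
        have := h2.le_of_le hDc.2 hBc.1 x hx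
        change x ≤ e - 1
        omega
    · obtain ⟨M, e', N, rfl, he', hdom, hs⟩ := ih h2 h0 hBc.2 hDc.2
        fun x hx => hpos x (by simp [hx])
      refine ⟨e :: M, e', N, rfl, he', ⟨by omega, ?_⟩, List.pairwise_cons.2 ⟨fun x hx => ?_, hs⟩⟩
      · rwa [show b + (c - 1) - e = b + c - e - 1 by omega]
      · rcases List.mem_append.1 hx with hx | hx
        · exact hDc.1 x (by simp [hx])
        · rcases List.mem_cons.1 hx with rfl | hx
          · exact (Nat.sub_le _ _).trans (hDc.1 e' (by simp))
          · exact hDc.1 x (by simp [hx])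

theorem sum_lower (M N : List ℕ) {e : ℕ} (he : 2 ≤ e) :
    (M ++ (e - 1) :: N).sum + 1 = (M ++ e :: N).sum := by
  simp only [List.sum_append, List.sum_cons]
  omega

theorem positionWeight_lower (M N : List ℕ) {e : ℕ} (he : 2 ≤ e) :
    positionWeight (M ++ (e - 1) :: N) ≤ positionWeight (M ++ e :: N) := by
  induction M with
  | nil => exact le_rfl
  | cons m M ih =>
    have := sum_lower M N he
    simp only [List.cons_append, positionWeight]
    omega

/-- A sequence that is strictly dominated can be improved by a transfer of one unit. -/
theorem Dominates.exists_transfer {B D : List ℕ} (h : Dominates 0 B D) (hne : D ≠ B)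
    (hB : B.Pairwise (· ≥ ·)) (hD : D.Pairwise (· ≥ ·)) (hpos : ∀ b ∈ B, 1 ≤ b) :
    ∃ (d e : ℕ) (E : Multiset ℕ) (D' : List ℕ), (D : Multiset ℕ) = d ::ₘ e ::ₘ E ∧ (D' : Multiset ℕ) = (d + 1) ::ₘ (e - 1) ::ₘ E ∧
      e ≤ d ∧ 2 ≤ e ∧ Dominates 0 B D' ∧ D'.Pairwise (· ≥ ·) ∧ D'.sum = D.sum ∧
      positionWeight D' < positionWeight D := by
  induction B generalizing D with
  | nil =>
    obtain _ | ⟨d, D⟩ := D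
    · exact absurd rfl hne
    · exact h.elim
  | cons b B ih =>
    obtain _ | ⟨d, D⟩ := D
    · exact h.elim
    obtain ⟨h1, h2⟩ := h
    have hDc := List.pairwise_cons.1 hD
    have hBc := List.pairwise_cons.1 hB
    have hpos' : ∀ x ∈ B, 1 ≤ x := fun x hx => hpos x (by simp [hx])
    -- At the first position where the sequences differ, `d < b` and a surplus appears: this entry
    -- is raised, and the entry that uses up the surplus is lowered.
    by_cases hdb : d = b
    · subst hdb
      rw [add_zero, Nat.sub_self] at h2
      obtain ⟨d', e, E, D', hE, hE', hed, he, hdom, hs, hsum, hw⟩ := ih h2 (by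
        rintro rfl
        exact hne rfl) hBc.2 hDc.2 hpos'
      refine ⟨d', e, d ::ₘ E, d :: D', ?_, ?_, hed, he, ⟨h1, by simpa using hdom⟩,
        List.pairwise_cons.2 ⟨hdom.le_of_le hs hBc.1, hs⟩, by simp [hsum], ?_⟩
      · rw [← Multiset.cons_coe, hE, Multiset.cons_swap d d', Multiset.cons_swap d e]
      · rw [← Multiset.cons_coe, hE', Multiset.cons_swap d, Multiset.cons_swap d (e - 1)]
      · simp only [positionWeight]
        omega
    · obtain ⟨M, e, N, rfl, he, hdom, hs⟩ := h2.exists_lower (by omega) hBc.2 hDc.2 hpos'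
      have hsum := sum_lower M N he
      have hw := positionWeight_lower M N he
      refine ⟨d, e, ↑(M ++ N), (d + 1) :: (M ++ (e - 1) :: N), ?_, ?_, hDc.1 e (by simp), he,
        ⟨by omega, ?_⟩, List.pairwise_cons.2 ⟨fun x hx => ?_, hs⟩, ?_, ?_⟩
      · rw [Multiset.cons_coe, Multiset.cons_coe, Multiset.coe_eq_coe]
        exact List.perm_middle.cons d
      · rw [Multiset.cons_coe, Multiset.cons_coe, Multiset.coe_eq_coe]
        exact List.perm_middle.cons (d + 1)
      · rwa [show b + 0 - (d + 1) = b + 0 - d - 1 by omega]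
      · refine le_trans ?_ (Nat.le_succ d)
        rcases List.mem_append.1 hx with hx | hx
        · exact hDc.1 x (by simp [hx])
        · rcases List.mem_cons.1 hx with rfl | hx
          · exact (Nat.sub_le _ _).trans (hDc.1 e (by simp))
          · exact hDc.1 x (by simp [hx])
      · simp only [List.sum_cons]
        omega
      · simp only [positionWeight]
        omega

theorem Dominates.exists_le {I : FinTree → ℝ} (hI : IsTreeInvariant I) {ρ : RootedFinTree → ℝ}
    (hc : MaxCompatible ρ I) {B D : List ℕ} (h : Dominates 0 B D) (hB : B.Pairwise (· ≥ ·))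
    (hD : D.Pairwise (· ≥ ·)) (hpos : ∀ b ∈ B, 1 ≤ b) {T : FinTree} (hT : T.degrees = ↑D) :
    ∃ T' : FinTree, T'.degrees = ↑B ∧ I T ≤ I T' := by
  -- Every transfer moves a unit towards the front, which lowers the position weight; one is
  -- possible as long as `D ≠ B`.
  induction hn : positionWeight D using Nat.strong_induction_on generalizing D T with
  | _ n ih =>
    by_cases hne : D = B
    · exact ⟨T, by rw [hT, hne], le_rfl⟩
    · obtain ⟨d, e, E, D', hE, hE', hed, he, hdom, hs, -, hw⟩ := h.exists_transfer hne hB hD hpos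
      obtain ⟨T1, hT1, hle1⟩ := ConfigTree.exists_le_of_transfer hI hc (hT.trans hE) hed he
      obtain ⟨T2, hT2, hle2⟩ := ih _ (hn ▸ hw) hdom hs (hT1.trans hE'.symm) rfl
      exact ⟨T2, hT2, hle1.trans hle2⟩

/-- For every tree whose degree sequence is majorised by `B` there is a tree with degree sequence
`B` that is at least as good. -/
theorem exists_degrees_eq_of_majorises {I : FinTree → ℝ} (hI : IsTreeInvariant I)
    {ρ : RootedFinTree → ℝ} (hc : MaxCompatible ρ I) {B : List ℕ} (hB : IsTreeDegreeSeq B)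
    {T : FinTree} (hT : T ∈ treesMajorisedBy B) :
    ∃ T' : FinTree, T'.degrees = ↑B ∧ I T ≤ I T' := by
  obtain ⟨T0, rfl⟩ := hB
  obtain ⟨h1, h2, h3⟩ := hT
  have hs := T0.degreeSeq_pairwise
  have hT0 := T0.coe_degreeSeq
  have hTd := T.coe_degreeSeq
  have hsT := T.degreeSeq_pairwise
  generalize T0.degreeSeq = B at *
  generalize T.degreeSeq = D at *
  -- Up to length one, equal sums already force equality. Longer degree sequences of trees have only
  -- positive entries, as the transfers require.
  by_cases hB1 : B.length ≤ 1
  · refine ⟨T, ?_, le_rfl⟩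
    obtain _ | ⟨b, _ | ⟨b', B⟩⟩ := B
    · rw [← hTd, List.length_eq_zero_iff.1 h1.symm]
    · obtain ⟨d, rfl⟩ := List.length_eq_one_iff.1 h1.symm
      rw [← hTd]
      simp only [List.sum_singleton] at h2
      rw [h2]
    · simp at hB1
  · refine Dominates.exists_le hI hc (dominates_of_sum_take h1 (by rw [h2, add_zero]) fun k hk => ?_)
      hs hsT ?_ hTd.symm
    · rcases Nat.eq_zero_or_pos k with rfl | hk0
      · simp
      · exact h3 k hk0 hk
    · obtain _ | ⟨b, B⟩ := B
      · simp
      · exact ConfigTree.one_le_of_mem_degrees hT0.symm (by rintro rfl; simp at hB1)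

/-! ### From minimum to maximum, and the conclusion. -/

theorem MinCompatible.neg {ρ : RootedFinTree → ℝ} {I : FinTree → ℝ} (h : MinCompatible ρ I) :
    MaxCompatible ρ (-I) := by
  intro H v w hvw hv hw T hT s h1 h2
  simpa only [Pi.neg_apply, neg_le_neg_iff] using h H v w hvw hv hw T hT s h1 h2

theorem IsTreeInvariant.neg {I : FinTree → ℝ} (h : IsTreeInvariant I) : IsTreeInvariant (-I) :=
  fun S T e => by rw [Pi.neg_apply, Pi.neg_apply, h S T e]

/-- A tree with degree sequence `B` that is optimal among these trees is optimal among the trees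
whose degree sequence is majorised by `B`. -/
theorem isGreatest_of_degrees {I : FinTree → ℝ} (hI : IsTreeInvariant I)
    {ρ : RootedFinTree → ℝ} (hc : MaxCompatible ρ I) {B : List ℕ} (hB : IsTreeDegreeSeq B)
    {G : FinTree} (h : ∀ T : FinTree, T.degrees = ↑B → B.Pairwise (· ≥ ·) →
      I T ≤ I G ∧ G.degrees = ↑B) :
    G ∈ treesMajorisedBy B ∧ ∀ T ∈ treesMajorisedBy B, I T ≤ I G := by
  obtain ⟨T0, hT0⟩ := hB
  have hs : B.Pairwise (· ≥ ·) := hT0 ▸ T0.degreeSeq_pairwise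
  refine ⟨?_, fun T hT => ?_⟩
  · have hG := (h T0 (by rw [← hT0, T0.coe_degreeSeq]) hs).2
    have : G.degreeSeq = B := by
      rw [← hT0]
      refine FinTree.degreeSeq_eq_of_degrees ?_
      rw [hG, ← hT0, T0.coe_degreeSeq]
    exact ⟨by rw [this], by rw [this], fun k _ _ => by rw [this]⟩
  · obtain ⟨T', hT', hle⟩ := exists_degrees_eq_of_majorises hI hc ⟨T0, hT0⟩ hT
    exact hle.trans (h T' hT' hs).1

theorem theorem3p10 (I : FinTree → ℝ) (hI : IsTreeInvariant I)
    (ρ : RootedFinTree → ℝ) (hρ : IsRootedTreeInvariant ρ)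
    (f : Multiset ℝ → ℝ) (hf : HasRecurrenceRule ρ f)
    (B : List ℕ) (hB : IsTreeDegreeSeq B) :
    (MaxCompatible ρ I →
      (StrictlyIncreasingRule ρ f → SingleIsStrictMin ρ →
        greedyTree B ∈ treesMajorisedBy B ∧
          ∀ T ∈ treesMajorisedBy B, I T ≤ I (greedyTree B)) ∧
      (StrictlyDecreasingRule ρ f → SingleIsStrictMax ρ →
        mTree B ∈ treesMajorisedBy B ∧
          ∀ T ∈ treesMajorisedBy B, I T ≤ I (mTree B))) ∧
    (MinCompatible ρ I →
      (StrictlyIncreasingRule ρ f → SingleIsStrictMin ρ →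
        greedyTree B ∈ treesMajorisedBy B ∧
          ∀ T ∈ treesMajorisedBy B, I (greedyTree B) ≤ I T) ∧
      (StrictlyDecreasingRule ρ f → SingleIsStrictMax ρ →
        mTree B ∈ treesMajorisedBy B ∧
          ∀ T ∈ treesMajorisedBy B, I (mTree B) ≤ I T)) := by
  -- Stated for an arbitrary invariant, so that it applies to `I` and to `-I`.
  have key : ∀ J : FinTree → ℝ, IsTreeInvariant J → MaxCompatible ρ J →
      (StrictlyIncreasingRule ρ f → greedyTree B ∈ treesMajorisedBy B ∧
        ∀ T ∈ treesMajorisedBy B, J T ≤ J (greedyTree B)) ∧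
      (StrictlyDecreasingRule ρ f → mTree B ∈ treesMajorisedBy B ∧
        ∀ T ∈ treesMajorisedBy B, J T ≤ J (mTree B)) := fun J hJ hc =>
    ⟨fun hi => isGreatest_of_degrees hJ hc hB fun _ hT hs =>
        ConfigTree.le_greedyTree hJ hc hf hi hT hs,
      fun hd => isGreatest_of_degrees hJ hc hB fun _ hT hs =>
        ConfigTree.le_mTree hJ hc hf hd hT hs⟩
  refine ⟨fun hc => ⟨fun hi _ => (key I hI hc).1 hi, fun hd _ => (key I hI hc).2 hd⟩, fun hc => ?_⟩
  obtain ⟨h1, h2⟩ := key (-I) hI.neg hc.neg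
  exact ⟨fun hi _ => ⟨(h1 hi).1, fun T hT => neg_le_neg_iff.1 ((h1 hi).2 T hT)⟩,
    fun hd _ => ⟨(h2 hd).1, fun T hT => neg_le_neg_iff.1 ((h2 hd).2 T hT)⟩⟩
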